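/- Let $V\in L^1(\mathbb R^3;\mathbb R)$ be even, $V(-x)=V(x)$ for almost every $x$, with $\int_{\mathbb R^3}(1+|p|^2)\,|\widehat V(p)|\,dp<\infty$. For $N\in\mathbb N$, $N\ge 1$, put $\hbar=N^{-1/3}$. For a bounded operator $\omega$ on $L^2(\mathbb R^3)$ write $\operatorname{tr}|A|$ for the trace norm of $A$, let $e^{ip\cdot x}$ denote the multiplication operator, and set $\operatorname{tr}|[\omega,\hbar\nabla]|=\sum_{j=1}^3\operatorname{tr}|[\omega,\hbar\partial_j]|$, where $[\omega,\hbar\partial_j]$ is understood as the bounded operator $D$ with $\langle\varphi,D\psi\rangle=\langle\varphi,\omega\hbar\partial_j\psi\rangle+\langle\hbar\partial_j\varphi,\omega\psi\rangle$ for all Schwartz functions $\varphi,\psi$ (and the trace norm is $+\infty$ if there is no such $D$). Then there are constants $K,c>0$, depending only on $V$, such that the following holds for every $N\ge 1$ and every $C\ge 0$. Let $\omega_N$ be a non-negative trace class operator on $L^2(\mathbb R^3)$ with $\operatorname{tr}\omega_N=N$, $\|\omega_N\|\le 1$ and $$\sup_{p\in\mathbb R^3}\frac1{1+|p|}\operatorname{tr}|[\omega_N,e^{ip\cdot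 x}]|\le CN\hbar,\qquad \operatorname{tr}|[\omega_N,\hbar\nabla]|\le CN\hbar .$$ Let $t\mapsto\omega_{N,t}$, $t\in\mathbb R$, be a solution of the Hartree–Fock equation $$i\hbar\,\partial_t\omega_{N,t}=\big[-\hbar^2\Delta+(V*\rho_t)-X_t,\ \omega_{N,t}\big],\qquad \omega_{N,0}=\omega_N,$$ where $\rho_t(x)=N^{-1}\omega_{N,t}(x;x)$ is the normalized density and $X_t$ is the operator with integral kernel $X_t(x;y)=N^{-1}V(x-y)\,\omega_{N,t}(x;y)$; here a solution is a trace-norm continuous curve of trace class operators which satisfies the equation as an identity of sesquilinear forms on Schwartz functions. Then for all $t\in\mathbb R$ $$\sup_{p\in\mathbb R^3}\frac1{1+|p|}\operatorname{tr}|[\omega_{N,t},e^{ip\cdot x}]|\le K\,C\,N\hbar\,e^{c|t|},\qquad \operatorname{tr}|[\omega_{N,t},\hbar\nabla]|\le K\,C\,N\hbar\,e^{c|t|}.$$ -/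

import Mathlib

open MeasureTheory
open scoped ENNReal FourierTransform SchwartzMap InnerProductSpace

namespace HartreeFock

noncomputable section

/-- Configuration space `ℝ³` with the Euclidean norm. -/
abbrev R3 : Type := EuclideanSpace ℝ (Fin 3)

/-- The one-particle Hilbert space `L²(ℝ³; ℂ)`. -/
abbrev L2 : Type := Lp ℂ 2 (volume : Measure R3)

/-- Bounded operators on `L²(ℝ³)`. -/
abbrev Op : Type := L2 →L[ℂ] L2

/-! ### Trace and trace norm -/

section Trace

variable {H : Type*} [NormedAddCommGroup H] [InnerProductSpace ℂ H] [CompleteSpace H]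

/-- The absolute value `|A| = √(A* A)` of a bounded operator. -/
def absOp (A : H →L[ℂ] H) : H →L[ℂ] H := CFC.abs A

variable (H) in
/-- A Hilbert basis of `H`. The traces below do not depend on the choice of the basis. -/
def onb : HilbertBasis (exists_hilbertBasis ℂ H).choose ℂ H :=
  (exists_hilbertBasis ℂ H).choose_spec.choose

/-- The trace norm `tr |A|` as an extended non-negative number. -/
def traceNorm (A : H →L[ℂ] H) : ℝ≥0∞ :=
  ∑' i, ENNReal.ofReal (⟪onb H i, absOp A (onb H i)⟫_ℂ).re

/-- `A` is trace class. -/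
def IsTraceClass (A : H →L[ℂ] H) : Prop := traceNorm A < ∞

/-- The trace of a trace-class operator (the series converges absolutely for such operators). -/
def opTrace (A : H →L[ℂ] H) : ℂ := ∑' i, ⟪onb H i, A (onb H i)⟫_ℂ

end Trace

/-! ### Multiplication operators, integral kernels, densities -/

/-- The operator of multiplication by an essentially bounded function `f`
(and `0` if `f` is not an essentially bounded measurable function). -/
def mulOp (f : R3 → ℂ) : Op :=
  open Classical in
  if hf : MemLp f ∞ (volume : Measure R3) then
    (ContinuousLinearMap.mul ℂ ℂ).holderL (volume : Measure R3) ∞ 2 2 hf.toLp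
  else 0

/-- The defining property of `mulOp`. -/
theorem mulOp_ae_eq {f : R3 → ℂ} (hf : MemLp f ∞ (volume : Measure R3)) (ψ : L2) :
    (mulOp f ψ : R3 → ℂ) =ᵐ[volume] fun x => f x * ψ x := by
  have h1 := ContinuousLinearMap.coeFn_holder (r := 2) (ContinuousLinearMap.mul ℂ ℂ) hf.toLp ψ
  have h2 := hf.coeFn_toLp
  have h3 : mulOp f ψ = (ContinuousLinearMap.mul ℂ ℂ).holder 2 hf.toLp ψ := by
    rw [mulOp, dif_pos hf]
    rfl
  rw [h3]
  filter_upwards [h1, h2] with x hx1 hx2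
  rw [hx1, hx2]
  rfl

/-- The function `x ↦ e^{i p · x}`. -/
def planeWave (p : R3) (x : R3) : ℂ := Complex.exp (Complex.I * (⟪p, x⟫_ℝ : ℂ))

/-- Plane waves are essentially bounded, so that `mulOp (planeWave p)` is what it should be. -/
theorem memLp_planeWave (p : R3) : MemLp (planeWave p) ∞ (volume : Measure R3) := by
  refine memLp_top_of_bound (C := 1) ?_ (Filter.Eventually.of_forall fun x => ?_)
  · have : Continuous (planeWave p) := by unfold planeWave; fun_prop
    exact this.aestronglyMeasurable
  · rw [planeWave, mul_comm, Complex.norm_exp_ofReal_mul_I]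

/-- `k` is a square-integrable integral kernel of the operator `A`:
`(A ψ)(x) = ∫ k(x;y) ψ(y) dy`. Such an operator is Hilbert-Schmidt, every Hilbert-Schmidt
operator has such a kernel, and the kernel is unique almost everywhere. -/
def HasKernel (A : Op) (k : R3 × R3 → ℂ) : Prop :=
  MemLp k 2 ((volume : Measure R3).prod (volume : Measure R3)) ∧
    ∀ ψ : L2, (A ψ : R3 → ℂ) =ᵐ[volume] fun x => ∫ y, k (x, y) * ψ y

/-- `ρ` is the normalized density `ρ(x) = N⁻¹ ω(x;x)` of the trace-class operator `ω`.
The diagonal of the kernel of a trace-class operator is the integrable function determined by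
`N⁻¹ tr (f ω) = ∫ f(x) ρ(x) dx` for all bounded functions `f`, where on the left `f` stands for
the multiplication operator. -/
def IsDensity (N : ℕ) (ω : Op) (ρ : R3 → ℂ) : Prop :=
  Integrable ρ ∧ ∀ f : R3 → ℂ, MemLp f ∞ (volume : Measure R3) →
    ∫ x, f x * ρ x = (N : ℂ)⁻¹ * opTrace (mulOp f ∘L ω)

/-- `X` is the exchange operator of `ω`, i.e. `X(x;y) = N⁻¹ V(x-y) ω(x;y)`. -/
def IsExchange (V : R3 → ℝ) (N : ℕ) (ω X : Op) : Prop :=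
  ∃ k : R3 × R3 → ℂ, HasKernel ω k ∧
    HasKernel X (fun z => (N : ℂ)⁻¹ * (V (z.1 - z.2) : ℂ) * k z)

/-- The operator of multiplication by `(V * ρ)(x) = ∫ V(y) ρ(x-y) dy`. For integrable `ρ` and
integrable `V` with integrable Fourier transform the function `V * ρ` is bounded. -/
def directOp (V : R3 → ℝ) (ρ : R3 → ℂ) : Op :=
  mulOp (convolution V ρ (ContinuousLinearMap.lsmul ℝ ℝ) volume)

/-! ### The Hartree-Fock equation -/

/-- The semiclassical parameter `ħ = N^{-1/3}`. -/
def hbar (N : ℕ) : ℝ := (N : ℝ) ^ (-(1 / 3) : ℝ)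

/-- A Schwartz function as an element of `L²(ℝ³)`. -/
abbrev toL2 (φ : 𝓢(R3, ℂ)) : L2 := φ.toLp 2 (volume : Measure R3)

/-- `-ħ²Δφ` as an element of `L²(ℝ³)`. -/
def kinetic (N : ℕ) (φ : 𝓢(R3, ℂ)) : L2 :=
  -((hbar N : ℂ) ^ 2 • toL2 (Laplacian.laplacian φ))

/-- `ω` is a (global in time) solution of the Hartree-Fock equation
`iħ ∂ₜ ωₜ = [-ħ²Δ + V*ρₜ - Xₜ, ωₜ]`: a trace-norm continuous curve of trace-class operators which
satisfies the equation when both sides are taken as sesquilinear forms on Schwartz functions.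
The part of the commutator with the unbounded operator `-ħ²Δ` is the form
`(φ, ψ) ↦ ⟪-ħ²Δφ, ωₜ ψ⟫ - ⟪φ, ωₜ (-ħ²Δψ)⟫`. -/
structure IsHFSolution (V : R3 → ℝ) (N : ℕ) (ω : ℝ → Op) : Prop where
  traceClass : ∀ t, IsTraceClass (ω t)
  continuous : ∀ t, Filter.Tendsto (fun s => traceNorm (ω s - ω t)) (nhds t) (nhds 0)
  equation : ∀ t, ∃ (ρ : R3 → ℂ) (X : Op), IsDensity N (ω t) ρ ∧ IsExchange V N (ω t) X ∧
    ∀ φ ψ : 𝓢(R3, ℂ),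
      HasDerivAt (fun s => Complex.I * (hbar N : ℂ) * ⟪toL2 φ, ω s (toL2 ψ)⟫_ℂ)
        (⟪kinetic N φ, ω t (toL2 ψ)⟫_ℂ - ⟪toL2 φ, ω t (kinetic N ψ)⟫_ℂ
          + ⟪toL2 φ, ((directOp V ρ - X) ∘L ω t - ω t ∘L (directOp V ρ - X)) (toL2 ψ)⟫_ℂ) t

/-! ### The semiclassical commutators -/

/-- The commutator `[A, B]` of bounded operators. -/
def comm (A B : Op) : Op := A ∘L B - B ∘L A

/-- `ħ∂ⱼφ` as an element of `L²(ℝ³)`. -/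
def hbarDeriv (N : ℕ) (j : Fin 3) (φ : 𝓢(R3, ℂ)) : L2 :=
  (hbar N : ℂ) • toL2 (LineDeriv.lineDerivOp (EuclideanSpace.single j (1 : ℝ)) φ)

/-- `D` is the bounded operator `[ω, ħ∂ⱼ]`: since `∂ⱼ` is skew-adjoint this says that
`⟪φ, D ψ⟫ = ⟪φ, ω ħ∂ⱼψ⟫ + ⟪ħ∂ⱼφ, ω ψ⟫` for Schwartz functions. By density, there is at most
one such `D`. -/
def IsGradComm (N : ℕ) (j : Fin 3) (ω D : Op) : Prop :=
  ∀ φ ψ : 𝓢(R3, ℂ), ⟪toL2 φ, D (toL2 ψ)⟫_ℂ =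
    ⟪toL2 φ, ω (hbarDeriv N j ψ)⟫_ℂ + ⟪hbarDeriv N j φ, ω (toL2 ψ)⟫_ℂ

/-- `tr |[ω, ħ∇]| = ∑ⱼ tr |[ω, ħ∂ⱼ]|`; a summand is `∞` if the commutator `[ω, ħ∂ⱼ]` does not
extend to a bounded operator (and otherwise the infimum is over exactly one operator). -/
def gradCommNorm (N : ℕ) (ω : Op) : ℝ≥0∞ :=
  ∑ j : Fin 3, ⨅ (D : Op) (_ : IsGradComm N j ω D), traceNorm D

/-- `sup_p (1+|p|)⁻¹ tr |[ω, e^{ip·x}]|`. -/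
def waveCommNorm (ω : Op) : ℝ≥0∞ :=
  ⨆ p : R3, ENNReal.ofReal (1 / (1 + ‖p‖)) * traceNorm (comm ω (mulOp (planeWave p)))

end

end HartreeFock

open MeasureTheory
open scoped ENNReal FourierTransform SchwartzMap InnerProductSpace

namespace HartreeFock

noncomputable section

/-! ### Hilbert–Schmidt and trace norms -/

section TraceClass

variable {H : Type*} [NormedAddCommGroup H] [InnerProductSpace ℂ H] [CompleteSpace H]

open ContinuousLinearMap Filter
open scoped Topology

/-! The mean field W = V*ρ - X enters the evolution with a prefactor ħ⁻¹, so the double commutator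
[[W, A], ω] must yield a factor ħ for the observables A of interest. In Fourier variables W is a
superposition, with weight N⁻¹V̂(ξ) and q = 2πξ, of the operators tr(e^{-iq·x}ω) e^{iq·x} - e^{iq·x}
ω e^{-iq·x} (`isWeakIntegral_meanField`). Let A = e^{ip·x}T_a be a Weyl operator with |a| = O(ħ). In
the direct term, [e^{iq·x}, A] = (1 - e^{iq·a}) e^{iq·x}A, which gains |q||a| = O(ħ|q|), while N⁻¹
tr|ω| ≤ 1. In the exchange term, the commutator with A is a phase times e^{iq·x}[ω, A]e^{-iq·x}, and
N⁻¹ ≤ ħ together with ‖ω‖ ≤ 1 suffices. Both contributions are again bounded by commutators of ω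
with A and with plane waves (`traceNorm_comm_comm_le`).

The kinetic energy is removed by the interaction picture. Free evolution maps e^{ip·x}T_a to a phase
times e^{ip·x}T_{a+2ħtp} (`interaction_weylOp`), so for |t| ≤ 1 the Weyl operators with |p| ≤ 1 stay
within displacements of order ħ. By the Jacobi identity the derivative of [ω, A] is the sum of a
commutator of [ω, A] with a self-adjoint generator, which does not change its trace norm to first
order, and of the double commutator above. Gronwall's inequality for the supremum over a family of
observables closes the estimate (`iSup_traceNorm_comm_le`). Frequencies |p| > 1 follow from
subadditivity of p ↦ tr|[ω, e^{ip·x}]|, which costs the factor 1+|p|.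

Since plane waves generate translations under the free flow, the gradient has to be controlled
simultaneously. It is replaced by translations: tr|[ω, T_a]| ≤ (|a|/ħ) tr|[ω, ħ∇]|
(`traceNorm_comm_transOp_le`), and conversely a uniform bound on (ħ/|b|) tr|[ω, T_b]| for small b
returns the gradient commutator by weak compactness (`exists_isGradComm`). The family therefore
contains one rescaled translation (ħ/|b|)T_b, with estimates independent of b, and all observables
remain bounded operators. One unit of time multiplies the larger of the two norms by at most a
constant K depending only on V; iteration gives the exponential.

A solution satisfies the equation only weakly on Schwartz functions and is not assumed self-adjoint.
Duality of the trace norm upgrades the weak equation to a trace-norm derivative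
(`hasTraceDerivAt_interaction`), a Gronwall argument for ω - ω* gives self-adjointness
(`adjoint_eq_of_deriv`), and then trace norm and operator norm do not exceed their initial values
(`IsMeanFieldFlow.le_initial`). -/

/-- The square of the Hilbert–Schmidt norm. -/
def hsSq (A : H →L[ℂ] H) : ℝ≥0∞ := ∑' i, ‖A (onb H i)‖ₑ ^ 2

omit [CompleteSpace H] in
theorem tsum_enorm_inner_sq {ι : Type*} (b : HilbertBasis ι ℂ H) (x : H) :
    ∑' i, ‖⟪b i, x⟫_ℂ‖ₑ ^ 2 = ‖x‖ₑ ^ 2 := by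
  have h := b.hasSum_inner_mul_inner x x
  have h2 : HasSum (fun i => ‖⟪b i, x⟫_ℂ‖ ^ 2) (‖x‖ ^ 2) := by
    have h3 := (Complex.hasSum_re h)
    convert h3 using 1
    · ext i
      rw [← inner_conj_symm x (b i), mul_comm, Complex.mul_conj, Complex.normSq_eq_norm_sq]
      norm_cast
    · rw [inner_self_eq_norm_sq_to_K]
      norm_cast
  have h4 := h2.tsum_eq
  have : ∀ y : ℂ, ‖y‖ₑ ^ 2 = ENNReal.ofReal (‖y‖ ^ 2) := fun y => by
    rw [ENNReal.ofReal_pow (norm_nonneg _), ofReal_norm]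
  simp_rw [this]
  rw [← ENNReal.ofReal_tsum_of_nonneg (fun _ => by positivity) h2.summable, h4,
    ENNReal.ofReal_pow (norm_nonneg _), ofReal_norm]

/-- By Parseval both sides are the sum of the squared moduli of all matrix elements, taken in the
two possible orders. -/
theorem hsSq_adjoint (A : H →L[ℂ] H) : hsSq (adjoint A) = hsSq A := by
  unfold hsSq
  simp_rw [← tsum_enorm_inner_sq (onb H)]
  rw [ENNReal.tsum_comm]
  refine tsum_congr fun i => tsum_congr fun j => ?_
  rw [adjoint_inner_right, ← inner_conj_symm, RCLike.enorm_conj]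

theorem hsSq_comp_le_left (B A : H →L[ℂ] H) : hsSq (B ∘L A) ≤ ‖B‖ₑ ^ 2 * hsSq A := by
  unfold hsSq
  rw [← ENNReal.tsum_mul_left]
  refine ENNReal.tsum_le_tsum fun i => ?_
  rw [← mul_pow]
  gcongr
  exact B.le_opENorm _

theorem enorm_adjoint (A : H →L[ℂ] H) : ‖adjoint A‖ₑ = ‖A‖ₑ := by
  rw [← ofReal_norm, ← ofReal_norm, LinearIsometryEquiv.norm_map]

theorem hsSq_comp_le_right (A B : H →L[ℂ] H) : hsSq (A ∘L B) ≤ ‖B‖ₑ ^ 2 * hsSq A := by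
  rw [← hsSq_adjoint, adjoint_comp, ← hsSq_adjoint A, ← enorm_adjoint B]
  exact hsSq_comp_le_left _ _

theorem enorm_sq_le_hsSq (A : H →L[ℂ] H) : ‖A‖ₑ ^ 2 ≤ hsSq A := by
  rcases eq_or_ne (hsSq A) ∞ with h | h
  · simp [h]
  have key : ∀ x, ‖A x‖ₑ ^ 2 ≤ hsSq A * ‖x‖ₑ ^ 2 := fun x => by
    rw [← tsum_enorm_inner_sq (onb H), ← hsSq_adjoint, hsSq, ← ENNReal.tsum_mul_right]
    refine ENNReal.tsum_le_tsum fun i => ?_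
    rw [← adjoint_inner_left, ← mul_pow]
    gcongr
    have := norm_inner_le_norm (𝕜 := ℂ) (adjoint A (onb H i)) x
    rw [← ofReal_norm, ← ofReal_norm, ← ofReal_norm, ← ENNReal.ofReal_mul (norm_nonneg _)]
    exact ENNReal.ofReal_le_ofReal this
  have h2 : ‖A‖ ≤ Real.sqrt (hsSq A).toReal := by
    refine opNorm_le_bound _ (Real.sqrt_nonneg _) fun x => ?_
    have := ENNReal.toReal_mono (by finiteness) (key x)
    rw [ENNReal.toReal_pow, ENNReal.toReal_mul, ENNReal.toReal_pow, toReal_enorm, toReal_enorm]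
      at this
    rw [← Real.sqrt_sq (norm_nonneg x), ← Real.sqrt_mul ENNReal.toReal_nonneg]
    exact Real.le_sqrt_of_sq_le this
  have h3 : ‖A‖ ^ 2 ≤ (hsSq A).toReal := by
    rw [← Real.sq_sqrt (ENNReal.toReal_nonneg (a := hsSq A))]
    gcongr
  rw [← ofReal_norm, ← ENNReal.ofReal_pow (norm_nonneg _)]
  exact ENNReal.ofReal_le_of_le_toReal h3

theorem norm_absOp_apply (A : H →L[ℂ] H) (x : H) : ‖absOp A x‖ = ‖A x‖ := by
  have h1 : adjoint (absOp A) = absOp A := (CFC.abs_nonneg A).isSelfAdjoint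
  have h2 : absOp A ∘L absOp A = adjoint A ∘L A := CFC.abs_mul_abs A
  have h3 : ⟪absOp A x, absOp A x⟫_ℂ = ⟪A x, A x⟫_ℂ := by
    rw [← adjoint_inner_right, h1, ← ContinuousLinearMap.comp_apply, h2,
      ContinuousLinearMap.comp_apply, adjoint_inner_right]
  rw [inner_self_eq_norm_sq_to_K, inner_self_eq_norm_sq_to_K] at h3
  have h4 : ‖absOp A x‖ ^ 2 = ‖A x‖ ^ 2 := by exact_mod_cast h3
  exact (sq_eq_sq₀ (norm_nonneg _) (norm_nonneg _)).1 h4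

/-- Polar decomposition. -/
theorem exists_polar (A : H →L[ℂ] H) :
    ∃ U : H →L[ℂ] H, ‖U‖ ≤ 1 ∧ A = U ∘L absOp A ∧ absOp A = adjoint U ∘L A := by
  set R := absOp A
  set K : Submodule ℂ H := (LinearMap.range (R : H →ₗ[ℂ] H)).topologicalClosure with hK
  have hmem : ∀ x, R x ∈ K := fun x => Submodule.le_topologicalClosure _ ⟨x, rfl⟩
  have : CompleteSpace K := (Submodule.isClosed_topologicalClosure _).completeSpace_coe
  let e : H →ₗ[ℂ] K := (R : H →ₗ[ℂ] H).codRestrict K hmem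
  have hde : DenseRange e := by
    intro y
    rw [Metric.mem_closure_iff]
    intro ε hε
    have hy : (y : H) ∈ closure (Set.range R) := y.2
    obtain ⟨_, ⟨x, rfl⟩, hx⟩ := Metric.mem_closure_iff.1 hy ε hε
    exact ⟨e x, ⟨x, rfl⟩, hx⟩
  -- Since ‖|A|x‖ = ‖Ax‖, the assignment |A|x ↦ Ax is isometric and extends to the closure of the
  -- range of |A|; composing with the orthogonal projection makes it zero on the complement.
  have hb : ∀ x, ‖(A : H →ₗ[ℂ] H) x‖ ≤ 1 * ‖e x‖ := fun x => by
    rw [one_mul]; exact (norm_absOp_apply A x).ge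
  let f : K →L[ℂ] H := LinearMap.extendOfNorm (A : H →ₗ[ℂ] H) e
  have hf : ∀ x, f (e x) = A x := fun x => LinearMap.extendOfNorm_eq hde ⟨1, hb⟩ x
  have hfn : ‖f‖ ≤ 1 := LinearMap.opNorm_extendOfNorm_le hde zero_le_one hb
  let U : H →L[ℂ] H := f ∘L K.orthogonalProjectionOnto
  have hU : ‖U‖ ≤ 1 := by
    refine (opNorm_comp_le _ _).trans ?_
    have := K.orthogonalProjectionOnto_norm_le
    nlinarith [norm_nonneg f, norm_nonneg (K.orthogonalProjectionOnto)]
  have hUR : ∀ x, U (R x) = A x := fun x => by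
    have : K.orthogonalProjectionOnto (R x) = e x :=
      Submodule.orthogonalProjectionOnto_mem_subspace_eq_self (K := K) (e x)
    change f (K.orthogonalProjectionOnto (R x)) = _
    rw [this, hf]
  refine ⟨U, hU, by ext x; exact (hUR x).symm, ?_⟩
  ext x
  have hUa : ‖adjoint U‖ ≤ 1 := by rwa [LinearIsometryEquiv.norm_map]
  have h1 : ‖adjoint U (A x)‖ ≤ ‖R x‖ := by
    rw [norm_absOp_apply]
    exact ((adjoint U).le_opNorm _).trans (mul_le_of_le_one_left (norm_nonneg _) hUa)
  -- The cross term is ⟪Ax, U|A|x⟫ = ‖Ax‖², while both squares are at most ‖Ax‖². This gives |A| =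
  -- U*A without identifying U*U as a projection.
  have h2 : ‖adjoint U (A x) - R x‖ ^ 2 ≤ 0 := by
    rw [@norm_sub_sq ℂ, adjoint_inner_left, hUR, inner_self_eq_norm_sq, norm_absOp_apply A x]
    rw [norm_absOp_apply A x] at h1
    nlinarith [norm_nonneg (adjoint U (A x)), norm_nonneg (A x)]
  have h3 : ‖adjoint U (A x) - R x‖ = 0 := by
    nlinarith [norm_nonneg (adjoint U (A x) - R x)]
  rw [norm_eq_zero, sub_eq_zero] at h3
  exact h3.symm

/-! ### The trace norm: factorization, duality and the ideal property. -/

theorem traceNorm_eq_hsSq (A : H →L[ℂ] H) : traceNorm A = hsSq (CFC.sqrt (absOp A)) := by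
  have h1 : adjoint (CFC.sqrt (absOp A)) = CFC.sqrt (absOp A) :=
    (CFC.sqrt_nonneg (absOp A)).isSelfAdjoint
  have h2 : CFC.sqrt (absOp A) ∘L CFC.sqrt (absOp A) = absOp A :=
    CFC.sqrt_mul_sqrt_self _ (CFC.abs_nonneg A)
  unfold traceNorm hsSq
  refine tsum_congr fun i => ?_
  conv_lhs => rw [← h2]
  rw [ContinuousLinearMap.comp_apply, ← adjoint_inner_left, h1, inner_self_eq_norm_sq_to_K,
    ← ofReal_norm, ← ENNReal.ofReal_pow (norm_nonneg _)]
  congr 1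
  norm_cast

omit [CompleteSpace H] in
theorem enorm_sq_le_one {U : H →L[ℂ] H} (hU : ‖U‖ ≤ 1) : ‖U‖ₑ ^ 2 ≤ 1 := by
  refine pow_le_one₀ zero_le ?_
  rw [← ofReal_norm]
  exact ENNReal.ofReal_le_one.2 hU

/-- A trace class operator is a product of two Hilbert–Schmidt operators. -/
theorem exists_factor (A : H →L[ℂ] H) :
    ∃ P Q : H →L[ℂ] H, A = P ∘L Q ∧ hsSq P ≤ traceNorm A ∧ hsSq Q ≤ traceNorm A := by
  obtain ⟨U, hU, hA, -⟩ := exists_polar A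
  have h2 : CFC.sqrt (absOp A) ∘L CFC.sqrt (absOp A) = absOp A :=
    CFC.sqrt_mul_sqrt_self _ (CFC.abs_nonneg A)
  refine ⟨U ∘L CFC.sqrt (absOp A), CFC.sqrt (absOp A), ?_, ?_, ?_⟩
  · rw [ContinuousLinearMap.comp_assoc, h2]; exact hA
  · rw [traceNorm_eq_hsSq]
    refine (hsSq_comp_le_left _ _).trans (mul_le_of_le_one_left zero_le (enorm_sq_le_one hU))
  · rw [traceNorm_eq_hsSq]

omit [CompleteSpace H] in
theorem two_mul_enorm_inner_le (x y : H) : 2 * ‖⟪x, y⟫_ℂ‖ₑ ≤ ‖x‖ₑ ^ 2 + ‖y‖ₑ ^ 2 := by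
  rw [← ofReal_norm, ← ofReal_norm, ← ofReal_norm, ← ENNReal.ofReal_pow (norm_nonneg _),
    ← ENNReal.ofReal_pow (norm_nonneg _), ← ENNReal.ofReal_add (by positivity) (by positivity),
    ← ENNReal.ofReal_ofNat, ← ENNReal.ofReal_mul (by norm_num)]
  refine ENNReal.ofReal_le_ofReal ?_
  have := norm_inner_le_norm (𝕜 := ℂ) x y
  nlinarith [sq_nonneg (‖x‖ - ‖y‖)]

/-- The arithmetic-geometric mean inequality replaces Cauchy–Schwarz. Nothing is lost in the
applications, because `exists_factor` bounds both factors by the same number. -/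
theorem tsum_inner_comp_le (P Q S T : H →L[ℂ] H) (hS : ‖S‖ ≤ 1) (hT : ‖T‖ ≤ 1) :
    2 * ∑' i, ‖⟪S (onb H i), P (Q (T (onb H i)))⟫_ℂ‖ₑ ≤ hsSq P + hsSq Q := by
  rw [← ENNReal.tsum_mul_left]
  calc _ ≤ ∑' i, (‖(adjoint P ∘L S) (onb H i)‖ₑ ^ 2 + ‖(Q ∘L T) (onb H i)‖ₑ ^ 2) := by
        refine ENNReal.tsum_le_tsum fun i => ?_
        rw [← adjoint_inner_left]
        exact two_mul_enorm_inner_le _ _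
    _ = hsSq (adjoint P ∘L S) + hsSq (Q ∘L T) := ENNReal.tsum_add
    _ ≤ _ := by
        refine add_le_add ?_ ?_
        · refine (hsSq_comp_le_right _ _).trans ?_
          rw [hsSq_adjoint]
          exact mul_le_of_le_one_left zero_le (enorm_sq_le_one hS)
        · exact (hsSq_comp_le_right _ _).trans
            (mul_le_of_le_one_left zero_le (enorm_sq_le_one hT))

theorem tsum_enorm_inner_le_traceNorm (A S T : H →L[ℂ] H) (hS : ‖S‖ ≤ 1) (hT : ‖T‖ ≤ 1) :
    ∑' i, ‖⟪S (onb H i), A (T (onb H i))⟫_ℂ‖ₑ ≤ traceNorm A := by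
  obtain ⟨P, Q, hA, hP, hQ⟩ := exists_factor A
  have h := tsum_inner_comp_le P Q S T hS hT
  have h2 : 2 * ∑' i, ‖⟪S (onb H i), A (T (onb H i))⟫_ℂ‖ₑ ≤ 2 * traceNorm A := by
    rw [two_mul (traceNorm A)]
    refine le_trans ?_ (add_le_add hP hQ)
    simpa [hA] using h
  exact (ENNReal.mul_le_mul_iff_right (by norm_num) (by norm_num)).1 h2

theorem enorm_sum_inner_le_traceNorm (A S T : H →L[ℂ] H) (hS : ‖S‖ ≤ 1) (hT : ‖T‖ ≤ 1)
    (s : Finset (exists_hilbertBasis ℂ H).choose) :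
    ‖∑ i ∈ s, ⟪S (onb H i), A (T (onb H i))⟫_ℂ‖ₑ ≤ traceNorm A :=
  (enorm_sum_le _ _).trans ((ENNReal.sum_le_tsum s).trans
    (tsum_enorm_inner_le_traceNorm A S T hS hT))

/-- The polar factor U satisfies |A| = U*A, so S = U turns the partial sums of the trace of |A| into
the sums being tested. Only finite sums of matrix elements occur, hence bounds pass through weak
limits, weak integrals and weak derivatives; most trace-norm estimates below rest on this. -/
theorem traceNorm_le_of_forall {A : H →L[ℂ] H} {M : ℝ≥0∞}
    (h : ∀ S : H →L[ℂ] H, ‖S‖ ≤ 1 → ∀ s : Finset (exists_hilbertBasis ℂ H).choose,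
      ‖∑ i ∈ s, ⟪S (onb H i), A (onb H i)⟫_ℂ‖ₑ ≤ M) : traceNorm A ≤ M := by
  obtain ⟨U, hU, -, hA⟩ := exists_polar A
  unfold traceNorm
  rw [ENNReal.tsum_eq_iSup_sum]
  refine iSup_le fun s => ?_
  have hnn : ∀ i, 0 ≤ (⟪onb H i, absOp A (onb H i)⟫_ℂ).re := fun i => by
    have := (ContinuousLinearMap.nonneg_iff_isPositive (absOp A)).1 (CFC.abs_nonneg A)
    exact this.re_inner_nonneg_right _
  rw [← ENNReal.ofReal_sum_of_nonneg fun i _ => hnn i]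
  refine le_trans ?_ (h U hU s)
  rw [← ofReal_norm]
  refine ENNReal.ofReal_le_ofReal ?_
  rw [← Complex.re_sum]
  refine (Complex.re_le_norm _).trans (le_of_eq ?_)
  congr 1
  refine Finset.sum_congr rfl fun i _ => ?_
  rw [hA, ContinuousLinearMap.comp_apply, adjoint_inner_right]

theorem two_mul_traceNorm_comp_le (P Q : H →L[ℂ] H) :
    2 * traceNorm (P ∘L Q) ≤ hsSq P + hsSq Q := by
  have : traceNorm (P ∘L Q) ≤ (hsSq P + hsSq Q) / 2 := by
    refine traceNorm_le_of_forall fun S hS s => ?_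
    rw [ENNReal.le_div_iff_mul_le (by norm_num) (by norm_num), mul_comm]
    refine le_trans ?_ (tsum_inner_comp_le P Q S 1 hS ContinuousLinearMap.norm_id_le)
    gcongr
    exact (enorm_sum_le _ _).trans (ENNReal.sum_le_tsum s)
  rw [ENNReal.le_div_iff_mul_le (by norm_num) (by norm_num), mul_comm] at this
  exact this

theorem traceNorm_add_le (A B : H →L[ℂ] H) :
    traceNorm (A + B) ≤ traceNorm A + traceNorm B := by
  refine traceNorm_le_of_forall fun S hS s => ?_
  have h1 := enorm_sum_inner_le_traceNorm A S 1 hS ContinuousLinearMap.norm_id_le s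
  have h2 := enorm_sum_inner_le_traceNorm B S 1 hS ContinuousLinearMap.norm_id_le s
  simp only [add_apply, inner_add_right, Finset.sum_add_distrib]
  exact (enorm_add_le _ _).trans (add_le_add h1 h2)

theorem traceNorm_smul (c : ℂ) (A : H →L[ℂ] H) : traceNorm (c • A) = ‖c‖ₑ * traceNorm A := by
  have key : ∀ (c : ℂ) (A : H →L[ℂ] H), traceNorm (c • A) ≤ ‖c‖ₑ * traceNorm A := by
    intro c A
    refine traceNorm_le_of_forall fun S hS s => ?_
    have h1 := enorm_sum_inner_le_traceNorm A S 1 hS ContinuousLinearMap.norm_id_le s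
    simp only [smul_apply, inner_smul_right, ← Finset.mul_sum, enorm_mul]
    gcongr
    exact h1
  refine le_antisymm (key c A) ?_
  rcases eq_or_ne c 0 with rfl | hc
  · simp
  · have h := key c⁻¹ (c • A)
    rw [smul_smul, inv_mul_cancel₀ hc, one_smul, enorm_inv hc] at h
    calc ‖c‖ₑ * traceNorm A ≤ ‖c‖ₑ * (‖c‖ₑ⁻¹ * traceNorm (c • A)) := by gcongr
      _ = _ := by
        rw [← mul_assoc, ENNReal.mul_inv_cancel (by simpa using hc) (by simp), one_mul]

@[simp] theorem traceNorm_zero : traceNorm (0 : H →L[ℂ] H) = 0 := by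
  simpa using traceNorm_smul (0 : ℂ) (0 : H →L[ℂ] H)

theorem traceNorm_neg (A : H →L[ℂ] H) : traceNorm (-A) = traceNorm A := by
  simpa using traceNorm_smul (-1 : ℂ) A

theorem traceNorm_sub_le (A B : H →L[ℂ] H) :
    traceNorm (A - B) ≤ traceNorm A + traceNorm B := by
  rw [sub_eq_add_neg, ← traceNorm_neg B]
  exact traceNorm_add_le _ _

theorem traceNorm_adjoint (A : H →L[ℂ] H) : traceNorm (adjoint A) = traceNorm A := by
  have key : ∀ A : H →L[ℂ] H, traceNorm (adjoint A) ≤ traceNorm A := by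
    intro A
    obtain ⟨P, Q, hA, hP, hQ⟩ := exists_factor A
    have h := two_mul_traceNorm_comp_le (adjoint Q) (adjoint P)
    rw [← adjoint_comp, ← hA, hsSq_adjoint, hsSq_adjoint] at h
    refine (ENNReal.mul_le_mul_iff_right (a := 2) (by norm_num) (by norm_num)).1 (h.trans ?_)
    rw [two_mul]
    exact add_le_add hQ hP
  refine le_antisymm (key A) ?_
  simpa using key (adjoint A)

/-- For a contraction, B is absorbed into the left Hilbert–Schmidt factor of A; the general case
follows by scaling. -/
theorem traceNorm_comp_le_left (B A : H →L[ℂ] H) :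
    traceNorm (B ∘L A) ≤ ‖B‖ₑ * traceNorm A := by
  have key : ∀ B : H →L[ℂ] H, ‖B‖ ≤ 1 → traceNorm (B ∘L A) ≤ traceNorm A := by
    intro B hB
    obtain ⟨P, Q, hA, hP, hQ⟩ := exists_factor A
    have h := two_mul_traceNorm_comp_le (B ∘L P) Q
    rw [ContinuousLinearMap.comp_assoc, ← hA] at h
    refine (ENNReal.mul_le_mul_iff_right (a := 2) (by norm_num) (by norm_num)).1 (h.trans ?_)
    rw [two_mul]
    refine add_le_add ?_ hQ
    exact (hsSq_comp_le_left _ _).trans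
      ((mul_le_of_le_one_left zero_le (enorm_sq_le_one hB)).trans hP)
  rcases eq_or_ne B 0 with rfl | hB
  · simp
  have hn : (‖B‖ : ℂ) ≠ 0 := by simpa using hB
  have h1 : B = (‖B‖ : ℂ) • ((‖B‖ : ℂ)⁻¹ • B) := by
    rw [smul_smul, mul_inv_cancel₀ hn, one_smul]
  have h2 : ‖(‖B‖ : ℂ)⁻¹ • B‖ ≤ 1 := by
    rw [norm_smul, norm_inv, Complex.norm_real, norm_norm,
      inv_mul_cancel₀ (norm_ne_zero_iff.2 hB)]
  calc traceNorm (B ∘L A)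
      = traceNorm ((‖B‖ : ℂ) • (((‖B‖ : ℂ)⁻¹ • B) ∘L A)) := by
        rw [← ContinuousLinearMap.smul_comp, ← h1]
    _ = ‖(‖B‖ : ℂ)‖ₑ * traceNorm (((‖B‖ : ℂ)⁻¹ • B) ∘L A) := traceNorm_smul _ _
    _ ≤ ‖B‖ₑ * traceNorm A := by
        gcongr
        · rw [← ofReal_norm, Complex.norm_real, norm_norm, ofReal_norm]
        · exact key _ h2

theorem traceNorm_comp_le_right (A B : H →L[ℂ] H) :
    traceNorm (A ∘L B) ≤ ‖B‖ₑ * traceNorm A := by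
  rw [← traceNorm_adjoint, adjoint_comp, ← traceNorm_adjoint A, ← enorm_adjoint B]
  exact traceNorm_comp_le_left _ _

theorem enorm_le_traceNorm (A : H →L[ℂ] H) : ‖A‖ₑ ≤ traceNorm A := by
  obtain ⟨P, Q, hA, hP, hQ⟩ := exists_factor A
  have h : ‖A‖ₑ ≤ ‖P‖ₑ * ‖Q‖ₑ := by
    rw [← ofReal_norm, ← ofReal_norm, ← ofReal_norm, ← ENNReal.ofReal_mul (norm_nonneg _), hA]
    exact ENNReal.ofReal_le_ofReal (opNorm_comp_le _ _)
  have h2 : ‖A‖ₑ ^ 2 ≤ traceNorm A ^ 2 := by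
    calc ‖A‖ₑ ^ 2 ≤ (‖P‖ₑ * ‖Q‖ₑ) ^ 2 := by gcongr
      _ = ‖P‖ₑ ^ 2 * ‖Q‖ₑ ^ 2 := mul_pow _ _ _
      _ ≤ traceNorm A * traceNorm A :=
        mul_le_mul' ((enorm_sq_le_hsSq P).trans hP) ((enorm_sq_le_hsSq Q).trans hQ)
      _ = _ := (sq _).symm
  exact (ENNReal.pow_le_pow_left_iff (by norm_num)).1 h2

/-! ### The trace and its cyclicity. -/

theorem summable_of_tsum_enorm_ne_top {ι : Type*} {f : ι → ℂ} (h : ∑' i, ‖f i‖ₑ ≠ ∞) :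
    Summable f := by
  refine Summable.of_norm ?_
  have h2 : Summable fun i => ‖f i‖₊ := ENNReal.tsum_coe_ne_top_iff_summable.1 h
  exact NNReal.summable_coe.2 h2

theorem tsum_enorm_diag_le (A : H →L[ℂ] H) :
    ∑' i, ‖⟪onb H i, A (onb H i)⟫_ℂ‖ₑ ≤ traceNorm A :=
  tsum_enorm_inner_le_traceNorm A 1 1 ContinuousLinearMap.norm_id_le
    ContinuousLinearMap.norm_id_le

theorem summable_opTrace {A : H →L[ℂ] H} (hA : traceNorm A ≠ ∞) :
    Summable fun i => ⟪onb H i, A (onb H i)⟫_ℂ :=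
  summable_of_tsum_enorm_ne_top (ne_top_of_le_ne_top hA (tsum_enorm_diag_le A))

theorem enorm_opTrace_le {A : H →L[ℂ] H} (hA : traceNorm A ≠ ∞) :
    ‖opTrace A‖ₑ ≤ traceNorm A := by
  refine le_trans ?_ (tsum_enorm_diag_le A)
  have h := (summable_opTrace hA).hasSum
  refine le_of_tendsto (h.enorm) (Eventually.of_forall fun s => ?_)
  exact (enorm_sum_le _ _).trans (ENNReal.sum_le_tsum s)

theorem opTrace_sub {A B : H →L[ℂ] H} (hA : traceNorm A ≠ ∞) (hB : traceNorm B ≠ ∞) :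
    opTrace (A - B) = opTrace A - opTrace B := by
  unfold opTrace
  rw [← (summable_opTrace hA).tsum_sub (summable_opTrace hB)]
  simp

theorem opTrace_adjoint (A : H →L[ℂ] H) :
    opTrace (adjoint A) = (starRingEnd ℂ) (opTrace A) := by
  unfold opTrace
  rw [Complex.conj_tsum]
  refine tsum_congr fun i => ?_
  rw [adjoint_inner_right, inner_conj_symm]

/-- Both traces are double sums of products of matrix elements. The bound ab ≤ a² + b² and the
Hilbert–Schmidt norms make the double sum absolutely convergent, so the order can be exchanged. -/
theorem opTrace_comp_eq {P Q : H →L[ℂ] H} (hP : hsSq P ≠ ∞) (hQ : hsSq Q ≠ ∞) :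
    opTrace (P ∘L Q) = opTrace (Q ∘L P) := by
  have e1 : ∀ P Q : H →L[ℂ] H, opTrace (P ∘L Q) =
      ∑' i, ∑' k, ⟪onb H i, P (onb H k)⟫_ℂ * ⟪onb H k, Q (onb H i)⟫_ℂ := by
    intro P Q
    refine tsum_congr fun i => ?_
    rw [ContinuousLinearMap.comp_apply, ← adjoint_inner_left,
      ← (onb H).tsum_inner_mul_inner]
    simp only [adjoint_inner_left]
  rw [e1 P Q, e1 Q P]
  rw [Summable.tsum_comm]
  · refine tsum_congr fun i => tsum_congr fun k => mul_comm _ _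
  · refine summable_of_tsum_enorm_ne_top (ne_top_of_le_ne_top (b := hsSq P + hsSq Q)
      (by finiteness) ?_)
    have e2 : ∀ P : H →L[ℂ] H, hsSq P = ∑' i, ∑' k, ‖⟪onb H k, P (onb H i)⟫_ℂ‖ₑ ^ 2 := by
      intro P
      unfold hsSq
      simp_rw [tsum_enorm_inner_sq]
    have e3 : hsSq Q = ∑' i, ∑' k, ‖⟪onb H i, Q (onb H k)⟫_ℂ‖ₑ ^ 2 := by
      rw [e2 Q, ENNReal.tsum_comm]
    rw [e2 P, e3, ← ENNReal.tsum_add]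
    simp_rw [← ENNReal.tsum_add]
    rw [ENNReal.tsum_prod']
    refine ENNReal.tsum_le_tsum fun i => ENNReal.tsum_le_tsum fun k => ?_
    simp only [Function.uncurry, enorm_mul]
    set a := ‖⟪onb H k, P (onb H i)⟫_ℂ‖ₑ
    set b := ‖⟪onb H i, Q (onb H k)⟫_ℂ‖ₑ
    rcases le_total a b with h | h
    · calc a * b ≤ b * b := by gcongr
        _ = b ^ 2 := (sq b).symm
        _ ≤ _ := le_add_self
    · calc a * b ≤ a * a := by gcongr
        _ = a ^ 2 := (sq a).symm
        _ ≤ _ := le_self_add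

/-- Cyclicity of the trace. -/
theorem opTrace_comp_comm {A : H →L[ℂ] H} (hA : traceNorm A ≠ ∞) (B : H →L[ℂ] H) :
    opTrace (B ∘L A) = opTrace (A ∘L B) := by
  obtain ⟨P, Q, rfl, hP, hQ⟩ := exists_factor A
  have hP' := ne_top_of_le_ne_top hA hP
  have hQ' := ne_top_of_le_ne_top hA hQ
  have h1 : hsSq (B ∘L P) ≠ ∞ := ne_top_of_le_ne_top (by finiteness) (hsSq_comp_le_left B P)
  have h2 : hsSq (Q ∘L B) ≠ ∞ := ne_top_of_le_ne_top (by finiteness) (hsSq_comp_le_right Q B)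
  rw [← ContinuousLinearMap.comp_assoc, opTrace_comp_eq h1 hQ', ← ContinuousLinearMap.comp_assoc,
    ← opTrace_comp_eq hP' h2, ContinuousLinearMap.comp_assoc]

theorem traceNorm_eq_opTrace {A : H →L[ℂ] H} (hA : A.IsPositive) (h : traceNorm A ≠ ∞) :
    traceNorm A = ENNReal.ofReal (opTrace A).re := by
  have h1 : absOp A = A :=
    CFC.abs_of_nonneg A ((ContinuousLinearMap.nonneg_iff_isPositive A).2 hA)
  have hs := summable_opTrace h
  unfold traceNorm opTrace
  rw [Complex.re_tsum hs, ENNReal.ofReal_tsum_of_nonneg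
    (f := fun i => (⟪onb H i, A (onb H i)⟫_ℂ).re) (fun i => hA.re_inner_nonneg_right _)
    (Complex.hasSum_re hs.hasSum).summable, h1]

/-- Dominated convergence over the basis, with majorant M²‖P e_i‖². -/
theorem tendsto_hsSq_comp {ι : Type*} {l : Filter ι} {U : ι → H →L[ℂ] H} {M : ℝ}
    (hM : ∀ s, ‖U s‖ ≤ M) (hU : ∀ x, Tendsto (fun s => U s x) l (𝓝 0)) {P : H →L[ℂ] H}
    (hP : hsSq P ≠ ∞) : Tendsto (fun s => hsSq (U s ∘L P)) l (𝓝 0) := by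
  have e : ∀ x : H, ‖x‖ₑ ^ 2 = ENNReal.ofReal (‖x‖ ^ 2) := fun x => by
    rw [ENNReal.ofReal_pow (norm_nonneg _), ofReal_norm]
  have hs : Summable fun i => ‖P (onb H i)‖ ^ 2 := by
    have h2 : Summable fun i => ‖P (onb H i)‖₊ ^ 2 :=
      ENNReal.tsum_coe_ne_top_iff_summable.1 (by simpa [hsSq, enorm] using hP)
    have h3 := NNReal.summable_coe.2 h2
    simpa only [NNReal.coe_pow, coe_nnnorm] using h3
  have hle : ∀ s i, ‖(U s) (P (onb H i))‖ ^ 2 ≤ M ^ 2 * ‖P (onb H i)‖ ^ 2 := fun s i => by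
    rw [← mul_pow]
    gcongr
    exact ((U s).le_opNorm _).trans (by gcongr; exact hM s)
  have h1 : ∀ s, hsSq (U s ∘L P) = ENNReal.ofReal (∑' i, ‖(U s) (P (onb H i))‖ ^ 2) := by
    intro s
    rw [ENNReal.ofReal_tsum_of_nonneg (fun _ => by positivity)
      (Summable.of_nonneg_of_le (fun _ => by positivity) (hle s) (hs.mul_left _))]
    simp only [hsSq, e, ContinuousLinearMap.comp_apply]
  simp_rw [h1]
  rw [← ENNReal.ofReal_zero]
  refine ENNReal.tendsto_ofReal ?_
  have h0 : (0 : ℝ) = ∑' i : (exists_hilbertBasis ℂ H).choose, (0 : ℝ) := by simp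
  rw [h0]
  refine tendsto_tsum_of_dominated_convergence (hs.mul_left (M ^ 2)) (fun i => ?_)
    (Eventually.of_forall fun s i => ?_)
  · simpa using ((hU (P (onb H i))).norm.pow 2)
  · rw [Real.norm_of_nonneg (by positivity)]
    exact hle s i

theorem tendsto_traceNorm_comp_left {ι : Type*} {l : Filter ι} {U : ι → H →L[ℂ] H} {M : ℝ}
    (hM : ∀ s, ‖U s‖ ≤ M) (hU : ∀ x, Tendsto (fun s => U s x) l (𝓝 0)) {A : H →L[ℂ] H}
    (hA : traceNorm A ≠ ∞) : Tendsto (fun s => traceNorm (U s ∘L A)) l (𝓝 0) := by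
  obtain ⟨P, Q, rfl, hP, hQ⟩ := exists_factor A
  have hP' := ne_top_of_le_ne_top hA hP
  have hQ' := ne_top_of_le_ne_top hA hQ
  have hsm : ∀ (c : ℂ) (B : H →L[ℂ] H), hsSq (c • B) = ‖c‖ₑ ^ 2 * hsSq B := fun c B => by
    simp [hsSq, enorm_smul, mul_pow, ENNReal.tsum_mul_left]
  -- The factorization may be rescaled to (cP)(c⁻¹Q). First c is taken large to make the Q term
  -- small, then s is moved along the filter to make the remaining term small.
  have key : ∀ (c : ℝ), 0 < c → ∀ s, 2 * traceNorm (U s ∘L P ∘L Q) ≤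
      ENNReal.ofReal (c ^ 2) * hsSq (U s ∘L P) + ENNReal.ofReal ((c⁻¹) ^ 2) * hsSq Q := by
    intro c hc s
    have h := two_mul_traceNorm_comp_le ((c : ℂ) • (U s ∘L P)) ((c : ℂ)⁻¹ • Q)
    have hc' : (c : ℂ) ≠ 0 := by exact_mod_cast hc.ne'
    rw [ContinuousLinearMap.comp_smul, ContinuousLinearMap.smul_comp, smul_smul,
      inv_mul_cancel₀ hc', one_smul, hsm, hsm, ContinuousLinearMap.comp_assoc] at h
    convert h using 3
    · rw [← ofReal_norm, Complex.norm_real, Real.norm_of_nonneg hc.le,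
        ENNReal.ofReal_pow hc.le]
    · rw [← ofReal_norm, norm_inv, Complex.norm_real, Real.norm_of_nonneg hc.le,
        ENNReal.ofReal_pow (by positivity)]
  have key2 : ∀ c : ℝ, 0 < c → ∀ δ : ℝ≥0∞, 0 < δ → ∀ᶠ s in l, traceNorm (U s ∘L P ∘L Q) ≤
      δ + ENNReal.ofReal ((c⁻¹) ^ 2) * hsSq Q := by
    intro c hc δ hδ
    have h1 := ENNReal.Tendsto.const_mul (a := ENNReal.ofReal (c ^ 2))
      (tendsto_hsSq_comp hM hU hP') (Or.inr ENNReal.ofReal_ne_top)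
    rw [mul_zero] at h1
    filter_upwards [ENNReal.tendsto_nhds_zero.1 h1 δ hδ] with s hs
    refine le_trans ?_ ((key c hc s).trans (add_le_add_left hs _))
    rw [two_mul]
    exact le_self_add
  rw [ENNReal.tendsto_nhds_zero]
  intro ε hε
  have h2 : Tendsto (fun c : ℝ => ENNReal.ofReal ((c⁻¹) ^ 2) * hsSq Q) atTop (𝓝 0) := by
    have h3 : Tendsto (fun c : ℝ => ENNReal.ofReal ((c⁻¹) ^ 2)) atTop (𝓝 (ENNReal.ofReal 0)) := by
      refine ENNReal.tendsto_ofReal ?_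
      simpa using (tendsto_inv_atTop_zero (𝕜 := ℝ)).pow 2
    have h4 := ENNReal.Tendsto.mul_const (b := hsSq Q) h3 (Or.inr hQ')
    simpa using h4
  obtain ⟨c, hc, hc0⟩ := ((ENNReal.tendsto_nhds_zero.1 h2 (ε / 2)
    (ENNReal.half_pos hε.ne')).and (eventually_gt_atTop 0)).exists
  filter_upwards [key2 c hc0 (ε / 2) (ENNReal.half_pos hε.ne')] with s hs
  refine hs.trans ((add_le_add_right hc _).trans ?_)
  rw [ENNReal.add_halves]

end TraceClass

/-! ### Differential inequalities -/

section Gronwall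

open Filter
open scoped Topology

/-- The hypothesis bounds the upper right Dini derivative of f by cf + ε for every ε > 0, so no
differentiability of f is needed. -/
theorem le_exp_of_forall_eventually_le_add {f : ℝ → ℝ} (hf : Continuous f) {T c : ℝ} (hT : 0 ≤ T)
    (h : ∀ t ∈ Set.Ico 0 T, ∀ ε > 0, ∀ᶠ s in 𝓝 (0 : ℝ), f (t + s) ≤ f t + |s| * (c * f t + ε)) :
    f T ≤ Real.exp (c * T) * f 0 := by
  have key := le_gronwallBound_of_liminf_deriv_right_le (f := f) (f' := fun x => c * f x)
    (δ := f 0) (K := c) (ε := 0) (a := 0) (b := T) hf.continuousOn ?_ le_rfl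
    (fun x _ => by simp) T ⟨hT, le_rfl⟩
  · rw [gronwallBound_ε0, sub_zero, mul_comm] at key
    exact key
  · intro x hx r hr
    refine Eventually.frequently ?_
    have h1 := h x hx ((r - c * f x) / 2) (by linarith)
    have h2 : Tendsto (fun z => z - x) (𝓝[>] x) (𝓝 0) := by
      have : Tendsto (fun z => z - x) (𝓝 x) (𝓝 (x - x)) := tendsto_id.sub_const x
      rw [sub_self] at this
      exact this.mono_left nhdsWithin_le_nhds
    filter_upwards [h2.eventually h1, self_mem_nhdsWithin] with z hz hzx
    have hpos : 0 < z - x := sub_pos.2 hzx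
    rw [abs_of_pos hpos, add_sub_cancel] at hz
    rw [inv_mul_lt_iff₀ hpos]
    nlinarith

/-- The quadratic error, whose constant may depend on the time, is absorbed into ε|s| for small s.
Negative times are handled by reflecting the curve. -/
theorem ennreal_gronwall {f : ℝ → ℝ≥0∞} (hfin : ∀ t, f t ≠ ∞) (hf : Continuous f) {T c : ℝ}
    (hc : 0 ≤ c)
    (h : ∀ t, |t| ≤ T → ∃ K : ℝ, 0 ≤ K ∧ ∀ ε > 0, ∀ᶠ s in 𝓝 (0 : ℝ),
      f (t + s) ≤ ENNReal.ofReal (1 + K * s ^ 2) * f t +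
        ENNReal.ofReal |s| * (ENNReal.ofReal c * f t + ENNReal.ofReal ε)) :
    ∀ t, |t| ≤ T → f t ≤ ENNReal.ofReal (Real.exp (c * |t|)) * f 0 := by
  set g : ℝ → ℝ := fun t => (f t).toReal with hg
  have hgc : Continuous g := continuous_iff_continuousAt.2 fun t =>
    (ENNReal.tendsto_toReal (hfin t)).comp hf.continuousAt
  have hfg : ∀ t, f t = ENNReal.ofReal (g t) := fun t => (ENNReal.ofReal_toReal (hfin t)).symm
  have hg0 : ∀ t, 0 ≤ g t := fun t => ENNReal.toReal_nonneg
  have hstep : ∀ t, |t| ≤ T → ∀ ε > 0, ∀ᶠ s in 𝓝 (0 : ℝ),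
      g (t + s) ≤ g t + |s| * (c * g t + ε) := by
    intro t ht ε hε
    obtain ⟨K, hK, h1⟩ := h t ht
    have h2 : ∀ᶠ s in 𝓝 (0 : ℝ), K * g t * |s| < ε / 2 := by
      have : Tendsto (fun s : ℝ => K * g t * |s|) (𝓝 0) (𝓝 (K * g t * |0|)) :=
        (continuous_const.mul continuous_abs).continuousAt
      rw [abs_zero, mul_zero] at this
      exact this.eventually (gt_mem_nhds (by positivity))
    filter_upwards [h1 (ε / 2) (by positivity), h2] with s hs1 hs2
    rw [hfg t, hfg (t + s), ← ENNReal.ofReal_mul hc, ← ENNReal.ofReal_add (by have := hg0 t; positivity)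
      (by positivity), ← ENNReal.ofReal_mul (by positivity), ← ENNReal.ofReal_mul (by positivity),
      ← ENNReal.ofReal_add (by have := hg0 t; positivity) (by have := hg0 t; positivity),
      ENNReal.ofReal_le_ofReal_iff (by have := hg0 t; positivity)] at hs1
    refine hs1.trans ?_
    have : s ^ 2 = |s| * |s| := by rw [abs_mul_abs_self, sq]
    rw [this]
    nlinarith [abs_nonneg s]
  intro t ht
  rw [hfg t, hfg 0, ← ENNReal.ofReal_mul (Real.exp_nonneg _)]
  refine ENNReal.ofReal_le_ofReal ?_
  rcases le_total 0 t with h0 | h0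
  · rw [abs_of_nonneg h0] at ht ⊢
    refine le_exp_of_forall_eventually_le_add hgc h0 fun u hu => hstep u ?_
    rw [abs_of_nonneg hu.1]
    exact hu.2.le.trans ht
  · rw [abs_of_nonpos h0] at ht ⊢
    have := le_exp_of_forall_eventually_le_add (f := fun u => g (-u)) (hgc.comp continuous_neg)
      (T := -t) (c := c) (by linarith) ?_
    · simpa using this
    · intro u hu ε hε
      have h1 := hstep (-u) (by rw [abs_neg, abs_of_nonneg hu.1]; exact hu.2.le.trans ht) ε hε
      have h2 : Tendsto (fun s : ℝ => -s) (𝓝 0) (𝓝 0) := by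
        simpa using (continuous_neg (G := ℝ)).tendsto 0
      filter_upwards [h2.eventually h1] with s hs
      rw [abs_neg] at hs
      rw [neg_add]
      exact hs

theorem continuous_of_le_add {f : ℝ → ℝ≥0∞} (hfin : ∀ t, f t ≠ ∞) {g : ℝ → ℝ → ℝ≥0∞}
    (h1 : ∀ s t, f s ≤ f t + g s t) (h2 : ∀ s t, f s ≤ f t + g t s)
    (hg : ∀ t, Tendsto (fun s => g s t) (𝓝 t) (𝓝 0)) : Continuous f := by
  rw [continuous_iff_continuousAt]
  intro t
  refine (ENNReal.tendsto_nhds (hfin t)).2 fun ε hε => ?_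
  filter_upwards [ENNReal.tendsto_nhds_zero.1 (hg t) ε hε] with s hs
  refine ⟨tsub_le_iff_right.2 ((h2 t s).trans ?_), (h1 s t).trans ?_⟩ <;> gcongr

end Gronwall

/-! ### Trace norm estimates for evolution equations -/

section Evolution

variable {H : Type*} [NormedAddCommGroup H] [InnerProductSpace ℂ H] [CompleteSpace H]

open ContinuousLinearMap Filter
open scoped Topology

/-- A mean value inequality in trace norm, for curves of operators whose matrix elements between
vectors of a dense set are differentiable. -/
theorem traceNorm_sub_le_of_weak_deriv {X : Type*} {j : X → H} (hj : DenseRange j)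
    {A D : ℝ → H →L[ℂ] H} {a b M : ℝ} (hM : 0 ≤ M)
    (hderiv : ∀ s ∈ Set.uIcc a b, ∀ φ ψ,
      HasDerivAt (fun s => ⟪j φ, A s (j ψ)⟫_ℂ) ⟪j φ, D s (j ψ)⟫_ℂ s)
    (hD : ∀ s ∈ Set.uIcc a b, traceNorm (D s) ≤ ENNReal.ofReal M) :
    traceNorm (A b - A a) ≤ ENNReal.ofReal (M * |b - a|) := by
  refine traceNorm_le_of_forall fun S hS s => ?_
  have hDn : ∀ r ∈ Set.uIcc a b, ‖D r‖ ≤ M := fun r hr => by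
    have := (enorm_le_traceNorm (D r)).trans (hD r hr)
    rwa [← ofReal_norm, ENNReal.ofReal_le_ofReal_iff hM] at this
  have key : ∀ f e : (exists_hilbertBasis ℂ H).choose → H,
      ‖∑ i ∈ s, ⟪f i, (A b - A a) (e i)⟫_ℂ‖ ≤
        (M + M * ∑ i ∈ s, (‖f i - S (onb H i)‖ * ‖e i‖ + ‖S (onb H i)‖ * ‖e i - onb H i‖))
          * |b - a| := by
    refine isClosed_property2 (DenseRange.piMap fun _ => hj) ?_ ?_
    · refine isClosed_le (by fun_prop) (by fun_prop)
    · intro f e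
      simp only [Pi.map_apply]
      have hd : ∀ r ∈ Set.uIcc a b, HasDerivWithinAt
          (fun r => ∑ i ∈ s, ⟪j (f i), A r (j (e i))⟫_ℂ)
          (∑ i ∈ s, ⟪j (f i), D r (j (e i))⟫_ℂ) (Set.uIcc a b) r := fun r hr =>
        (HasDerivAt.fun_sum fun i _ => hderiv r hr (f i) (e i)).hasDerivWithinAt
      have hb : ∀ r ∈ Set.uIcc a b, ‖∑ i ∈ s, ⟪j (f i), D r (j (e i))⟫_ℂ‖ ≤
          M + M * ∑ i ∈ s, (‖j (f i) - S (onb H i)‖ * ‖j (e i)‖ +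
            ‖S (onb H i)‖ * ‖j (e i) - onb H i‖) := by
        intro r hr
        have e1 : ∑ i ∈ s, ⟪j (f i), D r (j (e i))⟫_ℂ =
            ∑ i ∈ s, ⟪S (onb H i), D r (onb H i)⟫_ℂ +
            ∑ i ∈ s, (⟪j (f i) - S (onb H i), D r (j (e i))⟫_ℂ +
              ⟪S (onb H i), D r (j (e i) - onb H i)⟫_ℂ) := by
          rw [← Finset.sum_add_distrib]
          refine Finset.sum_congr rfl fun i _ => ?_
          rw [inner_sub_left, map_sub, inner_sub_right]
          ring
        rw [e1]
        refine (norm_add_le _ _).trans (add_le_add ?_ ?_)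
        · have := (enorm_sum_inner_le_traceNorm (D r) S 1 hS norm_id_le s).trans (hD r hr)
          rwa [← ofReal_norm, ENNReal.ofReal_le_ofReal_iff hM] at this
        · rw [Finset.mul_sum]
          refine (norm_sum_le _ _).trans (Finset.sum_le_sum fun i _ => ?_)
          have hle : ∀ x y : H, ‖⟪x, D r y⟫_ℂ‖ ≤ M * (‖x‖ * ‖y‖) := fun x y => by
            refine (norm_inner_le_norm _ _).trans ?_
            calc ‖x‖ * ‖D r y‖ ≤ ‖x‖ * (M * ‖y‖) := by
                  gcongr
                  exact ((D r).le_opNorm y).trans (by gcongr; exact hDn r hr)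
              _ = _ := by ring
          rw [mul_add]
          exact (norm_add_le _ _).trans (add_le_add (hle _ _) (hle _ _))
      have := (convex_uIcc a b).norm_image_sub_le_of_norm_hasDerivWithin_le hd hb
        Set.left_mem_uIcc Set.right_mem_uIcc
      rw [Real.norm_eq_abs, ← Finset.sum_sub_distrib] at this
      simpa [inner_sub_right] using this
  have h := key (fun i => S (onb H i)) (fun i => onb H i)
  simp only [sub_self, norm_zero, zero_mul, mul_zero, add_zero, Finset.sum_const_zero] at h
  rw [← ofReal_norm]
  exact ENNReal.ofReal_le_ofReal h

/-- `Z` is the derivative of the curve `B` at `t` in trace norm. -/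
def HasTraceDerivAt (B : ℝ → H →L[ℂ] H) (Z : H →L[ℂ] H) (t : ℝ) : Prop :=
  ∀ ε > 0, ∀ᶠ h in 𝓝 (0 : ℝ),
    traceNorm (B (t + h) - B t - (h : ℂ) • Z) ≤ ENNReal.ofReal (ε * |h|)

/-- The mean value inequality is applied to B(s) - sZ(t), whose weak derivative Z(s) - Z(t) is small
in trace norm near t. -/
theorem hasTraceDerivAt_of_weak_deriv {X : Type*} {j : X → H} (hj : DenseRange j)
    {B Z : ℝ → H →L[ℂ] H} {t : ℝ}
    (hderiv : ∀ s φ ψ, HasDerivAt (fun s => ⟪j φ, B s (j ψ)⟫_ℂ) ⟪j φ, Z s (j ψ)⟫_ℂ s)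
    (hZ : Tendsto (fun s => traceNorm (Z s - Z t)) (𝓝 t) (𝓝 0)) :
    HasTraceDerivAt B (Z t) t := by
  intro ε hε
  have h1 := ENNReal.tendsto_nhds_zero.1 hZ (ENNReal.ofReal ε) (by simpa using hε)
  obtain ⟨δ, hδ, h2⟩ := Metric.eventually_nhds_iff.1 h1
  refine Metric.eventually_nhds_iff.2 ⟨δ, hδ, fun h hh => ?_⟩
  rw [Real.dist_eq, sub_zero] at hh
  have key := traceNorm_sub_le_of_weak_deriv hj (A := fun s => B s - (s : ℂ) • Z t)
    (D := fun s => Z s - Z t) (a := t) (b := t + h) hε.le ?_ ?_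
  · convert key using 2
    · push_cast
      rw [add_smul]
      abel
    · rw [add_sub_cancel_left]
  · intro s _ φ ψ
    have h3 := (hderiv s φ ψ).sub
      ((Complex.ofRealCLM.hasDerivAt (x := s)).mul_const ⟪j φ, Z t (j ψ)⟫_ℂ)
    simpa [inner_sub_right, inner_smul_right, Pi.sub_def] using h3
  · intro s hs
    refine h2 ?_
    rw [Real.dist_eq]
    refine lt_of_le_of_lt ?_ hh
    have := Set.abs_sub_left_of_mem_uIcc hs
    simpa using this

theorem HasTraceDerivAt.tendsto {B : ℝ → H →L[ℂ] H} {Z : H →L[ℂ] H} {t : ℝ}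
    (h : HasTraceDerivAt B Z t) (hZ : traceNorm Z ≠ ∞) :
    Tendsto (fun s => traceNorm (B s - B t)) (𝓝 t) (𝓝 0) := by
  have h1 : Tendsto (fun h : ℝ => ENNReal.ofReal (1 * |h|) + ENNReal.ofReal |h| * traceNorm Z)
      (𝓝 0) (𝓝 (ENNReal.ofReal (1 * |0|) + ENNReal.ofReal |0| * traceNorm Z)) := by
    refine Tendsto.add (ENNReal.tendsto_ofReal ?_) (ENNReal.Tendsto.mul_const
      (ENNReal.tendsto_ofReal ?_) (Or.inr hZ))
    · exact (continuous_const.mul continuous_abs).continuousAt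
    · exact continuous_abs.continuousAt
  simp only [abs_zero, mul_zero, ENNReal.ofReal_zero, zero_mul, add_zero] at h1
  have h2 : Tendsto (fun h => traceNorm (B (t + h) - B t)) (𝓝 0) (𝓝 0) := by
    refine tendsto_of_tendsto_of_tendsto_of_le_of_le' tendsto_const_nhds h1
      (Eventually.of_forall fun _ => zero_le) ?_
    filter_upwards [h 1 one_pos] with s hs
    have : B (t + s) - B t = (B (t + s) - B t - (s : ℂ) • Z) + (s : ℂ) • Z := by abel
    rw [this]
    refine (traceNorm_add_le _ _).trans (add_le_add hs ?_)
    rw [traceNorm_smul, ← ofReal_norm, Complex.norm_real, Real.norm_eq_abs]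
  have h3 : Tendsto (fun s => s - t) (𝓝 t) (𝓝 0) := by
    have : Tendsto (fun z => z - t) (𝓝 t) (𝓝 (t - t)) := tendsto_id.sub_const t
    rwa [sub_self] at this
  refine (h2.comp h3).congr fun s => ?_
  simp

end Evolution

section Propagation

open ContinuousLinearMap Filter
open scoped Topology

/-- A subadditive function on operators compatible with left and right multiplication. -/
structure IsIdealNorm (n : Op → ℝ≥0∞) : Prop where
  add_le : ∀ A B, n (A + B) ≤ n A + n B
  comp_le_left : ∀ B A, n (B ∘L A) ≤ ‖B‖ₑ * n A
  comp_le_right : ∀ A B, n (A ∘L B) ≤ ‖B‖ₑ * n A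
  le_traceNorm : ∀ A, n A ≤ traceNorm A

theorem isIdealNorm_traceNorm : IsIdealNorm (traceNorm : Op → ℝ≥0∞) :=
  ⟨traceNorm_add_le, traceNorm_comp_le_left, traceNorm_comp_le_right, fun _ => le_rfl⟩

theorem enorm_comp_le (B A : Op) : ‖B ∘L A‖ₑ ≤ ‖B‖ₑ * ‖A‖ₑ := by
  rw [← ofReal_norm, ← ofReal_norm, ← ofReal_norm, ← ENNReal.ofReal_mul (norm_nonneg _)]
  exact ENNReal.ofReal_le_ofReal (opNorm_comp_le _ _)

theorem isIdealNorm_enorm : IsIdealNorm (fun A => ‖A‖ₑ) :=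
  ⟨fun A B => enorm_add_le A B, enorm_comp_le, fun A B => by rw [mul_comm]; exact enorm_comp_le _ _,
    enorm_le_traceNorm⟩

theorem IsIdealNorm.smul_le {n : Op → ℝ≥0∞} (hn : IsIdealNorm n) (c : ℂ) (A : Op) :
    n (c • A) ≤ ‖c‖ₑ * n A := by
  have h := hn.comp_le_left (c • ContinuousLinearMap.id ℂ L2) A
  rw [ContinuousLinearMap.smul_comp, ContinuousLinearMap.id_comp, enorm_smul] at h
  refine h.trans ?_
  gcongr
  refine mul_le_of_le_one_right zero_le ?_
  rw [← ofReal_norm]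
  exact ENNReal.ofReal_le_one.2 norm_id_le

/-- For self-adjoint W the first-order terms cancel in (1 + iκW)*(1 + iκW) = 1 + κ²W². -/
theorem norm_one_add_smul_sq_le {W : Op} (hW : adjoint W = W) (κ : ℝ) :
    ‖(1 : Op) + (Complex.I * κ) • W‖ ^ 2 ≤ 1 + κ ^ 2 * ‖W‖ ^ 2 := by
  have hW' : star W = W := hW
  have h1 : star ((1 : Op) + (Complex.I * κ) • W) * (1 + (Complex.I * κ) • W) =
      1 + ((κ : ℂ) ^ 2) • (W * W) := by
    rw [star_add, star_one, star_smul, hW']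
    simp only [add_mul, mul_add, one_mul, mul_one, smul_mul_smul_comm]
    rw [show star (Complex.I * (κ : ℂ)) = -(Complex.I * κ) by simp,
      show -(Complex.I * (κ : ℂ)) * (Complex.I * κ) = (κ : ℂ) ^ 2 by
        linear_combination (-(κ : ℂ) ^ 2) * Complex.I_sq, neg_smul]
    abel
  rw [sq, ← CStarRing.norm_star_mul_self, h1]
  refine (norm_add_le _ _).trans (add_le_add norm_id_le ?_)
  rw [norm_smul, sq ‖W‖]
  have : ‖(κ : ℂ) ^ 2‖ = κ ^ 2 := by
    rw [norm_pow, Complex.norm_real, Real.norm_eq_abs, sq_abs]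
  rw [this]
  gcongr
  exact norm_mul_le _ _

/-- Up to the second-order term κ²WGW, the left operator is (1 - iκW)G(1 + iκW), and both outer
factors have norm 1 + O(κ²). This infinitesimal form of unitary invariance makes it unnecessary to
construct the propagator of the time-dependent generator. -/
theorem IsIdealNorm.sub_smul_comm_le {n : Op → ℝ≥0∞} (hn : IsIdealNorm n) {W : Op}
    (hW : adjoint W = W) (G : Op) (κ : ℝ) :
    n (G - (Complex.I * κ) • comm W G) ≤ ENNReal.ofReal (1 + 2 * ‖W‖ ^ 2 * κ ^ 2) * n G := by
  have e : G - (Complex.I * κ) • comm W G =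
      ((1 : Op) + (Complex.I * (-κ : ℝ)) • W) ∘L (G ∘L ((1 : Op) + (Complex.I * κ) • W)) +
        (-(κ : ℂ) ^ 2) • (W ∘L (G ∘L W)) := by
    have : ((1 : Op) + (Complex.I * (-κ : ℝ)) • W) * (G * ((1 : Op) + (Complex.I * κ) • W)) +
        (-(κ : ℂ) ^ 2) • (W * (G * W)) = G - (Complex.I * κ) • (W * G - G * W) := by
      simp only [add_mul, mul_add, one_mul, mul_one, smul_mul_assoc, mul_smul_comm, smul_smul,
        smul_add, smul_sub]
      rw [show Complex.I * (κ : ℂ) * (Complex.I * ((-κ : ℝ) : ℂ)) = (κ : ℂ) ^ 2 by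
        push_cast
        linear_combination (-(κ : ℂ) ^ 2) * Complex.I_sq,
        show Complex.I * ((-κ : ℝ) : ℂ) = -(Complex.I * κ) by push_cast; ring, neg_smul, neg_smul]
      abel
    exact this.symm
  rw [e]
  set a := ‖(1 : Op) + (Complex.I * (-κ : ℝ)) • W‖ with ha
  set b := ‖(1 : Op) + (Complex.I * κ) • W‖ with hb
  have h1 : a * b ≤ 1 + κ ^ 2 * ‖W‖ ^ 2 := by
    have h1 := norm_one_add_smul_sq_le hW κ
    have h2 := norm_one_add_smul_sq_le hW (-κ)
    rw [neg_sq] at h2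
    nlinarith [sq_nonneg (a - b)]
  have hs : ‖(-(κ : ℂ) ^ 2)‖ₑ = ENNReal.ofReal (κ ^ 2) := by
    rw [← ofReal_norm, norm_neg, norm_pow, Complex.norm_real, Real.norm_eq_abs, sq_abs]
  calc _ ≤ ENNReal.ofReal (a * b) * n G +
        ENNReal.ofReal (κ ^ 2) * (ENNReal.ofReal (‖W‖ ^ 2) * n G) := by
        refine (hn.add_le _ _).trans (add_le_add ?_ ?_)
        · refine (hn.comp_le_left _ _).trans ?_
          rw [ENNReal.ofReal_mul (norm_nonneg _), mul_assoc, ofReal_norm, ofReal_norm]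
          gcongr
          exact hn.comp_le_right _ _
        · refine (hn.smul_le _ _).trans ?_
          rw [hs, sq ‖W‖, ENNReal.ofReal_mul (norm_nonneg _), mul_assoc, ofReal_norm]
          gcongr
          refine (hn.comp_le_left _ _).trans ?_
          gcongr
          exact hn.comp_le_right _ _
    _ ≤ _ := by
        rw [← mul_assoc, ← add_mul, ← ENNReal.ofReal_mul (by positivity),
          ← ENNReal.ofReal_add (by positivity) (by positivity)]
        refine mul_le_mul_left (ENNReal.ofReal_le_ofReal ?_) _
        linarith

theorem traceNorm_comm_le (A B : Op) : traceNorm (comm A B) ≤ 2 * ‖B‖ₑ * traceNorm A := by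
  unfold comm
  refine (traceNorm_sub_le _ _).trans ?_
  rw [two_mul, add_mul]
  exact add_le_add (traceNorm_comp_le_right _ _) (traceNorm_comp_le_left _ _)

theorem traceNorm_comm_le' (A B : Op) : traceNorm (comm A B) ≤ 2 * ‖A‖ₑ * traceNorm B := by
  unfold comm
  refine (traceNorm_sub_le _ _).trans ?_
  rw [two_mul, add_mul]
  exact add_le_add (traceNorm_comp_le_left _ _) (traceNorm_comp_le_right _ _)

/-! ### Flows with bounded time-dependent generators. -/

section

variable {B W : ℝ → Op} (hB : ∀ t, traceNorm (B t) ≠ ∞)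
  (hderiv : ∀ t, HasTraceDerivAt B (-Complex.I • comm (W t) (B t)) t)

theorem traceNorm_sub_comm (A B : Op) : traceNorm (A - B) = traceNorm (B - A) := by
  rw [← traceNorm_neg, neg_sub]

include hB hderiv in
theorem tendsto_traceNorm_sub_of_deriv (t : ℝ) :
    Tendsto (fun s => traceNorm (B s - B t)) (𝓝 t) (𝓝 0) := by
  refine (hderiv t).tendsto ?_
  rw [traceNorm_smul]
  have := traceNorm_comm_le' (W t) (B t)
  have h2 := hB t
  refine ENNReal.mul_ne_top (by finiteness) (ne_top_of_le_ne_top (by finiteness) this)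

include hB hderiv in
/-- A seminorm that is an ideal norm is conserved under the flow. -/
theorem IsIdealNorm.le_initial {n : Op → ℝ≥0∞} (hn : IsIdealNorm n)
    (hW : ∀ t, adjoint (W t) = W t) (t : ℝ) : n (B t) ≤ n (B 0) := by
  have hfin : ∀ t, n (B t) ≠ ∞ := fun t => ne_top_of_le_ne_top (hB t) (hn.le_traceNorm _)
  have hle : ∀ A A' : Op, n A ≤ n A' + traceNorm (A - A') := fun A A' => by
    have h := hn.add_le A' (A - A')
    rw [add_sub_cancel] at h
    exact h.trans (add_le_add le_rfl (hn.le_traceNorm _))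
  have hc : Continuous fun t => n (B t) :=
    continuous_of_le_add hfin (g := fun s t => traceNorm (B s - B t)) (fun s t => hle _ _)
      (fun s t => by rw [traceNorm_sub_comm]; exact hle _ _)
      (tendsto_traceNorm_sub_of_deriv hB hderiv)
  -- Rate c = 0: the increment consists only of a second-order term and the error o(s) from the
  -- trace-norm derivative.
  have key := ennreal_gronwall hfin hc (T := |t|) (c := 0) le_rfl ?_ t le_rfl
  · simpa using key
  · intro u _
    refine ⟨2 * ‖W u‖ ^ 2, by positivity, fun ε hε => ?_⟩
    filter_upwards [hderiv u ε hε] with s hs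
    have e : B (u + s) = (B u - (Complex.I * s) • comm (W u) (B u)) +
        (B (u + s) - B u - (s : ℂ) • (-Complex.I • comm (W u) (B u))) := by
      rw [smul_smul, show (s : ℂ) * -Complex.I = -(Complex.I * s) by ring, neg_smul]
      abel
    rw [e]
    refine (hn.add_le _ _).trans (add_le_add (hn.sub_smul_comm_le (hW u) _ _) ?_)
    refine (hn.le_traceNorm _).trans (hs.trans (le_of_eq ?_))
    rw [ENNReal.ofReal_zero, zero_mul, zero_add, ← ENNReal.ofReal_mul (abs_nonneg _), mul_comm]

include hB hderiv in
/-- Propagation of commutator bounds. -/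
theorem iSup_traceNorm_comm_le (hW : ∀ t, adjoint (W t) = W t) {𝒜 : Set Op} {L : ℝ}
    (hL : ∀ A ∈ 𝒜, ‖A‖ ≤ L) {T c : ℝ} (hc : 0 ≤ c)
    (hbound : ∀ t, |t| ≤ T → ∀ A ∈ 𝒜, traceNorm (comm (comm (W t) A) (B t)) ≤
      ENNReal.ofReal c * ⨆ A ∈ 𝒜, traceNorm (comm (B t) A)) (t : ℝ) (ht : |t| ≤ T) :
    ⨆ A ∈ 𝒜, traceNorm (comm (B t) A) ≤
      ENNReal.ofReal (Real.exp (c * |t|)) * ⨆ A ∈ 𝒜, traceNorm (comm (B 0) A) := by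
  have hLe : ∀ A ∈ 𝒜, ∀ R : Op, traceNorm (comm R A) ≤ 2 * ENNReal.ofReal L * traceNorm R := by
    intro A hA R
    refine (traceNorm_comm_le _ _).trans ?_
    gcongr
    rw [← ofReal_norm]
    exact ENNReal.ofReal_le_ofReal (hL A hA)
  have hfin : ∀ t, ⨆ A ∈ 𝒜, traceNorm (comm (B t) A) ≠ ∞ := fun t => by
    have h2 := hB t
    exact ne_top_of_le_ne_top (b := 2 * ENNReal.ofReal L * traceNorm (B t)) (by finiteness)
      (iSup₂_le fun A hA => hLe A hA _)
  have hle : ∀ s t, ⨆ A ∈ 𝒜, traceNorm (comm (B s) A) ≤ (⨆ A ∈ 𝒜, traceNorm (comm (B t) A)) +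
      2 * ENNReal.ofReal L * traceNorm (B s - B t) := fun s t => by
    refine iSup₂_le fun A hA => ?_
    have e : comm (B s) A = comm (B t) A + comm (B s - B t) A := by
      simp only [comm, ContinuousLinearMap.sub_comp, ContinuousLinearMap.comp_sub]
      abel
    rw [e]
    refine (traceNorm_add_le _ _).trans (add_le_add ?_ (hLe A hA _))
    exact le_iSup₂ (f := fun A _ => traceNorm (comm (B t) A)) A hA
  have hcont : Continuous fun t => ⨆ A ∈ 𝒜, traceNorm (comm (B t) A) := by
    refine continuous_of_le_add hfin (g := fun s t => 2 * ENNReal.ofReal L * traceNorm (B s - B t))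
      hle (fun s t => by rw [traceNorm_sub_comm]; exact hle _ _) fun t => ?_
    have := ENNReal.Tendsto.const_mul (a := 2 * ENNReal.ofReal L)
      (tendsto_traceNorm_sub_of_deriv hB hderiv t) (Or.inr (by finiteness))
    rwa [mul_zero] at this
  refine ennreal_gronwall hfin hcont hc (fun u hu => ?_) t ht
  refine ⟨2 * ‖W u‖ ^ 2, by positivity, fun ε hε => ?_⟩
  have hL' : (0 : ℝ) < 2 * max L 0 + 1 := by positivity
  -- A commutator with A multiplies the remainder by at most 2L, uniformly over the family, so the
  -- tolerance is divided in advance; the added 1 keeps the denominator positive.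
  filter_upwards [hderiv u (ε / (2 * max L 0 + 1)) (by positivity)] with s hs
  refine iSup₂_le fun A hA => ?_
  set R := B (u + s) - B u - (s : ℂ) • (-Complex.I • comm (W u) (B u)) with hR
  -- Jacobi identity: [[W, B], A] = [W, [B, A]] + [[W, A], B]. The first bracket is harmless by
  -- near-unitarity, the second is what `hbound` controls.
  have e : comm (B (u + s)) A = (comm (B u) A - (Complex.I * s) • comm (W u) (comm (B u) A)) +
      ((-(Complex.I * s)) • comm (comm (W u) A) (B u) + comm R A) := by
    have e1 : B (u + s) = B u - (Complex.I * s) • comm (W u) (B u) + R := by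
      rw [hR, smul_smul, show (s : ℂ) * -Complex.I = -(Complex.I * s) by ring, neg_smul]
      abel
    rw [e1]
    have e2 : ∀ (b w A R : Op) (z : ℂ),
        (b - z • (w * b - b * w) + R) * A - A * (b - z • (w * b - b * w) + R) =
        (b * A - A * b) - z • (w * (b * A - A * b) - (b * A - A * b) * w) +
        ((-z) • ((w * A - A * w) * b - b * (w * A - A * w)) + (R * A - A * R)) := by
      intro b w A R z
      simp only [mul_sub, sub_mul, mul_add, add_mul, smul_sub, smul_mul_assoc, mul_smul_comm,
        neg_smul, mul_assoc]
      abel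
    exact e2 _ _ _ _ _
  rw [e]
  refine (traceNorm_add_le _ _).trans (add_le_add ?_ ?_)
  · refine (isIdealNorm_traceNorm.sub_smul_comm_le (hW u) _ _).trans ?_
    gcongr
    exact le_iSup₂ (f := fun A _ => traceNorm (comm (B u) A)) A hA
  · rw [mul_add]
    refine (traceNorm_add_le _ _).trans (add_le_add ?_ ?_)
    · have : ‖-(Complex.I * (s : ℂ))‖ₑ = ENNReal.ofReal |s| := by
        rw [← ofReal_norm, norm_neg, norm_mul, Complex.norm_I, one_mul, Complex.norm_real,
          Real.norm_eq_abs]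
      rw [traceNorm_smul, this]
      gcongr
      exact hbound u hu A hA
    · refine (hLe A hA R).trans ?_
      calc 2 * ENNReal.ofReal L * traceNorm R
          ≤ ENNReal.ofReal (2 * max L 0 + 1) *
            ENNReal.ofReal (ε / (2 * max L 0 + 1) * |s|) := by
            gcongr
            rw [← ENNReal.ofReal_ofNat, ← ENNReal.ofReal_mul (by norm_num)]
            refine ENNReal.ofReal_le_ofReal ?_
            linarith [le_max_left L 0]
        _ = _ := by
            rw [← ENNReal.ofReal_mul hL'.le, ← ENNReal.ofReal_mul (abs_nonneg _)]
            congr 1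
            field_simp

include hB hderiv in
/-- The flow preserves self-adjointness, provided the generator depends on the operator in a
Lipschitz manner that respects adjoints. -/
theorem adjoint_eq_of_deriv (h0 : adjoint (B 0) = B 0)
    (hbound : ∀ T : ℝ, ∃ c : ℝ, 0 ≤ c ∧ ∀ t, |t| ≤ T →
      ‖W t - adjoint (W t)‖ₑ ≤ ENNReal.ofReal c * traceNorm (B t - adjoint (B t)) ∧
      ‖W t‖ₑ ≤ ENNReal.ofReal c ∧ traceNorm (B t) ≤ ENNReal.ofReal c) (t : ℝ) :
    adjoint (B t) = B t := by
  set f : ℝ → ℝ≥0∞ := fun t => traceNorm (B t - adjoint (B t)) with hf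
  have hadj : ∀ A A' : Op, adjoint (A - A') = adjoint A - adjoint A' := fun A A' => map_sub _ _ _
  have hfin : ∀ t, f t ≠ ∞ := fun t => by
    have h2 := hB t
    refine ne_top_of_le_ne_top ?_ (traceNorm_sub_le _ _)
    rw [traceNorm_adjoint]
    finiteness
  have hle : ∀ s t, f s ≤ f t + 2 * traceNorm (B s - B t) := fun s t => by
    have e : B s - adjoint (B s) = (B t - adjoint (B t)) +
        ((B s - B t) - adjoint (B s - B t)) := by rw [hadj]; abel
    simp only [hf]
    rw [e]
    refine (traceNorm_add_le _ _).trans (add_le_add le_rfl ?_)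
    refine (traceNorm_sub_le _ _).trans (le_of_eq ?_)
    rw [traceNorm_adjoint, two_mul]
  have hcont : Continuous f := by
    refine continuous_of_le_add hfin (g := fun s t => 2 * traceNorm (B s - B t))
      hle (fun s t => by rw [traceNorm_sub_comm]; exact hle _ _) fun t => ?_
    have := ENNReal.Tendsto.const_mul (a := 2)
      (tendsto_traceNorm_sub_of_deriv hB hderiv t) (Or.inr (by finiteness))
    rwa [mul_zero] at this
  obtain ⟨c, hc, hcb⟩ := hbound |t|
  -- The rate 2c·c comes from [W - W*, B] with tr|B| ≤ c, and 2c from [W*, B - B*]. Since f(0) = 0,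
  -- any finite rate suffices.
  have key := ennreal_gronwall hfin hcont (T := |t|) (c := 2 * c * c + 2 * c) (by positivity) ?_ t
    le_rfl
  · have h1 : f 0 = 0 := by simp [hf, h0]
    rw [h1, mul_zero] at key
    have h2 := (enorm_le_traceNorm _).trans key
    rw [nonpos_iff_eq_zero, enorm_eq_zero, sub_eq_zero] at h2
    exact h2.symm
  · intro u hu
    obtain ⟨h1, h2, h3⟩ := hcb u hu
    refine ⟨0, le_rfl, fun ε hε => ?_⟩
    filter_upwards [hderiv u (ε / 2) (by positivity)] with s hs
    set R := B (u + s) - B u - (s : ℂ) • (-Complex.I • comm (W u) (B u)) with hR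
    set D := B u - adjoint (B u) with hD
    set X := W u - adjoint (W u) with hX
    have hZ : adjoint (comm (W u) (B u)) = -comm (adjoint (W u)) (adjoint (B u)) := by
      rw [comm, hadj, adjoint_comp, adjoint_comp, comm]
      abel
    have e : B (u + s) - adjoint (B (u + s)) = D + ((-(Complex.I * s)) •
        (comm X (B u) + comm (adjoint (W u)) D) + (R - adjoint R)) := by
      have e1 : B (u + s) = B u + (-(Complex.I * s)) • comm (W u) (B u) + R := by
        rw [hR, smul_smul, show (s : ℂ) * -Complex.I = -(Complex.I * s) by ring]
        abel
      have e2 : adjoint (B (u + s)) = adjoint (B u) +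
          (-(Complex.I * s)) • comm (adjoint (W u)) (adjoint (B u)) + adjoint R := by
        rw [e1, map_add, map_add, LinearIsometryEquiv.map_smulₛₗ, hZ]
        simp
      have e3 : comm X (B u) + comm (adjoint (W u)) D =
          comm (W u) (B u) - comm (adjoint (W u)) (adjoint (B u)) := by
        simp only [comm, hX, hD, ContinuousLinearMap.sub_comp, ContinuousLinearMap.comp_sub]
        abel
      rw [e2, e3, e1, smul_sub, hD]
      abel
    have hRle : traceNorm (R - adjoint R) ≤ ENNReal.ofReal (ε * |s|) := by
      refine (traceNorm_sub_le _ _).trans ?_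
      rw [traceNorm_adjoint]
      refine (add_le_add hs hs).trans (le_of_eq ?_)
      rw [← ENNReal.ofReal_add (by positivity) (by positivity)]
      congr 1
      ring
    have hn : ‖-(Complex.I * (s : ℂ))‖ₑ = ENNReal.ofReal |s| := by
      rw [← ofReal_norm, norm_neg, norm_mul, Complex.norm_I, one_mul, Complex.norm_real,
        Real.norm_eq_abs]
    simp only [hf]
    rw [e]
    refine (traceNorm_add_le _ _).trans (add_le_add (by simp [hD]) ?_)
    rw [mul_add]
    refine (traceNorm_add_le _ _).trans (add_le_add ?_ ?_)
    · rw [traceNorm_smul, hn]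
      gcongr
      refine (traceNorm_add_le _ _).trans ?_
      rw [ENNReal.ofReal_add (by positivity) (by positivity), add_mul]
      refine add_le_add ?_ ?_
      · refine (traceNorm_comm_le' _ _).trans ?_
        calc 2 * ‖X‖ₑ * traceNorm (B u) ≤
            2 * (ENNReal.ofReal c * traceNorm D) * ENNReal.ofReal c := by gcongr
          _ = _ := by
            rw [ENNReal.ofReal_mul (by positivity), ENNReal.ofReal_mul (by positivity),
              ENNReal.ofReal_ofNat]
            ring
      · refine (traceNorm_comm_le' _ _).trans ?_
        rw [enorm_adjoint, ENNReal.ofReal_mul (by positivity), ENNReal.ofReal_ofNat]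
        gcongr
    · refine hRle.trans (le_of_eq ?_)
      rw [← ENNReal.ofReal_mul (abs_nonneg _), mul_comm]

end

end Propagation

/-! ### Multiplication and translation operators -/

section Operators

open ContinuousLinearMap Filter
open scoped Topology

theorem denseRange_toL2 : DenseRange toL2 :=
  SchwartzMap.denseRange_toLpCLM (E := R3) (F := ℂ) (p := 2) ENNReal.ofNat_ne_top

theorem ext_toL2 {A B : Op} (h : ∀ φ, A (toL2 φ) = B (toL2 φ)) : A = B := by
  have := denseRange_toL2.equalizer A.continuous B.continuous (funext h)
  exact DFunLike.coe_injective this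

theorem memLp_top_of_norm_eq_one {f : R3 → ℂ} (hf : Continuous f) (h : ∀ x, ‖f x‖ = 1) :
    MemLp f ∞ (volume : Measure R3) :=
  memLp_top_of_bound hf.aestronglyMeasurable 1 (Eventually.of_forall fun x => (h x).le)

theorem mulOp_comp {f g : R3 → ℂ} (hf : MemLp f ∞ (volume : Measure R3))
    (hg : MemLp g ∞ (volume : Measure R3)) :
    mulOp f ∘L mulOp g = mulOp (fun x => f x * g x) := by
  ext1 ψ
  refine Lp.ext ?_
  have hfg : MemLp (fun x => f x * g x) ∞ (volume : Measure R3) := hg.mul hf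
  filter_upwards [mulOp_ae_eq hf (mulOp g ψ), mulOp_ae_eq hg ψ, mulOp_ae_eq hfg ψ]
    with x h1 h2 h3
  rw [ContinuousLinearMap.comp_apply, h1, h2, h3, mul_assoc]

theorem mulOp_one : mulOp (fun _ => 1) = 1 := by
  ext1 ψ
  refine Lp.ext ?_
  filter_upwards [mulOp_ae_eq (memLp_top_const (1 : ℂ)) ψ] with x h1
  rw [h1, one_mul]
  rfl

theorem adjoint_mulOp {f : R3 → ℂ} (hf : MemLp f ∞ (volume : Measure R3)) :
    adjoint (mulOp f) = mulOp (fun x => (starRingEnd ℂ) (f x)) := by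
  refine ((eq_adjoint_iff _ _).2 fun φ ψ => ?_).symm
  rw [L2.inner_def, L2.inner_def]
  refine integral_congr_ae ?_
  have hf' : MemLp (fun x => (starRingEnd ℂ) (f x)) ∞ (volume : Measure R3) := hf.star
  filter_upwards [mulOp_ae_eq hf ψ, mulOp_ae_eq hf' φ] with x h1 h2
  rw [h1, h2]
  simp only [RCLike.inner_apply, map_mul, RCLike.conj_conj]
  ring

theorem norm_mulOp_le {f : R3 → ℂ} {C : ℝ} (hC : 0 ≤ C) (hf : MemLp f ∞ (volume : Measure R3))
    (h : ∀ x, ‖f x‖ ≤ C) : ‖mulOp f‖ ≤ C := by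
  refine opNorm_le_bound _ hC fun ψ => ?_
  refine Lp.norm_le_mul_norm_of_ae_le_mul ?_
  filter_upwards [mulOp_ae_eq hf ψ] with x h1
  rw [h1, norm_mul]
  gcongr
  exact h x

theorem continuous_planeWave (p : R3) : Continuous (planeWave p) := by
  unfold planeWave; fun_prop

theorem norm_planeWave (p x : R3) : ‖planeWave p x‖ = 1 := by
  rw [planeWave, mul_comm, Complex.norm_exp_ofReal_mul_I]

theorem planeWave_add (p q x : R3) : planeWave (p + q) x = planeWave p x * planeWave q x := by
  rw [planeWave, planeWave, planeWave, ← Complex.exp_add, inner_add_left]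
  push_cast
  ring_nf

theorem planeWave_add_right (p x a : R3) :
    planeWave p (x + a) = planeWave p x * planeWave p a := by
  rw [planeWave, planeWave, planeWave, ← Complex.exp_add, inner_add_right]
  push_cast
  ring_nf

theorem conj_planeWave (p x : R3) : (starRingEnd ℂ) (planeWave p x) = planeWave (-p) x := by
  rw [planeWave, planeWave, ← Complex.exp_conj, inner_neg_left]
  simp

theorem planeWave_comm (p x : R3) : planeWave p x = planeWave x p := by
  rw [planeWave, planeWave, real_inner_comm]

@[simp] theorem planeWave_zero (x : R3) : planeWave 0 x = 1 := by simp [planeWave]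

/-- Multiplication by a plane wave. -/
def waveOp (p : R3) : Op := mulOp (planeWave p)

theorem waveOp_ae_eq (p : R3) (ψ : L2) :
    (waveOp p ψ : R3 → ℂ) =ᵐ[volume] fun x => planeWave p x * ψ x :=
  mulOp_ae_eq (memLp_planeWave p) ψ

theorem waveOp_comp (p q : R3) : waveOp p ∘L waveOp q = waveOp (p + q) := by
  rw [waveOp, waveOp, mulOp_comp (memLp_planeWave p) (memLp_planeWave q), waveOp]
  congr 1
  ext x
  rw [planeWave_add]

@[simp] theorem waveOp_zero : waveOp 0 = 1 := by
  rw [← mulOp_one, waveOp]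
  congr 1
  ext x
  simp

theorem adjoint_waveOp (p : R3) : adjoint (waveOp p) = waveOp (-p) := by
  rw [waveOp, adjoint_mulOp (memLp_planeWave p), waveOp]
  congr 1
  ext x
  rw [conj_planeWave]

theorem norm_waveOp_le (p : R3) : ‖waveOp p‖ ≤ 1 :=
  norm_mulOp_le zero_le_one (memLp_planeWave p) fun x => (norm_planeWave p x).le

/-- The translation `(T_a ψ)(x) = ψ(x + a)`. -/
def transOp (a : R3) : Op :=
  (Lp.compMeasurePreservingₗᵢ ℂ (fun x => x + a)
    (measurePreserving_add_right (volume : Measure R3) a)).toContinuousLinearMap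

theorem transOp_ae_eq (a : R3) (ψ : L2) :
    (transOp a ψ : R3 → ℂ) =ᵐ[volume] fun x => ψ (x + a) :=
  Lp.coeFn_compMeasurePreserving ψ (measurePreserving_add_right (volume : Measure R3) a)

theorem ae_add_right {P : R3 → Prop} (h : ∀ᵐ x, P x) (a : R3) :
    ∀ᵐ x, P (x + a) :=
  (measurePreserving_add_right (volume : Measure R3) a).quasiMeasurePreserving.ae h

theorem transOp_comp (a b : R3) : transOp a ∘L transOp b = transOp (a + b) := by
  ext1 ψ
  refine Lp.ext ?_
  filter_upwards [transOp_ae_eq a (transOp b ψ), ae_add_right (transOp_ae_eq b ψ) a,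
    transOp_ae_eq (a + b) ψ] with x h1 h2 h3
  rw [ContinuousLinearMap.comp_apply, h1, h2, h3, add_assoc]

@[simp] theorem transOp_zero : transOp 0 = 1 := by
  ext1 ψ
  refine Lp.ext ?_
  filter_upwards [transOp_ae_eq 0 ψ] with x h1
  rw [h1, add_zero]
  rfl

theorem norm_transOp_le (a : R3) : ‖transOp a‖ ≤ 1 :=
  LinearIsometry.norm_toContinuousLinearMap_le _

theorem adjoint_transOp (a : R3) : adjoint (transOp a) = transOp (-a) := by
  have h : adjoint (transOp a) ∘L transOp a = 1 := by
    ext1 ψ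
    refine ext_inner_left ℂ fun φ => ?_
    rw [ContinuousLinearMap.comp_apply, adjoint_inner_right]
    exact LinearIsometry.inner_map_map _ _ _
  have h2 : transOp a ∘L transOp (-a) = 1 := by rw [transOp_comp, add_neg_cancel, transOp_zero]
  calc adjoint (transOp a) = adjoint (transOp a) ∘L (transOp a ∘L transOp (-a)) := by
        rw [h2]; rfl
    _ = transOp (-a) := by rw [← ContinuousLinearMap.comp_assoc, h]; rfl

/-- The Weyl relation; the phase e^{ip·a} is the source of every gain in ħ. -/
theorem transOp_comp_waveOp (a p : R3) :
    transOp a ∘L waveOp p = planeWave p a • (waveOp p ∘L transOp a) := by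
  ext1 ψ
  refine Lp.ext ?_
  filter_upwards [transOp_ae_eq a (waveOp p ψ), ae_add_right (waveOp_ae_eq p ψ) a,
    waveOp_ae_eq p (transOp a ψ), transOp_ae_eq a ψ,
    Lp.coeFn_smul (planeWave p a) ((waveOp p ∘L transOp a) ψ)] with x h1 h2 h3 h4 h5
  rw [ContinuousLinearMap.comp_apply, h1, h2, _root_.smul_apply, h5, Pi.smul_apply,
    ContinuousLinearMap.comp_apply, h3, h4, planeWave_add_right, smul_eq_mul]
  ring

/-! ### The Fourier transform on `L²` -/

/-- The Fourier transform as a bounded operator. -/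
def fourOp : Op := (Lp.fourierTransformₗᵢ R3 ℂ).toContinuousLinearEquiv.toContinuousLinearMap

/-- The inverse Fourier transform as a bounded operator. -/
def fourInvOp : Op :=
  (Lp.fourierTransformₗᵢ R3 ℂ).symm.toContinuousLinearEquiv.toContinuousLinearMap

theorem fourOp_comp_fourInvOp : fourOp ∘L fourInvOp = 1 := by
  ext1 ψ
  exact (Lp.fourierTransformₗᵢ R3 ℂ).apply_symm_apply ψ

theorem fourInvOp_comp_fourOp : fourInvOp ∘L fourOp = 1 := by
  ext1 ψ
  exact (Lp.fourierTransformₗᵢ R3 ℂ).symm_apply_apply ψ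

theorem adjoint_fourOp : adjoint fourOp = fourInvOp := by
  refine ((eq_adjoint_iff _ _).2 fun φ ψ => ?_).symm
  have h := (Lp.fourierTransformₗᵢ R3 ℂ).inner_map_map (fourInvOp φ) ψ
  rw [← h]
  congr 1
  exact (Lp.fourierTransformₗᵢ R3 ℂ).apply_symm_apply φ

theorem adjoint_fourInvOp : adjoint fourInvOp = fourOp := by
  rw [← adjoint_fourOp, adjoint_adjoint]

theorem norm_fourOp_le : ‖fourOp‖ ≤ 1 :=
  LinearIsometry.norm_toContinuousLinearMap_le (Lp.fourierTransformₗᵢ R3 ℂ).toLinearIsometry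

theorem norm_fourInvOp_le : ‖fourInvOp‖ ≤ 1 :=
  LinearIsometry.norm_toContinuousLinearMap_le (Lp.fourierTransformₗᵢ R3 ℂ).symm.toLinearIsometry

theorem fourOp_toL2 (φ : 𝓢(R3, ℂ)) : fourOp (toL2 φ) = toL2 (𝓕 φ) :=
  SchwartzMap.toLp_fourier_eq φ

theorem fourInvOp_toL2 (φ : 𝓢(R3, ℂ)) : fourInvOp (toL2 φ) = toL2 (𝓕⁻ φ) :=
  SchwartzMap.toLp_fourierInv_eq φ

theorem hasTemperateGrowth_exp_mul_I :
    (fun y : ℝ => Complex.exp (Complex.I * y)).HasTemperateGrowth := by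
  have hd : ∀ n : ℕ, iteratedDeriv n (fun y : ℝ => Complex.exp (Complex.I * y)) =
      fun y : ℝ => Complex.I ^ n * Complex.exp (Complex.I * y) := by
    intro n
    induction n with
    | zero => simp
    | succ n ih =>
      rw [iteratedDeriv_succ, ih]
      ext y
      have h1 : HasDerivAt (fun y : ℝ => Complex.I * (y : ℂ)) Complex.I y := by
        simpa using (Complex.ofRealCLM.hasDerivAt (x := y)).const_mul Complex.I
      rw [(h1.cexp.const_mul (Complex.I ^ n)).deriv]
      ring
  refine ⟨(contDiff_const.mul Complex.ofRealCLM.contDiff).cexp, fun n => ⟨0, 1, fun y => ?_⟩⟩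
  rw [norm_iteratedFDeriv_eq_norm_iteratedDeriv, hd, norm_mul, norm_pow, Complex.norm_I,
    mul_comm Complex.I, Complex.norm_exp_ofReal_mul_I]
  simp

theorem hasTemperateGrowth_exp_mul_I_comp {f : R3 → ℝ} (hf : f.HasTemperateGrowth) :
    (fun x => Complex.exp (Complex.I * f x)).HasTemperateGrowth :=
  hasTemperateGrowth_exp_mul_I.comp hf

theorem hasTemperateGrowth_planeWave (p : R3) : (planeWave p).HasTemperateGrowth :=
  hasTemperateGrowth_exp_mul_I_comp (by fun_prop)

theorem mulOp_toL2 {f : R3 → ℂ} (hf : MemLp f ∞ (volume : Measure R3))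
    (hg : f.HasTemperateGrowth) (φ : 𝓢(R3, ℂ)) :
    mulOp f (toL2 φ) = toL2 (SchwartzMap.smulLeftCLM ℂ f φ) := by
  refine Lp.ext ?_
  filter_upwards [mulOp_ae_eq hf (toL2 φ), φ.coeFn_toLp 2 volume,
    (SchwartzMap.smulLeftCLM ℂ f φ).coeFn_toLp 2 volume] with x h1 h2 h3
  rw [h1, h2, h3, SchwartzMap.smulLeftCLM_apply_apply hg, smul_eq_mul]

/-- The Fourier transform is normalized with e^{-2πi x·ξ}, so a modulation by p becomes a shift by
p/(2π). This is the origin of the factors 2π throughout. -/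
theorem fourier_planeWave_mul (p ξ : R3) (φ : R3 → ℂ) :
    𝓕 (fun x => planeWave p x * φ x) ξ = 𝓕 φ (ξ + (-(2 * Real.pi)⁻¹) • p) := by
  rw [Real.fourier_eq', Real.fourier_eq']
  refine integral_congr_ae (Eventually.of_forall fun x => ?_)
  simp only [smul_eq_mul, planeWave]
  rw [← mul_assoc, ← Complex.exp_add, inner_add_right, inner_smul_right, real_inner_comm x p]
  congr 2
  push_cast
  have : (Real.pi : ℂ) ≠ 0 := by exact_mod_cast Real.pi_ne_zero
  field_simp
  ring

theorem fourOp_comp_waveOp (p : R3) :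
    fourOp ∘L waveOp p = transOp ((-(2 * Real.pi)⁻¹) • p) ∘L fourOp := by
  refine ext_toL2 fun φ => ?_
  rw [ContinuousLinearMap.comp_apply, ContinuousLinearMap.comp_apply, waveOp,
    mulOp_toL2 (memLp_planeWave p) (hasTemperateGrowth_planeWave p), fourOp_toL2, fourOp_toL2]
  refine Lp.ext ?_
  set a := (-(2 * Real.pi)⁻¹) • p
  filter_upwards [(𝓕 (SchwartzMap.smulLeftCLM ℂ (planeWave p) φ)).coeFn_toLp 2 volume,
    transOp_ae_eq a (toL2 (𝓕 φ)), ae_add_right ((𝓕 φ).coeFn_toLp 2 volume) a]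
    with ξ h1 h2 h3
  rw [h1, h2, h3, SchwartzMap.fourier_coe, SchwartzMap.fourier_coe, ← fourier_planeWave_mul]
  refine congrFun (congrArg _ (funext fun x => ?_)) ξ
  rw [SchwartzMap.smulLeftCLM_apply_apply (hasTemperateGrowth_planeWave p), smul_eq_mul]

theorem fourier_comp_add (a ξ : R3) (φ : R3 → ℂ) :
    𝓕 (fun x => φ (x + a)) ξ = planeWave ((2 * Real.pi) • a) ξ * 𝓕 φ ξ := by
  rw [Real.fourier_eq', Real.fourier_eq', ← integral_const_mul,
    ← integral_add_right_eq_self (fun x => planeWave ((2 * Real.pi) • a) ξ *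
      Complex.exp (↑(-2 * Real.pi * ⟪x, ξ⟫_ℝ) * Complex.I) • φ x) a]
  refine integral_congr_ae (Eventually.of_forall fun x => ?_)
  simp only [smul_eq_mul, planeWave]
  rw [← mul_assoc, ← Complex.exp_add, inner_add_left, inner_smul_left]
  congr 2
  push_cast
  simp
  ring

theorem transOp_toL2 (a : R3) (φ : 𝓢(R3, ℂ)) :
    transOp a (toL2 φ) = toL2 (φ.compSubConstCLM ℂ (-a)) := by
  refine Lp.ext ?_
  filter_upwards [transOp_ae_eq a (toL2 φ), ae_add_right (φ.coeFn_toLp 2 volume) a,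
    (φ.compSubConstCLM ℂ (-a)).coeFn_toLp 2 volume] with x h1 h2 h3
  rw [h1, h2, h3, SchwartzMap.compSubConstCLM_apply, sub_neg_eq_add]

theorem fourOp_comp_transOp (a : R3) :
    fourOp ∘L transOp a = waveOp ((2 * Real.pi) • a) ∘L fourOp := by
  refine ext_toL2 fun φ => ?_
  rw [ContinuousLinearMap.comp_apply, ContinuousLinearMap.comp_apply, transOp_toL2, fourOp_toL2,
    fourOp_toL2]
  refine Lp.ext ?_
  filter_upwards [(𝓕 (φ.compSubConstCLM ℂ (-a))).coeFn_toLp 2 volume,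
    waveOp_ae_eq ((2 * Real.pi) • a) (toL2 (𝓕 φ)), (𝓕 φ).coeFn_toLp 2 volume]
    with ξ h1 h2 h3
  rw [h1, h2, h3, SchwartzMap.fourier_coe, SchwartzMap.fourier_coe, ← fourier_comp_add]
  refine congrFun (congrArg _ (funext fun x => ?_)) ξ
  rw [SchwartzMap.compSubConstCLM_apply, sub_neg_eq_add]

end Operators

/-! ### The free propagator -/

section FreePropagator

open ContinuousLinearMap Filter
open scoped Topology

/-- The Fourier multiplier of the free propagator. -/
def chirp (κ t : ℝ) (ξ : R3) : ℂ :=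
  Complex.exp (Complex.I * ((-(t * κ * (2 * Real.pi) ^ 2 * ‖ξ‖ ^ 2) : ℝ) : ℂ))

theorem norm_chirp (κ t : ℝ) (ξ : R3) : ‖chirp κ t ξ‖ = 1 := by
  rw [chirp, mul_comm, Complex.norm_exp_ofReal_mul_I]

theorem memLp_chirp (κ t : ℝ) : MemLp (chirp κ t) ∞ (volume : Measure R3) :=
  memLp_top_of_norm_eq_one (by unfold chirp; fun_prop) (norm_chirp κ t)

theorem hasTemperateGrowth_chirp (κ t : ℝ) : (chirp κ t).HasTemperateGrowth :=
  hasTemperateGrowth_exp_mul_I_comp (by fun_prop)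

theorem chirp_add (κ s t : ℝ) (ξ : R3) : chirp κ (s + t) ξ = chirp κ s ξ * chirp κ t ξ := by
  rw [chirp, chirp, chirp, ← Complex.exp_add]
  push_cast
  ring_nf

theorem conj_chirp (κ t : ℝ) (ξ : R3) : (starRingEnd ℂ) (chirp κ t ξ) = chirp κ (-t) ξ := by
  rw [chirp, chirp, ← Complex.exp_conj, map_mul, Complex.conj_I, Complex.conj_ofReal]
  push_cast
  ring_nf

/-- The free propagator `exp (i κ t Δ)`. -/
def freeProp (κ t : ℝ) : Op := fourInvOp ∘L mulOp (chirp κ t) ∘L fourOp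

theorem freeProp_comp (κ s t : ℝ) : freeProp κ s ∘L freeProp κ t = freeProp κ (s + t) := by
  have h : mulOp (chirp κ s) * mulOp (chirp κ t) = mulOp (chirp κ (s + t)) := by
    rw [mul_def, mulOp_comp (memLp_chirp κ s) (memLp_chirp κ t)]
    simp_rw [← chirp_add]
  have h1 : fourOp * fourInvOp = 1 := fourOp_comp_fourInvOp
  simp only [freeProp, ← mul_def]
  calc _ = fourInvOp * (mulOp (chirp κ s) * (fourOp * fourInvOp) * mulOp (chirp κ t) * fourOp) := by
        simp only [mul_assoc]
    _ = _ := by rw [h1, mul_one, h]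

@[simp] theorem freeProp_zero (κ : ℝ) : freeProp κ 0 = 1 := by
  have : chirp κ 0 = fun _ => 1 := by ext ξ; simp [chirp]
  rw [freeProp, this, mulOp_one]
  exact fourInvOp_comp_fourOp

theorem adjoint_freeProp (κ t : ℝ) : adjoint (freeProp κ t) = freeProp κ (-t) := by
  rw [freeProp, adjoint_comp, adjoint_comp, adjoint_fourOp, adjoint_fourInvOp,
    adjoint_mulOp (memLp_chirp κ t), ContinuousLinearMap.comp_assoc, freeProp]
  simp_rw [conj_chirp]

theorem norm_freeProp_le (κ t : ℝ) : ‖freeProp κ t‖ ≤ 1 := by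
  have h1 : ‖mulOp (chirp κ t)‖ ≤ 1 :=
    norm_mulOp_le zero_le_one (memLp_chirp κ t) fun x => (norm_chirp κ t x).le
  refine (opNorm_comp_le _ _).trans (mul_le_one₀ norm_fourInvOp_le (norm_nonneg _) ?_)
  exact (opNorm_comp_le _ _).trans (mul_le_one₀ h1 (norm_nonneg _) norm_fourOp_le)

/-- Moves an intertwining relation for the free propagator to momentum space, where the propagator
is multiplication by the chirp. -/
theorem freeProp_comp_of_fourier {κ t : ℝ} {A B A' B' : Op} (hA : fourOp ∘L A = A' ∘L fourOp)
    (hB : fourOp ∘L B = B' ∘L fourOp)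
    (h : mulOp (chirp κ t) ∘L A' = B' ∘L mulOp (chirp κ t)) :
    freeProp κ t ∘L A = B ∘L freeProp κ t := by
  have h1 : fourOp * fourInvOp = 1 := fourOp_comp_fourInvOp
  have h2 : fourInvOp * fourOp = 1 := fourInvOp_comp_fourOp
  simp only [freeProp, ← mul_def] at hA hB h ⊢
  calc _ = fourInvOp * (mulOp (chirp κ t) * (fourOp * A)) := by simp only [mul_assoc]
    _ = fourInvOp * ((mulOp (chirp κ t) * A') * fourOp) := by rw [hA, mul_assoc]
    _ = fourInvOp * (B' * (fourOp * fourInvOp) * mulOp (chirp κ t) * fourOp) := by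
      rw [h, h1, mul_one]
    _ = fourInvOp * ((fourOp * B) * fourInvOp * mulOp (chirp κ t) * fourOp) := by
      rw [hB]; simp only [mul_assoc]
    _ = (fourInvOp * fourOp) * (B * (fourInvOp * (mulOp (chirp κ t) * fourOp))) := by
      simp only [mul_assoc]
    _ = _ := by rw [h2, one_mul]

theorem freeProp_comp_transOp (κ t : ℝ) (a : R3) :
    freeProp κ t ∘L transOp a = transOp a ∘L freeProp κ t := by
  refine freeProp_comp_of_fourier (fourOp_comp_transOp a) (fourOp_comp_transOp a) ?_
  rw [waveOp, mulOp_comp (memLp_chirp κ t) (memLp_planeWave _),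
    mulOp_comp (memLp_planeWave _) (memLp_chirp κ t)]
  simp_rw [mul_comm]

/-- The difference between |ξ|² and |ξ - p/(2π)|² is affine in ξ: its linear part is a plane wave,
that is, a translation in position space, and its constant part a scalar phase. -/
theorem chirp_eq_mul (κ t : ℝ) (p ξ : R3) :
    chirp κ t ξ = Complex.exp (Complex.I * ((t * κ * ‖p‖ ^ 2 : ℝ) : ℂ)) *
      (planeWave ((2 * Real.pi) • (-(2 * κ * t)) • p) ξ *
        chirp κ t (ξ + (-(2 * Real.pi)⁻¹) • p)) := by
  rw [chirp, chirp, planeWave, ← Complex.exp_add, ← Complex.exp_add]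
  congr 1
  rw [← mul_add, ← mul_add]
  congr 1
  rw [← Complex.ofReal_add, ← Complex.ofReal_add]
  congr 1
  rw [@norm_add_sq ℝ, norm_smul, inner_smul_left, inner_smul_left, inner_smul_right,
    real_inner_comm p ξ]
  simp only [RCLike.re_to_real, norm_neg, norm_inv, norm_mul, Real.norm_eq_abs, mul_pow, inv_pow,
    sq_abs, conj_trivial]
  have := Real.pi_ne_zero
  field_simp
  ring

/-- The free propagator maps plane waves to Weyl operators. -/
theorem freeProp_comp_waveOp (κ t : ℝ) (p : R3) :
    freeProp κ t ∘L waveOp p = (Complex.exp (Complex.I * ((t * κ * ‖p‖ ^ 2 : ℝ) : ℂ)) •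
      (transOp ((-(2 * κ * t)) • p) ∘L waveOp p)) ∘L freeProp κ t := by
  set z := Complex.exp (Complex.I * ((t * κ * ‖p‖ ^ 2 : ℝ) : ℂ)) with hz
  refine freeProp_comp_of_fourier (fourOp_comp_waveOp p)
    (B' := z • (waveOp ((2 * Real.pi) • (-(2 * κ * t)) • p) ∘L
      transOp ((-(2 * Real.pi)⁻¹) • p))) ?_ ?_
  · rw [ContinuousLinearMap.comp_smul, ContinuousLinearMap.smul_comp,
      ← ContinuousLinearMap.comp_assoc, fourOp_comp_transOp, ContinuousLinearMap.comp_assoc,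
      fourOp_comp_waveOp, ContinuousLinearMap.comp_assoc]
  · ext1 ψ
    refine Lp.ext ?_
    set τ := (-(2 * Real.pi)⁻¹) • p with hτ
    set q := (2 * Real.pi) • (-(2 * κ * t)) • p with hq
    filter_upwards [mulOp_ae_eq (memLp_chirp κ t) (transOp τ ψ), transOp_ae_eq τ ψ,
      Lp.coeFn_smul z ((waveOp q ∘L transOp τ) (mulOp (chirp κ t) ψ)),
      waveOp_ae_eq q (transOp τ (mulOp (chirp κ t) ψ)), transOp_ae_eq τ (mulOp (chirp κ t) ψ),
      ae_add_right (mulOp_ae_eq (memLp_chirp κ t) ψ) τ] with ξ h1 h2 h3 h4 h5 h6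
    rw [ContinuousLinearMap.comp_apply, h1, h2, ContinuousLinearMap.comp_apply, _root_.smul_apply,
      h3, Pi.smul_apply, ContinuousLinearMap.comp_apply, h4, h5, h6, smul_eq_mul,
      chirp_eq_mul κ t p ξ]
    ring

theorem norm_exp_mul_I_sub_one_sub_le (y : ℝ) :
    ‖Complex.exp (Complex.I * y) - 1 - Complex.I * y‖ ≤ 2 * y ^ 2 := by
  have hn : ‖Complex.I * (y : ℂ)‖ = |y| := by
    rw [norm_mul, Complex.norm_I, one_mul, Complex.norm_real, Real.norm_eq_abs]
  rcases le_total |y| 1 with h | h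
  · have := Complex.norm_exp_sub_one_sub_id_le (x := Complex.I * y) (by rwa [hn])
    rw [hn, sq_abs] at this
    nlinarith [sq_nonneg y]
  · have h1 := Real.norm_exp_I_mul_ofReal_sub_one_le (x := y)
    refine (norm_sub_le _ _).trans ?_
    rw [hn]
    rw [Real.norm_eq_abs] at h1
    have : y ^ 2 = |y| ^ 2 := (sq_abs y).symm
    rw [this]
    nlinarith

/-- The free evolution of a Schwartz function. -/
def freeSchwartz (κ t : ℝ) (φ : 𝓢(R3, ℂ)) : 𝓢(R3, ℂ) :=
  SchwartzMap.fourierMultiplierCLM ℂ (chirp κ t) φ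

theorem freeProp_toL2 (κ t : ℝ) (φ : 𝓢(R3, ℂ)) :
    freeProp κ t (toL2 φ) = toL2 (freeSchwartz κ t φ) := by
  rw [freeProp, ContinuousLinearMap.comp_apply, ContinuousLinearMap.comp_apply, fourOp_toL2,
    mulOp_toL2 (memLp_chirp κ t) (hasTemperateGrowth_chirp κ t), fourInvOp_toL2, freeSchwartz,
    SchwartzMap.fourierMultiplierCLM_apply]

/-- The function `ξ ↦ exp (i s θ(ξ))`. -/
def phase (θ : R3 → ℝ) (s : ℝ) (ξ : R3) : ℂ := Complex.exp (Complex.I * ((s * θ ξ : ℝ) : ℂ))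

theorem norm_phase (θ : R3 → ℝ) (s : ℝ) (ξ : R3) : ‖phase θ s ξ‖ = 1 := by
  rw [phase, mul_comm, Complex.norm_exp_ofReal_mul_I]

theorem hasTemperateGrowth_phase {θ : R3 → ℝ} (hθ : θ.HasTemperateGrowth) (s : ℝ) :
    (phase θ s).HasTemperateGrowth :=
  hasTemperateGrowth_exp_mul_I_comp ((Function.HasTemperateGrowth.const s).mul hθ)

theorem memLp_phase {θ : R3 → ℝ} (hθ : θ.HasTemperateGrowth) (s : ℝ) :
    MemLp (phase θ s) ∞ (volume : Measure R3) :=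
  memLp_top_of_norm_eq_one (hasTemperateGrowth_phase hθ s).1.continuous (norm_phase θ s)

theorem hasTemperateGrowth_I_mul {θ : R3 → ℝ} (hθ : θ.HasTemperateGrowth) :
    (fun ξ => Complex.I * (θ ξ : ℂ)).HasTemperateGrowth :=
  (Function.HasTemperateGrowth.const Complex.I).mul
    (Function.HasTemperateGrowth.comp Function.Complex.hasTemperateGrowth_ofReal hθ)

theorem hasDerivAt_mulOp_phase {θ : R3 → ℝ} (hθ : θ.HasTemperateGrowth) (t : ℝ) (g : 𝓢(R3, ℂ)) :
    HasDerivAt (fun s => mulOp (phase θ s) (toL2 g))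
      (mulOp (phase θ t) (toL2 (SchwartzMap.smulLeftCLM ℂ
        (fun ξ : R3 => Complex.I * (θ ξ : ℂ)) g))) t := by
  set lam : R3 → ℂ := fun ξ => Complex.I * (θ ξ : ℂ) with hlam
  have hl : lam.HasTemperateGrowth := hasTemperateGrowth_I_mul hθ
  set g1 := SchwartzMap.smulLeftCLM ℂ lam g
  set g2 := SchwartzMap.smulLeftCLM ℂ lam g1
  rw [hasDerivAt_iff_isLittleO]
  -- The second-order Taylor remainder is bounded pointwise by 2(s-t)²θ²|g|, and θ²g is again a
  -- Schwartz function, so the L² remainder is O((s-t)²).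
  have hbig : (fun s => mulOp (phase θ s) (toL2 g) - mulOp (phase θ t) (toL2 g) -
      (s - t) • mulOp (phase θ t) (toL2 g1)) =O[𝓝 t] fun s => (s - t) ^ 2 := by
    refine Asymptotics.IsBigO.of_bound (2 * ‖toL2 g2‖) (Eventually.of_forall fun s => ?_)
    rw [norm_pow, Real.norm_eq_abs, sq_abs, mul_right_comm]
    refine Lp.norm_le_mul_norm_of_ae_le_mul ?_
    filter_upwards [mulOp_ae_eq (memLp_phase hθ s) (toL2 g), mulOp_ae_eq (memLp_phase hθ t) (toL2 g),
      mulOp_ae_eq (memLp_phase hθ t) (toL2 g1), g.coeFn_toLp 2 volume, g1.coeFn_toLp 2 volume,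
      g2.coeFn_toLp 2 volume,
      Lp.coeFn_sub (mulOp (phase θ s) (toL2 g)) (mulOp (phase θ t) (toL2 g)),
      Lp.coeFn_sub (mulOp (phase θ s) (toL2 g) - mulOp (phase θ t) (toL2 g))
        ((s - t) • mulOp (phase θ t) (toL2 g1)),
      Lp.coeFn_smul (s - t) (mulOp (phase θ t) (toL2 g1))] with ξ h1 h2 h3 h4 h5 h6 h7 h8 h9
    rw [h8, Pi.sub_apply, h7, Pi.sub_apply, h9, Pi.smul_apply, h1, h2, h3, h4, h5, h6,
      SchwartzMap.smulLeftCLM_apply_apply hl, SchwartzMap.smulLeftCLM_apply_apply hl,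
      SchwartzMap.smulLeftCLM_apply_apply hl]
    set y : ℝ := (s - t) * θ ξ with hy
    have e1 : phase θ s ξ = phase θ t ξ * Complex.exp (Complex.I * y) := by
      rw [phase, phase, ← Complex.exp_add, hy]
      push_cast
      ring_nf
    have e2 : ((s - t : ℝ) : ℂ) * lam ξ = Complex.I * y := by
      simp only [hlam, hy]
      push_cast
      ring
    have e3 : phase θ s ξ * g ξ - phase θ t ξ * g ξ - (s - t) • (phase θ t ξ * (lam ξ • g ξ)) =
        phase θ t ξ * (Complex.exp (Complex.I * y) - 1 - Complex.I * y) * g ξ := by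
      rw [e1, Complex.real_smul, smul_eq_mul]
      linear_combination (-(phase θ t ξ * g ξ)) * e2
    have e4 : ‖lam ξ • lam ξ • g ξ‖ * (s - t) ^ 2 = y ^ 2 * ‖g ξ‖ := by
      rw [norm_smul, norm_smul]
      have : ‖lam ξ‖ * |s - t| = |y| := by
        have hl1 : ‖lam ξ‖ = |θ ξ| := by
          simp only [hlam, norm_mul, Complex.norm_I, one_mul, Complex.norm_real, Real.norm_eq_abs]
        rw [hl1, hy, abs_mul, mul_comm]
      rw [← sq_abs (s - t), ← sq_abs y, ← this]
      ring
    rw [e3, norm_mul, norm_mul, norm_phase, one_mul]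
    calc _ ≤ 2 * y ^ 2 * ‖g ξ‖ := by
          gcongr
          exact norm_exp_mul_I_sub_one_sub_le y
      _ = _ := by rw [mul_assoc, ← e4]; ring
  refine hbig.trans_isLittleO ?_
  have h0 : (fun s : ℝ => s - t) =o[𝓝 t] fun _ => (1 : ℝ) := by
    rw [Asymptotics.isLittleO_one_iff]
    have : Tendsto (fun z => z - t) (𝓝 t) (𝓝 (t - t)) := tendsto_id.sub_const t
    rwa [sub_self] at this
  have h1 := h0.mul_isBigO (Asymptotics.isBigO_refl (fun s : ℝ => s - t) (𝓝 t))
  simpa [sq] using h1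

/-- The free Schrödinger equation. -/
theorem hasDerivAt_freeProp_toL2 (N : ℕ) (hN : hbar N ≠ 0) (t : ℝ) (φ : 𝓢(R3, ℂ)) :
    HasDerivAt (fun s => freeProp (hbar N) s (toL2 φ))
      ((Complex.I * (hbar N : ℂ))⁻¹ • kinetic N (freeSchwartz (hbar N) t φ)) t := by
  set κ := hbar N
  set θ : R3 → ℝ := fun ξ => -(κ * (2 * Real.pi) ^ 2 * ‖ξ‖ ^ 2) with hθ
  have hθt : θ.HasTemperateGrowth := by fun_prop
  set lam : R3 → ℂ := fun ξ => Complex.I * (θ ξ : ℂ) with hlam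
  have hnsq : (fun ξ : R3 => ((‖ξ‖ ^ 2 : ℝ) : ℂ)).HasTemperateGrowth :=
    Function.HasTemperateGrowth.comp Function.Complex.hasTemperateGrowth_ofReal (by fun_prop)
  have hl : lam.HasTemperateGrowth := hasTemperateGrowth_I_mul hθt
  have hchirp : ∀ s, phase θ s = chirp κ s := fun s => by
    ext ξ
    rw [phase, chirp, hθ]
    congr 3
    ring
  have h := (fourInvOp.restrictScalars ℝ).hasFDerivAt.comp_hasDerivAt t
    (hasDerivAt_mulOp_phase hθt t (𝓕 φ))
  simp only [hchirp] at h
  have hfun : ∀ s, freeProp κ s (toL2 φ) = fourInvOp (mulOp (chirp κ s) (toL2 (𝓕 φ))) :=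
    fun s => by rw [← fourOp_toL2]; rfl
  simp_rw [hfun]
  suffices hval : (Complex.I * (κ : ℂ))⁻¹ • kinetic N (freeSchwartz κ t φ) =
      fourInvOp (mulOp (chirp κ t) (toL2 (SchwartzMap.smulLeftCLM ℂ lam (𝓕 φ)))) by
    rw [hval]
    exact h
  rw [mulOp_toL2 (memLp_chirp κ t) (hasTemperateGrowth_chirp κ t), fourInvOp_toL2, kinetic]
  rw [SchwartzMap.laplacian_eq_fourierMultiplierCLM]
  have e1 : SchwartzMap.fourierMultiplierCLM ℂ ((fun ξ : R3 => ‖ξ‖ ^ 2 : R3 → ℝ))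
      (freeSchwartz κ t φ) =
      SchwartzMap.fourierMultiplierCLM ℂ (fun ξ : R3 => ((‖ξ‖ ^ 2 : ℝ) : ℂ))
      (freeSchwartz κ t φ) :=
    (SchwartzMap.fourierMultiplierCLM_ofReal ℂ (by fun_prop) _).symm
  have e2 : SchwartzMap.smulLeftCLM ℂ (chirp κ t) (SchwartzMap.smulLeftCLM ℂ lam (𝓕 φ)) =
      (-(Complex.I * ((κ * (2 * Real.pi) ^ 2 : ℝ) : ℂ))) •
      SchwartzMap.smulLeftCLM ℂ (fun ξ : R3 => ((‖ξ‖ ^ 2 : ℝ) : ℂ))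
        (SchwartzMap.smulLeftCLM ℂ (chirp κ t) (𝓕 φ)) := by
    ext ξ
    rw [SchwartzMap.smulLeftCLM_apply_apply (hasTemperateGrowth_chirp κ t),
      SchwartzMap.smulLeftCLM_apply_apply hl, _root_.smul_apply,
      SchwartzMap.smulLeftCLM_apply_apply hnsq,
      SchwartzMap.smulLeftCLM_apply_apply (hasTemperateGrowth_chirp κ t)]
    simp only [hlam, hθ, smul_eq_mul]
    push_cast
    ring
  have e3 : 𝓕⁻ (SchwartzMap.smulLeftCLM ℂ (chirp κ t) (SchwartzMap.smulLeftCLM ℂ lam (𝓕 φ))) =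
      (-(Complex.I * ((κ * (2 * Real.pi) ^ 2 : ℝ) : ℂ))) •
      SchwartzMap.fourierMultiplierCLM ℂ (fun ξ : R3 => ((‖ξ‖ ^ 2 : ℝ) : ℂ))
        (freeSchwartz κ t φ) := by
    rw [e2, FourierTransform.fourierInv_smul, SchwartzMap.fourierMultiplierCLM_apply,
      freeSchwartz, SchwartzMap.fourierMultiplierCLM_apply, FourierTransform.fourier_fourierInv_eq]
  rw [e3]
  rw [e1]
  set G := SchwartzMap.fourierMultiplierCLM ℂ (fun ξ : R3 => ((‖ξ‖ ^ 2 : ℝ) : ℂ))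
    (freeSchwartz κ t φ)
  have e5 : toL2 ((-(Complex.I * ((κ * (2 * Real.pi) ^ 2 : ℝ) : ℂ))) • G) =
    (-(Complex.I * ((κ * (2 * Real.pi) ^ 2 : ℝ) : ℂ))) • toL2 G := rfl
  have e6 : toL2 (-(2 * Real.pi) ^ 2 • G) = ((-(2 * Real.pi) ^ 2 : ℝ) : ℂ) • toL2 G := by
    have : (-(2 * Real.pi) ^ 2 • G) = ((-(2 * Real.pi) ^ 2 : ℝ) : ℂ) • G := by
      ext ξ
      simp
    rw [this]
    rfl
  rw [e5, e6, smul_smul, smul_neg, smul_smul, ← neg_smul]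
  congr 1
  have hk : (κ : ℂ) ≠ 0 := by exact_mod_cast hN
  have hI := Complex.I_ne_zero
  push_cast
  field_simp
  rw [Complex.I_sq]
  ring

theorem tendsto_apply_of_dense {X : Type*} {j : X → L2} (hj : DenseRange j) {ι : Type*}
    {l : Filter ι} {U : ι → Op} {V : Op} (hU : ∀ s, ‖U s‖ ≤ 1) (hV : ‖V‖ ≤ 1)
    (h : ∀ x, Tendsto (fun s => U s (j x)) l (𝓝 (V (j x)))) (ψ : L2) :
    Tendsto (fun s => U s ψ) l (𝓝 (V ψ)) := by
  rw [Metric.tendsto_nhds]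
  intro ε hε
  obtain ⟨x, hx⟩ := hj.exists_dist_lt ψ (show 0 < ε / 3 by positivity)
  filter_upwards [Metric.tendsto_nhds.1 (h x) (ε / 3) (by positivity)] with s hs
  have hle : ∀ A : Op, ‖A‖ ≤ 1 → dist (A ψ) (A (j x)) < ε / 3 := fun A hA => by
    rw [dist_eq_norm, ← map_sub]
    refine lt_of_le_of_lt ((A.le_opNorm _).trans (mul_le_of_le_one_left (norm_nonneg _) hA)) ?_
    rwa [← dist_eq_norm]
  have h1 := hle (U s) (hU s)
  have h2 := hle V hV
  have h3 := dist_triangle4_right (U s ψ) (V ψ) (U s (j x)) (V (j x))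
  linarith

theorem tendsto_freeProp (N : ℕ) (hN : hbar N ≠ 0) (t : ℝ) (ψ : L2) :
    Tendsto (fun s => freeProp (hbar N) s ψ) (𝓝 t) (𝓝 (freeProp (hbar N) t ψ)) :=
  tendsto_apply_of_dense denseRange_toL2 (fun s => norm_freeProp_le _ s) (norm_freeProp_le _ t)
    (fun φ => (hasDerivAt_freeProp_toL2 N hN t φ).continuousAt.tendsto) ψ

end FreePropagator

/-! ### The interaction picture -/

section InteractionPicture

open ContinuousLinearMap Filter
open scoped Topology

theorem enorm_le_one_of_norm_le_one {A : Op} (h : ‖A‖ ≤ 1) : ‖A‖ₑ ≤ 1 := by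
  rw [← ofReal_norm]
  exact ENNReal.ofReal_le_one.2 h

theorem traceNorm_conj_le {A B C : Op} (hA : ‖A‖ ≤ 1) (hC : ‖C‖ ≤ 1) :
    traceNorm (A ∘L B ∘L C) ≤ traceNorm B := by
  refine (traceNorm_comp_le_left _ _).trans ?_
  refine (mul_le_of_le_one_left zero_le (enorm_le_one_of_norm_le_one hA)).trans ?_
  refine (traceNorm_comp_le_right _ _).trans ?_
  exact mul_le_of_le_one_left zero_le (enorm_le_one_of_norm_le_one hC)

theorem tendsto_neg_nhds (t : ℝ) : Tendsto (fun s : ℝ => -s) (𝓝 t) (𝓝 (-t)) :=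
  continuous_neg.tendsto t

theorem tendsto_traceNorm_freeProp_sub (N : ℕ) (hN : hbar N ≠ 0) (t : ℝ) {Y : Op}
    (hY : traceNorm Y ≠ ∞) :
    Tendsto (fun s => traceNorm ((freeProp (hbar N) (-s) - freeProp (hbar N) (-t)) ∘L Y))
      (𝓝 t) (𝓝 0) := by
  refine tendsto_traceNorm_comp_left (M := 2) (fun s => ?_) (fun x => ?_) hY
  · refine (norm_sub_le _ _).trans ?_
    linarith [norm_freeProp_le (hbar N) (-s), norm_freeProp_le (hbar N) (-t)]
  · have h := (tendsto_freeProp N hN (-t) x).comp (tendsto_neg_nhds t)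
    have h2 := h.sub_const (freeProp (hbar N) (-t) x)
    rw [sub_self] at h2
    exact h2

/-- The operator `A` at time `t` in the interaction picture. -/
def interaction (N : ℕ) (t : ℝ) (A : Op) : Op :=
  freeProp (hbar N) (-t) ∘L A ∘L freeProp (hbar N) t

theorem tendsto_traceNorm_interaction_sub (N : ℕ) (hN : hbar N ≠ 0) (t : ℝ) {Y : ℝ → Op}
    (hY : traceNorm (Y t) ≠ ∞)
    (hYt : Tendsto (fun s => traceNorm (Y s - Y t)) (𝓝 t) (𝓝 0)) :
    Tendsto (fun s => traceNorm (interaction N s (Y s) - interaction N t (Y t))) (𝓝 t) (𝓝 0) := by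
  set U := freeProp (hbar N) with hU
  have hY' : traceNorm (adjoint (Y t)) ≠ ∞ := by rwa [traceNorm_adjoint]
  have hlim := (hYt.add (tendsto_traceNorm_freeProp_sub N hN t hY)).add
    (tendsto_traceNorm_freeProp_sub N hN t hY')
  simp only [add_zero] at hlim
  refine tendsto_of_tendsto_of_tendsto_of_le_of_le tendsto_const_nhds hlim
    (fun _ => zero_le) fun s => ?_
  have e : interaction N s (Y s) - interaction N t (Y t) =
      U (-s) ∘L (Y s - Y t) ∘L U s + (((U (-s) - U (-t)) ∘L Y t) ∘L U s +
        U (-t) ∘L (Y t ∘L (U s - U t))) := by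
    simp only [interaction, ← hU, ← mul_def, mul_sub, sub_mul, mul_assoc]
    abel
  -- The propagator is only strongly continuous, which helps on the left of a trace class operator;
  -- a difference on the right is brought to the left by taking adjoints.
  have e2 : traceNorm (Y t ∘L (U s - U t)) =
      traceNorm ((U (-s) - U (-t)) ∘L adjoint (Y t)) := by
    rw [← traceNorm_adjoint, adjoint_comp, map_sub, adjoint_freeProp, adjoint_freeProp]
  have hs : ∀ r, ‖U r‖ₑ ≤ 1 := fun r => enorm_le_one_of_norm_le_one (norm_freeProp_le _ _)
  rw [e, add_assoc]
  refine (traceNorm_add_le _ _).trans (add_le_add ?_ ((traceNorm_add_le _ _).trans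
    (add_le_add ?_ ?_)))
  · exact traceNorm_conj_le (norm_freeProp_le _ _) (norm_freeProp_le _ _)
  · exact (traceNorm_comp_le_right _ _).trans (mul_le_of_le_one_left zero_le (hs s))
  · rw [← e2]
    exact (traceNorm_comp_le_left _ _).trans (mul_le_of_le_one_left zero_le (hs _))

theorem interaction_comp (N : ℕ) (t : ℝ) (A B : Op) :
    interaction N t (A ∘L B) = interaction N t A ∘L interaction N t B := by
  have h : freeProp (hbar N) t * freeProp (hbar N) (-t) = 1 := by
    rw [mul_def, freeProp_comp, add_neg_cancel, freeProp_zero]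
  simp only [interaction, ← mul_def]
  calc _ = freeProp (hbar N) (-t) * A * 1 * B * freeProp (hbar N) t := by
        simp only [mul_one, mul_assoc]
    _ = _ := by rw [← h]; simp only [mul_assoc]

theorem interaction_sub (N : ℕ) (t : ℝ) (A B : Op) :
    interaction N t (A - B) = interaction N t A - interaction N t B := by
  simp only [interaction, ContinuousLinearMap.sub_comp, ContinuousLinearMap.comp_sub]

theorem interaction_smul (N : ℕ) (t : ℝ) (z : ℂ) (A : Op) :
    interaction N t (z • A) = z • interaction N t A := by
  simp only [interaction, ContinuousLinearMap.smul_comp, ContinuousLinearMap.comp_smul]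

theorem interaction_comm (N : ℕ) (t : ℝ) (A B : Op) :
    interaction N t (comm A B) = comm (interaction N t A) (interaction N t B) := by
  simp only [comm, interaction_sub, interaction_comp]

theorem adjoint_interaction (N : ℕ) (t : ℝ) (A : Op) :
    adjoint (interaction N t A) = interaction N t (adjoint A) := by
  simp only [interaction, adjoint_comp, adjoint_freeProp, neg_neg, ContinuousLinearMap.comp_assoc]

@[simp] theorem interaction_zero_time (N : ℕ) (A : Op) : interaction N 0 A = A := by
  simp only [interaction, neg_zero, freeProp_zero, ← mul_def, mul_one, one_mul]

theorem interaction_neg_interaction (N : ℕ) (t : ℝ) (A : Op) :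
    interaction N (-t) (interaction N t A) = A := by
  have h : freeProp (hbar N) t * freeProp (hbar N) (-t) = 1 := by
    rw [mul_def, freeProp_comp, add_neg_cancel, freeProp_zero]
  simp only [interaction, ← mul_def, neg_neg]
  calc _ = (freeProp (hbar N) t * freeProp (hbar N) (-t)) * A *
        (freeProp (hbar N) t * freeProp (hbar N) (-t)) := by simp only [mul_assoc]
    _ = A := by rw [h, one_mul, mul_one]

theorem traceNorm_interaction (N : ℕ) (t : ℝ) (A : Op) :
    traceNorm (interaction N t A) = traceNorm A := by
  have h : ∀ t A, traceNorm (interaction N t A) ≤ traceNorm A := fun t A =>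
    traceNorm_conj_le (norm_freeProp_le _ _) (norm_freeProp_le _ _)
  refine le_antisymm (h t A) ?_
  conv_lhs => rw [← interaction_neg_interaction N t A]
  exact h _ _

theorem enorm_interaction (N : ℕ) (t : ℝ) (A : Op) : ‖interaction N t A‖ₑ = ‖A‖ₑ := by
  have h : ∀ t A, ‖interaction N t A‖ₑ ≤ ‖A‖ₑ := fun t A => by
    have h1 : ∀ r, ‖freeProp (hbar N) r‖ₑ ≤ 1 :=
      fun r => enorm_le_one_of_norm_le_one (norm_freeProp_le _ _)
    refine (enorm_comp_le _ _).trans ((mul_le_of_le_one_left zero_le (h1 _)).trans ?_)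
    exact (enorm_comp_le _ _).trans (mul_le_of_le_one_right zero_le (h1 _))
  refine le_antisymm (h t A) ?_
  conv_lhs => rw [← interaction_neg_interaction N t A]
  exact h _ _

theorem hasDerivAt_inner_of_eq_zero_left {a b : ℝ → L2} {a' : L2} {t : ℝ} (ha : HasDerivAt a a' t)
    (h0 : a t = 0) (hb : ContinuousAt b t) :
    HasDerivAt (fun s => ⟪a s, b s⟫_ℂ) ⟪a', b t⟫_ℂ t := by
  rw [hasDerivAt_iff_tendsto_slope] at ha ⊢
  have h := ha.inner (𝕜 := ℂ) (hb.tendsto.mono_left (nhdsWithin_le_nhds (s := {t}ᶜ)))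
  refine h.congr fun s => ?_
  rw [slope_def_module, slope_def_module, h0, inner_zero_left, sub_zero, sub_zero,
    inner_smul_left_eq_smul]

theorem hasDerivAt_inner_of_eq_zero_right {a b : ℝ → L2} {b' : L2} {t : ℝ} (hb : HasDerivAt b b' t)
    (h0 : b t = 0) (ha : ContinuousAt a t) :
    HasDerivAt (fun s => ⟪a s, b s⟫_ℂ) ⟪a t, b'⟫_ℂ t := by
  rw [hasDerivAt_iff_tendsto_slope] at hb ⊢
  have h := (ha.tendsto.mono_left (nhdsWithin_le_nhds (s := {t}ᶜ))).inner (𝕜 := ℂ) hb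
  refine h.congr fun s => ?_
  rw [slope_def_module, slope_def_module, h0, inner_zero_right, sub_zero, sub_zero,
    inner_smul_right_eq_smul]

/-- The operator curve is norm continuous but differentiable only against the frozen vectors f t and
g t. The increments of f and g are split off; each of them vanishes at t, so mere continuity of the
other factor suffices there. -/
theorem hasDerivAt_inner_apply {f g : ℝ → L2} {f' g' : L2} {ω : ℝ → Op} {t : ℝ} {z : ℂ}
    (hf : HasDerivAt f f' t) (hg : HasDerivAt g g' t) (hω : ContinuousAt ω t)
    (h : HasDerivAt (fun s => ⟪f t, ω s (g t)⟫_ℂ) z t) :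
    HasDerivAt (fun s => ⟪f s, ω s (g s)⟫_ℂ) (⟪f', ω t (g t)⟫_ℂ + ⟪f t, ω t g'⟫_ℂ + z) t := by
  have h1 : HasDerivAt (fun s => ⟪f s - f t, ω s (g s)⟫_ℂ) ⟪f', ω t (g t)⟫_ℂ t :=
    hasDerivAt_inner_of_eq_zero_left (hf.sub_const (f t)) (sub_self _)
      (hω.clm_apply hg.continuousAt)
  have h2 : HasDerivAt (fun s => ⟪adjoint (ω s) (f t), g s - g t⟫_ℂ)
      ⟪adjoint (ω t) (f t), g'⟫_ℂ t := by
    refine hasDerivAt_inner_of_eq_zero_right (hg.sub_const (g t)) (sub_self _) ?_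
    have : ContinuousAt (fun s => adjoint (ω s)) t :=
      (adjoint (𝕜 := ℂ) (E := L2) (F := L2)).continuous.continuousAt.comp hω
    exact this.clm_apply continuousAt_const
  simp only [adjoint_inner_left] at h2
  refine ((h1.add h2).add h).congr_of_eventuallyEq (Eventually.of_forall fun s => ?_)
  simp only [Pi.add_apply, inner_sub_left, inner_sub_right, map_sub]
  ring

theorem continuousAt_of_tendsto_traceNorm {ω : ℝ → Op} {t : ℝ}
    (h : Tendsto (fun s => traceNorm (ω s - ω t)) (𝓝 t) (𝓝 0)) : ContinuousAt ω t := by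
  rw [ContinuousAt, tendsto_iff_edist_tendsto_0]
  refine tendsto_of_tendsto_of_tendsto_of_le_of_le tendsto_const_nhds h (fun _ => zero_le)
    fun s => ?_
  rw [edist_eq_enorm_sub]
  exact enorm_le_traceNorm _

theorem hasTraceDerivAt_interaction {N : ℕ} (hN : hbar N ≠ 0) {ω W : ℝ → Op}
    (htc : ∀ t, traceNorm (ω t) ≠ ∞)
    (hcont : ∀ t, Tendsto (fun s => traceNorm (ω s - ω t)) (𝓝 t) (𝓝 0))
    (hW : ∀ t, Tendsto (fun s => ‖W s - W t‖ₑ) (𝓝 t) (𝓝 0))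
    (heq : ∀ t, ∀ φ ψ : 𝓢(R3, ℂ),
      HasDerivAt (fun s => Complex.I * (hbar N : ℂ) * ⟪toL2 φ, ω s (toL2 ψ)⟫_ℂ)
        (⟪kinetic N φ, ω t (toL2 ψ)⟫_ℂ - ⟪toL2 φ, ω t (kinetic N ψ)⟫_ℂ
          + ⟪toL2 φ, (W t ∘L ω t - ω t ∘L W t) (toL2 ψ)⟫_ℂ) t) (t : ℝ) :
    HasTraceDerivAt (fun t => interaction N t (ω t))
      (-Complex.I • comm (interaction N t (((hbar N)⁻¹ : ℂ) • W t)) (interaction N t (ω t))) t := by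
  have hI : (Complex.I * (hbar N : ℂ)) ≠ 0 :=
    mul_ne_zero Complex.I_ne_zero (by exact_mod_cast hN)
  have hz : ∀ t, -Complex.I • comm (interaction N t (((hbar N)⁻¹ : ℂ) • W t))
      (interaction N t (ω t)) =
      interaction N t ((Complex.I * (hbar N : ℂ))⁻¹ • comm (W t) (ω t)) := fun t => by
    have : comm (((hbar N)⁻¹ : ℂ) • W t) (ω t) = ((hbar N)⁻¹ : ℂ) • comm (W t) (ω t) := by
      simp only [comm, ContinuousLinearMap.smul_comp, ContinuousLinearMap.comp_smul, smul_sub]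
    rw [← interaction_comm, ← interaction_smul, this, smul_smul, mul_inv, Complex.inv_I]
  rw [hz]
  refine hasTraceDerivAt_of_weak_deriv denseRange_toL2
    (Z := fun t => interaction N t ((Complex.I * (hbar N : ℂ))⁻¹ • comm (W t) (ω t))) ?_ ?_
  · intro s φ ψ
    have hf := hasDerivAt_freeProp_toL2 N hN s φ
    have hg := hasDerivAt_freeProp_toL2 N hN s ψ
    -- The equation is tested with freely evolved vectors, which are again Schwartz functions; its
    -- kinetic form then cancels the derivatives of the two propagators.
    have he := (heq s (freeSchwartz (hbar N) s φ) (freeSchwartz (hbar N) s ψ)).const_mul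
      (Complex.I * (hbar N : ℂ))⁻¹
    simp only [inv_mul_cancel_left₀ hI, ← freeProp_toL2] at he
    have key := hasDerivAt_inner_apply hf hg (continuousAt_of_tendsto_traceNorm (hcont s)) he
    have e1 : ∀ (r : ℝ) (A : Op), ⟪toL2 φ, interaction N r A (toL2 ψ)⟫_ℂ =
        ⟪freeProp (hbar N) r (toL2 φ), A (freeProp (hbar N) r (toL2 ψ))⟫_ℂ := fun r A => by
      rw [interaction, ContinuousLinearMap.comp_apply, ContinuousLinearMap.comp_apply,
        ← adjoint_freeProp, adjoint_inner_right]
    simp only [e1]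
    convert key using 1
    rw [_root_.smul_apply, inner_smul_right, inner_smul_left, map_smul, inner_smul_right, map_inv₀,
      map_mul, Complex.conj_I, Complex.conj_ofReal, neg_mul, inv_neg, comm]
    ring
  · refine tendsto_traceNorm_interaction_sub N hN t
      (Y := fun t => (Complex.I * (hbar N : ℂ))⁻¹ • comm (W t) (ω t)) ?_ ?_
    · rw [traceNorm_smul]
      have h1 := traceNorm_comm_le' (W t) (ω t)
      have h2 := htc t
      exact ENNReal.mul_ne_top (by finiteness) (ne_top_of_le_ne_top (by finiteness) h1)
    · have h1 : ∀ᶠ s in 𝓝 t, ‖W s‖ₑ ≤ ‖W t‖ₑ + 1 := by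
        filter_upwards [ENNReal.tendsto_nhds_zero.1 (hW t) 1 one_pos] with s hs
        calc ‖W s‖ₑ = ‖W t + (W s - W t)‖ₑ := by rw [add_sub_cancel]
          _ ≤ ‖W t‖ₑ + ‖W s - W t‖ₑ := isIdealNorm_enorm.add_le _ _
          _ ≤ _ := by gcongr
      have hlim : Tendsto (fun s => ‖(Complex.I * (hbar N : ℂ))⁻¹‖ₑ *
          (2 * (‖W t‖ₑ + 1) * traceNorm (ω s - ω t) + 2 * ‖W s - W t‖ₑ * traceNorm (ω t)))
          (𝓝 t) (𝓝 (‖(Complex.I * (hbar N : ℂ))⁻¹‖ₑ *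
          (2 * (‖W t‖ₑ + 1) * 0 + 2 * 0 * traceNorm (ω t)))) := by
        refine ENNReal.Tendsto.const_mul (Tendsto.add (ENNReal.Tendsto.const_mul (hcont t)
          (Or.inr (by finiteness))) (ENNReal.Tendsto.mul_const (ENNReal.Tendsto.const_mul (hW t)
          (Or.inr (by finiteness))) (Or.inr (htc t)))) (Or.inr (by finiteness))
      simp only [mul_zero, zero_mul, add_zero] at hlim
      refine tendsto_of_tendsto_of_tendsto_of_le_of_le' tendsto_const_nhds hlim
        (Eventually.of_forall fun _ => zero_le) ?_
      filter_upwards [h1] with s hs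
      rw [← smul_sub, traceNorm_smul]
      gcongr
      have e : comm (W s) (ω s) - comm (W t) (ω t) =
          comm (W s) (ω s - ω t) + comm (W s - W t) (ω t) := by
        simp only [comm, ContinuousLinearMap.sub_comp, ContinuousLinearMap.comp_sub]
        abel
      rw [e]
      refine (traceNorm_add_le _ _).trans (add_le_add ?_ (traceNorm_comm_le' _ _))
      refine (traceNorm_comm_le' _ _).trans ?_
      gcongr

end InteractionPicture

/-! ### Operators given by weak integrals -/

section WeakIntegral

open ContinuousLinearMap Filter
open scoped Topology

/-- `T` is the weak integral of the family `F`. -/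
structure IsWeakIntegral (T : Op) (F : R3 → Op) : Prop where
  integrable : ∀ φ ψ, Integrable (fun ξ => ⟪φ, F ξ ψ⟫_ℂ)
  inner_eq : ∀ φ ψ, ⟪φ, T ψ⟫_ℂ = ∫ ξ, ⟪φ, F ξ ψ⟫_ℂ

namespace IsWeakIntegral

variable {T S : Op} {F G : R3 → Op}

theorem comp_left (h : IsWeakIntegral T F) (B : Op) :
    IsWeakIntegral (B ∘L T) (fun ξ => B ∘L F ξ) := by
  refine ⟨fun φ ψ => ?_, fun φ ψ => ?_⟩
  · simpa only [ContinuousLinearMap.comp_apply, ← adjoint_inner_left B] using h.integrable _ ψ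
  · simpa only [ContinuousLinearMap.comp_apply, ← adjoint_inner_left B] using h.inner_eq _ ψ

theorem comp_right (h : IsWeakIntegral T F) (B : Op) :
    IsWeakIntegral (T ∘L B) (fun ξ => F ξ ∘L B) :=
  ⟨fun φ ψ => h.integrable φ (B ψ), fun φ ψ => h.inner_eq φ (B ψ)⟩

theorem sub (h : IsWeakIntegral T F) (h' : IsWeakIntegral S G) :
    IsWeakIntegral (T - S) (fun ξ => F ξ - G ξ) := by
  refine ⟨fun φ ψ => ?_, fun φ ψ => ?_⟩
  · refine ((h.integrable φ ψ).sub (h'.integrable φ ψ)).congr (Eventually.of_forall fun ξ => ?_)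
    simp only [Pi.sub_apply, _root_.sub_apply, inner_sub_right]
  · simp only [_root_.sub_apply, inner_sub_right]
    rw [integral_sub (h.integrable φ ψ) (h'.integrable φ ψ), h.inner_eq, h'.inner_eq]

theorem comm_right (h : IsWeakIntegral T F) (A : Op) :
    IsWeakIntegral (comm T A) (fun ξ => comm (F ξ) A) :=
  (h.comp_right A).sub (h.comp_left A)

theorem adjoint (h : IsWeakIntegral T F) :
    IsWeakIntegral (adjoint T) (fun ξ => ContinuousLinearMap.adjoint (F ξ)) := by
  refine ⟨fun φ ψ => ?_, fun φ ψ => ?_⟩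
  · simp only [adjoint_inner_right]
    have := Complex.conjCLE.toContinuousLinearMap.integrable_comp (h.integrable ψ φ)
    refine this.congr (Eventually.of_forall fun ξ => ?_)
    exact inner_conj_symm _ _
  · simp only [adjoint_inner_right]
    rw [← inner_conj_symm, h.inner_eq, ← integral_conj]
    simp only [inner_conj_symm]

theorem comp_neg (h : IsWeakIntegral T F) : IsWeakIntegral T (fun ξ => F (-ξ)) :=
  ⟨fun φ ψ => (h.integrable φ ψ).comp_neg, fun φ ψ => by
    rw [h.inner_eq, integral_neg_eq_self (fun ξ => ⟪φ, F ξ ψ⟫_ℂ)]⟩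

/-- Duality is applied to finite sums before integrating, so no measurability of ξ ↦ F ξ in trace
norm is required. -/
theorem traceNorm_le (h : IsWeakIntegral T F) : traceNorm T ≤ ∫⁻ ξ, traceNorm (F ξ) := by
  refine traceNorm_le_of_forall fun S hS s => ?_
  have e : ∑ i ∈ s, ⟪S (onb L2 i), T (onb L2 i)⟫_ℂ =
      ∫ ξ, ∑ i ∈ s, ⟪S (onb L2 i), F ξ (onb L2 i)⟫_ℂ := by
    rw [integral_finsetSum _ fun i _ => h.integrable _ _]
    exact Finset.sum_congr rfl fun i _ => h.inner_eq _ _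
  rw [e]
  refine (enorm_integral_le_lintegral_enorm _).trans (lintegral_mono fun ξ => ?_)
  exact enorm_sum_inner_le_traceNorm (F ξ) S 1 hS norm_id_le s

theorem enorm_le (h : IsWeakIntegral T F) : ‖T‖ₑ ≤ ∫⁻ ξ, ‖F ξ‖ₑ := by
  rcases eq_or_ne (∫⁻ ξ, ‖F ξ‖ₑ) ∞ with htop | htop
  · rw [htop]; exact le_top
  have key : ∀ ψ, ‖T ψ‖ ≤ (∫⁻ ξ, ‖F ξ‖ₑ).toReal * ‖ψ‖ := by
    intro ψ
    have h1 : ‖⟪T ψ, T ψ⟫_ℂ‖ₑ ≤ ‖T ψ‖ₑ * ((∫⁻ ξ, ‖F ξ‖ₑ) * ‖ψ‖ₑ) := by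
      rw [h.inner_eq]
      refine (enorm_integral_le_lintegral_enorm _).trans ?_
      rw [← lintegral_mul_const' _ _ (by finiteness), ← lintegral_const_mul' _ _ (by finiteness)]
      refine lintegral_mono fun ξ => ?_
      simp only [← ofReal_norm]
      rw [← ENNReal.ofReal_mul (norm_nonneg _), ← ENNReal.ofReal_mul (norm_nonneg _)]
      refine ENNReal.ofReal_le_ofReal ((norm_inner_le_norm _ _).trans ?_)
      gcongr
      exact (F ξ).le_opNorm ψ
    have h2 := ENNReal.toReal_mono (by finiteness) h1
    rw [toReal_enorm, ENNReal.toReal_mul, ENNReal.toReal_mul, toReal_enorm, toReal_enorm,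
      inner_self_eq_norm_sq_to_K, norm_pow, RCLike.norm_ofReal, abs_norm, sq] at h2
    rcases (norm_nonneg (T ψ)).eq_or_lt with h0 | h0
    · rw [← h0]; positivity
    · exact le_of_mul_le_mul_left h2 h0
  have h3 := opNorm_le_bound T ENNReal.toReal_nonneg key
  rw [← ofReal_norm]
  exact ENNReal.ofReal_le_of_le_toReal h3

end IsWeakIntegral

/-! ### Fourier synthesis, inversion and convolution. -/

/-- The Fourier synthesis of `g`, written with plane waves. -/
def synth (g : R3 → ℂ) (x : R3) : ℂ := ∫ ξ, g ξ * planeWave ((2 * Real.pi) • ξ) x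

theorem norm_synth_le (g : R3 → ℂ) (x : R3) : ‖synth g x‖ ≤ ∫ ξ, ‖g ξ‖ := by
  refine (norm_integral_le_integral_norm _).trans (le_of_eq ?_)
  simp only [norm_mul, norm_planeWave, mul_one]

theorem continuous_planeWave_uncurry : Continuous fun z : R3 × R3 => planeWave z.1 z.2 := by
  unfold planeWave; fun_prop

theorem continuous_planeWave_left (x : R3) : Continuous fun ξ : R3 =>
    planeWave ((2 * Real.pi) • ξ) x := by
  unfold planeWave; fun_prop

theorem integrable_mul_planeWave {g : R3 → ℂ} (hg : Integrable g) (x : R3) :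
    Integrable fun ξ => g ξ * planeWave ((2 * Real.pi) • ξ) x := by
  refine hg.mul_bdd (c := 1) (continuous_planeWave_left x).aestronglyMeasurable
    (Eventually.of_forall fun ξ => (norm_planeWave _ _).le)

theorem continuous_synth {g : R3 → ℂ} (hg : Integrable g) : Continuous (synth g) := by
  refine continuous_of_dominated (bound := fun ξ => ‖g ξ‖)
    (fun x => (integrable_mul_planeWave hg x).aestronglyMeasurable)
    (fun x => Eventually.of_forall fun ξ => ?_) hg.norm (Eventually.of_forall fun ξ => ?_)
  · rw [norm_mul, norm_planeWave, mul_one]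
  · exact continuous_const.mul (continuous_planeWave _)

theorem memLp_synth {g : R3 → ℂ} (hg : Integrable g) : MemLp (synth g) ∞ (volume : Measure R3) :=
  memLp_top_of_bound (continuous_synth hg).aestronglyMeasurable _
    (Eventually.of_forall fun x => norm_synth_le g x)

/-- Fubini, with a general argument θ: the choices x, -x and x - y serve the direct term, Fourier
inversion and the exchange kernel respectively. -/
theorem integral_synth_mul {α : Type*} [MeasurableSpace α] {μ : Measure α} [SFinite μ]
    {θ : α → R3} (hθ : Measurable θ) {g : R3 → ℂ} (hg : Integrable g) {h : α → ℂ}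
    (hh : Integrable h μ) :
    (Integrable fun ξ => g ξ * ∫ z, planeWave ((2 * Real.pi) • ξ) (θ z) * h z ∂μ) ∧
    ∫ z, synth g (θ z) * h z ∂μ =
      ∫ ξ, g ξ * ∫ z, planeWave ((2 * Real.pi) • ξ) (θ z) * h z ∂μ := by
  have hm : AEStronglyMeasurable (fun w : R3 × α => planeWave ((2 * Real.pi) • w.1) (θ w.2))
      ((volume : Measure R3).prod μ) := by
    have h1 : Measurable fun w : R3 × α => (2 * Real.pi) • w.1 :=
      (continuous_const_smul (2 * Real.pi)).measurable.comp measurable_fst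
    have h2 : Measurable fun w : R3 × α => θ w.2 := hθ.comp measurable_snd
    have h3 := continuous_planeWave_uncurry.measurable.comp (h1.prodMk h2)
    exact h3.aestronglyMeasurable
  have hint : Integrable (fun w : R3 × α => planeWave ((2 * Real.pi) • w.1) (θ w.2) *
      (g w.1 * h w.2)) ((volume : Measure R3).prod μ) :=
    (hg.mul_prod hh).bdd_mul (c := 1) hm (Eventually.of_forall fun w => (norm_planeWave _ _).le)
  have e : ∀ ξ, ∫ z, planeWave ((2 * Real.pi) • ξ) (θ z) * (g ξ * h z) ∂μ =
      g ξ * ∫ z, planeWave ((2 * Real.pi) • ξ) (θ z) * h z ∂μ := fun ξ => by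
    rw [← integral_const_mul]
    exact integral_congr_ae (Eventually.of_forall fun z => by ring)
  constructor
  · refine hint.integral_prod_left.congr (Eventually.of_forall fun ξ => ?_)
    exact e ξ
  · have hswap := integral_integral_swap (f := fun ξ z => planeWave ((2 * Real.pi) • ξ) (θ z) *
      (g ξ * h z)) hint
    simp_rw [e] at hswap
    rw [hswap]
    refine integral_congr_ae (Eventually.of_forall fun z => ?_)
    simp only [synth]
    rw [← integral_mul_const]
    exact integral_congr_ae (Eventually.of_forall fun ξ => by ring)

theorem fourier_eq_integral_planeWave (f : R3 → ℂ) (ξ : R3) :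
    𝓕 f ξ = ∫ x, planeWave ((2 * Real.pi) • ξ) (-x) * f x := by
  rw [Real.fourier_eq']
  refine integral_congr_ae (Eventually.of_forall fun x => ?_)
  simp only [planeWave, smul_eq_mul, inner_neg_right, inner_smul_left]
  rw [real_inner_comm]
  congr 2
  push_cast
  simp
  ring

theorem fourierInv_eq_integral_planeWave (f : R3 → ℂ) (ξ : R3) :
    𝓕⁻ f ξ = ∫ x, planeWave ((2 * Real.pi) • ξ) x * f x := by
  rw [Real.fourierInv_eq']
  refine integral_congr_ae (Eventually.of_forall fun x => ?_)
  simp only [planeWave, smul_eq_mul, inner_smul_left]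
  rw [real_inner_comm]
  congr 2
  push_cast
  simp
  ring

/-- Fourier inversion almost everywhere. -/
theorem ae_eq_synth_fourier {f : R3 → ℂ} (hf : Integrable f) (hf' : Integrable (𝓕 f)) :
    ∀ᵐ x, f x = synth (𝓕 f) x := by
  have hb : LocallyIntegrable (synth (𝓕 f)) :=
    (continuous_synth hf').locallyIntegrable
  -- The function need not be continuous, so both sides are tested against smooth compactly
  -- supported g. Writing g as the Fourier transform of a Schwartz function and using Fubini twice
  -- identifies the integrals.
  refine ae_eq_of_integral_contDiff_smul_eq hf.locallyIntegrable hb fun g hg hgs => ?_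
  have hgC : ContDiff ℝ (↑(⊤ : ℕ∞)) (fun x => (g x : ℂ)) := Complex.ofRealCLM.contDiff.comp hg
  have hgCs : HasCompactSupport (fun x => (g x : ℂ)) :=
    hgs.comp_left (g := fun y : ℝ => (y : ℂ)) Complex.ofReal_zero
  set G : 𝓢(R3, ℂ) := hgCs.toSchwartzMap hgC with hG
  have hGx : ∀ x, (g x : ℂ) = G x := fun x => rfl
  set h : 𝓢(R3, ℂ) := 𝓕⁻ G with hh
  have hGh : ∀ x, G x = synth h (-x) := fun x => by
    have : G = 𝓕 h := by rw [hh, FourierTransform.fourier_fourierInv_eq]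
    rw [this, SchwartzMap.fourier_coe, fourier_eq_integral_planeWave, synth]
    refine integral_congr_ae (Eventually.of_forall fun ξ => ?_)
    simp only
    rw [mul_comm]
    congr 1
    simp only [planeWave, inner_smul_left, inner_neg_right]
    rw [real_inner_comm]
  have h1 := (integral_synth_mul (θ := fun x : R3 => -x) measurable_neg
    (h.integrable (μ := volume)) hf).2
  have h2 := (integral_synth_mul (θ := fun x : R3 => x) measurable_id hf'
    (G.integrable (μ := volume))).2
  calc ∫ x, g x • f x = ∫ x, synth h (-x) * f x := by
        refine integral_congr_ae (Eventually.of_forall fun x => ?_)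
        simp only [Complex.real_smul, hGx, hGh]
    _ = ∫ ξ, h ξ * 𝓕 f ξ := by
        rw [h1]
        simp_rw [fourier_eq_integral_planeWave f]
    _ = ∫ ξ, 𝓕 f ξ * h ξ := by simp_rw [mul_comm]
    _ = ∫ x, synth (𝓕 f) x * G x := by
        rw [h2]
        refine integral_congr_ae (Eventually.of_forall fun ξ => ?_)
        simp only
        rw [hh, SchwartzMap.fourierInv_coe, fourierInv_eq_integral_planeWave]
    _ = ∫ x, g x • synth (𝓕 f) x := by
        refine integral_congr_ae (Eventually.of_forall fun x => ?_)
        simp only [Complex.real_smul, ← hGx, mul_comm]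

theorem integrable_conj_mul (φ ψ : L2) :
    Integrable (fun x => ψ x * (starRingEnd ℂ) (φ x)) := by
  have := L2.integrable_inner (𝕜 := ℂ) φ ψ
  simpa only [RCLike.inner_apply] using this

theorem inner_eq_integral (φ ψ : L2) :
    ⟪φ, ψ⟫_ℂ = ∫ x, ψ x * (starRingEnd ℂ) (φ x) := by
  rw [L2.inner_def]
  simp only [RCLike.inner_apply]

theorem isWeakIntegral_mulOp_synth {g : R3 → ℂ} (hg : Integrable g) :
    IsWeakIntegral (mulOp (synth g)) (fun ξ => g ξ • waveOp ((2 * Real.pi) • ξ)) := by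
  have e1 : ∀ φ ψ ξ, ⟪φ, (g ξ • waveOp ((2 * Real.pi) • ξ)) ψ⟫_ℂ =
      g ξ * ∫ x, planeWave ((2 * Real.pi) • ξ) x * (ψ x * (starRingEnd ℂ) (φ x)) := by
    intro φ ψ ξ
    rw [_root_.smul_apply, inner_smul_right, inner_eq_integral]
    congr 1
    refine integral_congr_ae ?_
    filter_upwards [waveOp_ae_eq ((2 * Real.pi) • ξ) ψ] with x hx
    rw [hx, mul_assoc]
  have key := fun φ ψ => integral_synth_mul (θ := fun x : R3 => x) measurable_id hg
    (integrable_conj_mul φ ψ)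
  refine ⟨fun φ ψ => ?_, fun φ ψ => ?_⟩
  · simp_rw [e1]
    exact (key φ ψ).1
  · simp_rw [e1]
    rw [← (key φ ψ).2, inner_eq_integral]
    refine integral_congr_ae ?_
    filter_upwards [mulOp_ae_eq (memLp_synth hg) ψ] with x hx
    rw [hx, mul_assoc]

theorem convolution_eq_synth {V : R3 → ℝ} (hV : Integrable V)
    (hV' : Integrable (𝓕 fun x => (V x : ℂ))) {ρ : R3 → ℂ} (hρ : Integrable ρ) :
    convolution V ρ (ContinuousLinearMap.lsmul ℝ ℝ) volume =
      synth (fun ξ => 𝓕 (fun x => (V x : ℂ)) ξ * 𝓕 ρ ξ) := by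
  ext x
  rw [convolution_def]
  have hVC : Integrable fun x => (V x : ℂ) := hV.ofReal
  have hρx : Integrable (fun y => ρ (x - y)) := hρ.comp_sub_left x
  have h1 := (integral_synth_mul (θ := fun y : R3 => y) measurable_id hV' hρx).2
  calc _ = ∫ y, synth (𝓕 fun x => (V x : ℂ)) y * ρ (x - y) := by
        refine integral_congr_ae ?_
        filter_upwards [ae_eq_synth_fourier hVC hV'] with y hy
        rw [← hy]
        simp
    _ = _ := by
        rw [h1, synth]
        refine integral_congr_ae (Eventually.of_forall fun ξ => ?_)
        simp only
        rw [mul_assoc]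
        congr 1
        rw [fourier_eq_integral_planeWave, ← integral_mul_const,
          ← integral_sub_left_eq_self (fun z => planeWave ((2 * Real.pi) • ξ) (-z) * ρ z *
            planeWave ((2 * Real.pi) • ξ) x) volume x]
        refine integral_congr_ae (Eventually.of_forall fun y => ?_)
        simp only
        have : y = -(x - y) + x := by abel
        conv_lhs => rw [this, planeWave_add_right]
        rw [show x - (-(x - y) + x) = x - y by abel]
        ring

theorem integrable_fourier_mul {v ρ : R3 → ℂ} (hv : Integrable v) (hρ : Integrable ρ) :
    Integrable (fun ξ => v ξ * 𝓕 ρ ξ) := by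
  have hc : Continuous (𝓕 ρ) :=
    VectorFourier.fourierIntegral_continuous Real.continuous_fourierChar
      (innerSL ℝ).continuous₂ hρ
  refine hv.mul_bdd (c := ∫ x, ‖ρ x‖) hc.aestronglyMeasurable (Eventually.of_forall fun ξ => ?_)
  exact VectorFourier.norm_fourierIntegral_le_integral_norm _ _ _ _ _

/-! ### Integral kernels and the exchange operator. -/

theorem integrable_kernel {k : R3 × R3 → ℂ}
    (hk : MemLp k 2 ((volume : Measure R3).prod (volume : Measure R3))) (φ ψ : L2) :
    Integrable (fun z : R3 × R3 => k z * (ψ z.2 * (starRingEnd ℂ) (φ z.1)))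
      ((volume : Measure R3).prod (volume : Measure R3)) := by
  have hφ := Lp.memLp φ
  have hψ := Lp.memLp ψ
  have hm : AEStronglyMeasurable (fun z : R3 × R3 => ψ z.2 * (starRingEnd ℂ) (φ z.1))
      ((volume : Measure R3).prod (volume : Measure R3)) :=
    hψ.1.comp_snd.mul (RCLike.continuous_conj.comp_aestronglyMeasurable hφ.1.comp_fst)
  have h2 : MemLp (fun z : R3 × R3 => ψ z.2 * (starRingEnd ℂ) (φ z.1)) 2
      ((volume : Measure R3).prod (volume : Measure R3)) := by
    rw [memLp_two_iff_integrable_sq_norm hm]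
    have h := ((memLp_two_iff_integrable_sq_norm hφ.1).1 hφ).mul_prod
      ((memLp_two_iff_integrable_sq_norm hψ.1).1 hψ)
    refine h.congr (Eventually.of_forall fun z => ?_)
    simp only [norm_mul, RCLike.norm_conj]
    ring
  exact hk.integrable_mul h2

theorem HasKernel.inner_eq {A : Op} {k : R3 × R3 → ℂ} (h : HasKernel A k) (φ ψ : L2) :
    ⟪φ, A ψ⟫_ℂ = ∫ z, k z * (ψ z.2 * (starRingEnd ℂ) (φ z.1))
      ∂((volume : Measure R3).prod (volume : Measure R3)) := by
  rw [integral_prod _ (integrable_kernel h.1 φ ψ), inner_eq_integral]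
  refine integral_congr_ae ?_
  filter_upwards [h.2 ψ] with x hx
  rw [hx, ← integral_mul_const]
  refine integral_congr_ae (Eventually.of_forall fun y => ?_)
  simp only
  ring

theorem ae_sub_prod {P : R3 → Prop} (h : ∀ᵐ x, P x) :
    ∀ᵐ z ∂((volume : Measure R3).prod (volume : Measure R3)), P (z.1 - z.2) :=
  (quasiMeasurePreserving_sub_of_right_invariant (volume : Measure R3) volume).ae h

/-- Inserting V(x-y) = ∫ V̂(ξ) e^{iq·x} e^{-iq·y} dξ turns multiplication of the kernel by V(x-y)
into a superposition of conjugations of ω by plane waves. -/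
theorem isWeakIntegral_exchange {V : R3 → ℝ} (hV : Integrable V)
    (hV' : Integrable (𝓕 fun x => (V x : ℂ))) {N : ℕ} {ω X : Op} (hX : IsExchange V N ω X) :
    IsWeakIntegral X (fun ξ => ((N : ℂ)⁻¹ * 𝓕 (fun x => (V x : ℂ)) ξ) •
      (waveOp ((2 * Real.pi) • ξ) ∘L ω ∘L waveOp (-((2 * Real.pi) • ξ)))) := by
  obtain ⟨k, hk, hkX⟩ := hX
  set v := 𝓕 (fun x => (V x : ℂ)) with hv
  have hVC : Integrable fun x => (V x : ℂ) := hV.ofReal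
  have e1 : ∀ φ ψ ξ, ⟪φ, (((N : ℂ)⁻¹ * v ξ) •
      (waveOp ((2 * Real.pi) • ξ) ∘L ω ∘L waveOp (-((2 * Real.pi) • ξ)))) ψ⟫_ℂ =
      (N : ℂ)⁻¹ * (v ξ * ∫ z, planeWave ((2 * Real.pi) • ξ) (z.1 - z.2) *
        (k z * (ψ z.2 * (starRingEnd ℂ) (φ z.1)))
        ∂((volume : Measure R3).prod (volume : Measure R3))) := by
    intro φ ψ ξ
    set q := (2 * Real.pi) • ξ
    rw [_root_.smul_apply, inner_smul_right, mul_assoc, ContinuousLinearMap.comp_apply,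
      ContinuousLinearMap.comp_apply, ← adjoint_inner_left, adjoint_waveOp, hk.inner_eq]
    congr 2
    refine integral_congr_ae ?_
    have h1 := Measure.quasiMeasurePreserving_fst (μ := (volume : Measure R3))
      (ν := (volume : Measure R3)).ae (waveOp_ae_eq (-q) φ)
    have h2 := Measure.quasiMeasurePreserving_snd (μ := (volume : Measure R3))
      (ν := (volume : Measure R3)).ae (waveOp_ae_eq (-q) ψ)
    filter_upwards [h1, h2] with z hz1 hz2
    rw [hz1, hz2, map_mul, conj_planeWave, neg_neg, sub_eq_add_neg, planeWave_add_right]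
    have : planeWave q (-z.2) = planeWave (-q) z.2 := by simp [planeWave]
    rw [this]
    ring
  have key := fun φ ψ => integral_synth_mul (θ := fun z : R3 × R3 => z.1 - z.2)
    (measurable_fst.sub measurable_snd) hV' (integrable_kernel hk.1 φ ψ)
  refine ⟨fun φ ψ => ?_, fun φ ψ => ?_⟩
  · simp_rw [e1]
    exact (key φ ψ).1.const_mul _
  · simp_rw [e1]
    rw [integral_const_mul, ← (key φ ψ).2, hkX.inner_eq, ← integral_const_mul]
    refine integral_congr_ae ?_
    filter_upwards [ae_sub_prod (ae_eq_synth_fourier hVC hV')] with z hz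
    rw [hz]
    ring

end WeakIntegral

/-! ### The mean field operator -/

section MeanField

open ContinuousLinearMap

theorem comm_sub_left (A B C : Op) : comm (A - B) C = comm A C - comm B C := by
  simp only [comm, ← mul_def, sub_mul, mul_sub]; abel

theorem comm_smul_left (z : ℂ) (A B : Op) : comm (z • A) B = z • comm A B := by
  simp only [comm, ← mul_def, smul_mul_assoc, mul_smul_comm, smul_sub]

theorem comm_smul_right (z : ℂ) (A B : Op) : comm A (z • B) = z • comm A B := by
  simp only [comm, ← mul_def, smul_mul_assoc, mul_smul_comm, smul_sub]

theorem comm_comp_left (A B C : Op) : comm (A ∘L B) C = A ∘L comm B C + comm A C ∘L B := by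
  simp only [comm, ← mul_def, sub_mul, mul_sub, mul_assoc]; abel

theorem comm_comp_right (A B C : Op) : comm A (B ∘L C) = comm A B ∘L C + B ∘L comm A C := by
  simp only [comm, ← mul_def, sub_mul, mul_sub, mul_assoc]; abel

theorem traceNorm_comm_symm (A B : Op) : traceNorm (comm A B) = traceNorm (comm B A) :=
  traceNorm_sub_comm _ _

theorem enorm_waveOp_le (p : R3) : ‖waveOp p‖ₑ ≤ 1 := enorm_le_one_of_norm_le_one (norm_waveOp_le p)

theorem enorm_transOp_le (a : R3) : ‖transOp a‖ₑ ≤ 1 :=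
  enorm_le_one_of_norm_le_one (norm_transOp_le a)

theorem planeWave_neg_right (p x : R3) : planeWave p (-x) = planeWave (-p) x := by
  simp only [planeWave, inner_neg_left, inner_neg_right]

/-- The Weyl operator `e^{ip·x} T_a`. -/
def weylOp (p a : R3) : Op := waveOp p ∘L transOp a

theorem norm_weylOp_le (p a : R3) : ‖weylOp p a‖ ≤ 1 :=
  (opNorm_comp_le _ _).trans (mul_le_one₀ (norm_waveOp_le p) (norm_nonneg _) (norm_transOp_le a))

theorem weylOp_comp_waveOp (p a q : R3) :
    weylOp p a ∘L waveOp q = planeWave q a • (waveOp q ∘L weylOp p a) := by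
  have h := transOp_comp_waveOp a q
  have h' : waveOp p ∘L waveOp q = waveOp q ∘L waveOp p := by
    rw [waveOp_comp, waveOp_comp, add_comm]
  simp only [weylOp, ← mul_def] at h h' ⊢
  rw [mul_assoc, h, mul_smul_comm, planeWave_comm, ← mul_assoc, h', mul_assoc]

/-- The integrand of the mean field operator `V * ρ - X` in Fourier representation. -/
def meanField (v : R3 → ℂ) (N : ℕ) (ω : Op) (ξ : R3) : Op :=
  ((N : ℂ)⁻¹ * v ξ) • (opTrace (waveOp (-((2 * Real.pi) • ξ)) ∘L ω) • waveOp ((2 * Real.pi) • ξ) -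
    waveOp ((2 * Real.pi) • ξ) ∘L ω ∘L waveOp (-((2 * Real.pi) • ξ)))

theorem IsDensity.fourier_eq {N : ℕ} {ω : Op} {ρ : R3 → ℂ} (h : IsDensity N ω ρ) (ξ : R3) :
    𝓕 ρ ξ = (N : ℂ)⁻¹ * opTrace (waveOp (-((2 * Real.pi) • ξ)) ∘L ω) := by
  rw [waveOp, ← h.2 _ (memLp_planeWave _), fourier_eq_integral_planeWave]
  simp only [planeWave_neg_right]

theorem isWeakIntegral_directOp {V : R3 → ℝ} (hV : Integrable V)
    (hV' : Integrable (𝓕 fun x => (V x : ℂ))) {N : ℕ} {ω : Op} {ρ : R3 → ℂ}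
    (h : IsDensity N ω ρ) :
    IsWeakIntegral (directOp V ρ) (fun ξ => ((N : ℂ)⁻¹ * 𝓕 (fun x => (V x : ℂ)) ξ) •
      opTrace (waveOp (-((2 * Real.pi) • ξ)) ∘L ω) • waveOp ((2 * Real.pi) • ξ)) := by
  have := isWeakIntegral_mulOp_synth (integrable_fourier_mul hV' h.1)
  rw [← convolution_eq_synth hV hV' h.1] at this
  simp only [h.fourier_eq] at this
  rw [directOp]
  refine (congrArg (IsWeakIntegral _) (funext fun ξ => ?_)).mp this
  rw [smul_smul]
  congr 1
  ring

theorem isWeakIntegral_meanField {V : R3 → ℝ} (hV : Integrable V)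
    (hV' : Integrable (𝓕 fun x => (V x : ℂ))) {N : ℕ} {ω X : Op} {ρ : R3 → ℂ}
    (hρ : IsDensity N ω ρ) (hX : IsExchange V N ω X) :
    IsWeakIntegral (directOp V ρ - X) (meanField (𝓕 fun x => (V x : ℂ)) N ω) := by
  have := (isWeakIntegral_directOp hV hV' hρ).sub (isWeakIntegral_exchange hV hV' hX)
  simp only [← smul_sub] at this
  exact this

theorem traceNorm_waveOp_comp_le (p : R3) (A : Op) : traceNorm (waveOp p ∘L A) ≤ traceNorm A :=
  (traceNorm_comp_le_left _ _).trans (mul_le_of_le_one_left' (enorm_waveOp_le p))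

theorem enorm_opTrace_waveOp_le (p : R3) {ω : Op} (h : traceNorm ω ≠ ∞) :
    ‖opTrace (waveOp p ∘L ω)‖ₑ ≤ traceNorm ω :=
  (enorm_opTrace_le ((traceNorm_waveOp_comp_le p ω).trans_lt h.lt_top).ne).trans
    (traceNorm_waveOp_comp_le p ω)

theorem enorm_meanField_le (v : R3 → ℂ) (N : ℕ) {ω : Op} (h : traceNorm ω ≠ ∞) (ξ : R3) :
    ‖meanField v N ω ξ‖ₑ ≤ ‖(N : ℂ)⁻¹‖ₑ * ‖v ξ‖ₑ * (2 * traceNorm ω) := by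
  rw [meanField, enorm_smul, enorm_mul]
  gcongr
  refine (enorm_sub_le (E := Op)).trans ?_
  rw [two_mul (traceNorm ω), enorm_smul]
  refine add_le_add ((mul_le_mul' (enorm_opTrace_waveOp_le _ h) (enorm_waveOp_le _)).trans_eq
    (mul_one _)) ?_
  exact (enorm_le_traceNorm _).trans (traceNorm_conj_le (norm_waveOp_le _) (norm_waveOp_le _))

theorem meanField_sub (v : R3 → ℂ) (N : ℕ) {ω ω' : Op} (h : traceNorm ω ≠ ∞)
    (h' : traceNorm ω' ≠ ∞) (ξ : R3) :
    meanField v N ω ξ - meanField v N ω' ξ = meanField v N (ω - ω') ξ := by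
  have e : ∀ p, opTrace (waveOp p ∘L (ω - ω')) =
      opTrace (waveOp p ∘L ω) - opTrace (waveOp p ∘L ω') := fun p => by
    rw [ContinuousLinearMap.comp_sub, opTrace_sub
      ((traceNorm_waveOp_comp_le p ω).trans_lt h.lt_top).ne
      ((traceNorm_waveOp_comp_le p ω').trans_lt h'.lt_top).ne]
  rw [meanField, meanField, meanField, e, ← smul_sub, sub_smul, sub_comp, comp_sub]
  congr 1
  abel

theorem conj_opTrace_waveOp (p : R3) {ω : Op} (h : traceNorm ω ≠ ∞) :
    (starRingEnd ℂ) (opTrace (waveOp p ∘L ω)) = opTrace (waveOp (-p) ∘L adjoint ω) := by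
  rw [← opTrace_adjoint, adjoint_comp, adjoint_waveOp]
  exact (opTrace_comp_comm (by rwa [traceNorm_adjoint]) _).symm

theorem conj_fourier_ofReal (V : R3 → ℝ) (ξ : R3) :
    (starRingEnd ℂ) (𝓕 (fun x => (V x : ℂ)) ξ) = 𝓕 (fun x => (V x : ℂ)) (-ξ) := by
  rw [fourier_eq_integral_planeWave, fourier_eq_integral_planeWave, ← integral_conj]
  congr 1
  ext x
  rw [map_mul, conj_planeWave, Complex.conj_ofReal, smul_neg]

theorem fourier_neg_of_even {V : R3 → ℝ} (hV : ∀ᵐ x, V (-x) = V x) (ξ : R3) :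
    𝓕 (fun x => (V x : ℂ)) (-ξ) = 𝓕 (fun x => (V x : ℂ)) ξ := by
  rw [fourier_eq_integral_planeWave, fourier_eq_integral_planeWave,
    ← integral_neg_eq_self (fun x => planeWave ((2 * Real.pi) • ξ) (-x) * (V x : ℂ))]
  refine integral_congr_ae ?_
  filter_upwards [hV] with x hx
  rw [hx, planeWave_neg_right, planeWave_neg_right _ (-x), planeWave_neg_right, smul_neg, neg_neg]

/-- For an even real potential the mean field of `ω*` is the adjoint of the mean field of `ω`. -/
theorem isWeakIntegral_adjoint_meanField {V : R3 → ℝ} (hV : Integrable V)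
    (hVeven : ∀ᵐ x, V (-x) = V x)
    (hV' : Integrable (𝓕 fun x => (V x : ℂ))) {N : ℕ} {ω X : Op} {ρ : R3 → ℂ}
    (h : traceNorm ω ≠ ∞) (hρ : IsDensity N ω ρ) (hX : IsExchange V N ω X) :
    IsWeakIntegral (adjoint (directOp V ρ - X))
      (meanField (𝓕 fun x => (V x : ℂ)) N (adjoint ω)) := by
  -- The adjoint turns e^{iq·x} into e^{-iq·x} in the direct part, which is therefore reindexed by ξ
  -- ↦ -ξ and needs only that V is real. The exchange part keeps its form, and there evenness of V
  -- is used to make V̂ real.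
  have h1 := (isWeakIntegral_directOp hV hV' hρ).adjoint.comp_neg
  have h2 := (isWeakIntegral_exchange hV hV' hX).adjoint
  have h3 := h1.sub h2
  rw [← map_sub] at h3
  convert h3 using 1
  ext1 ξ
  have hreal : (starRingEnd ℂ) (𝓕 (fun x => (V x : ℂ)) ξ) = 𝓕 (fun x => (V x : ℂ)) ξ := by
    rw [conj_fourier_ofReal, fourier_neg_of_even hVeven]
  have hreal' : (starRingEnd ℂ) (𝓕 (fun x => (V x : ℂ)) (-ξ)) = 𝓕 (fun x => (V x : ℂ)) ξ := by
    rw [conj_fourier_ofReal, neg_neg]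
  simp only [LinearIsometryEquiv.map_smulₛₗ, adjoint_comp, adjoint_waveOp, map_mul, map_inv₀,
    Complex.conj_natCast, hreal, hreal', conj_opTrace_waveOp _ h, smul_neg, neg_neg, comp_assoc]
  rw [meanField, smul_sub]

theorem norm_one_sub_planeWave_le (q a : R3) : ‖1 - planeWave q a‖ ≤ ‖q‖ * ‖a‖ := by
  rw [norm_sub_rev, planeWave]
  exact (Real.norm_exp_I_mul_ofReal_sub_one_le).trans (by
    rw [Real.norm_eq_abs]; exact abs_real_inner_le_norm q a)

/-- The scalar factor is at most |q||a|, which is O(ħ|q|) for the displacements used later and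
compensates the ħ⁻¹ of the equation. -/
theorem comm_waveOp_weylOp (q p a : R3) :
    comm (waveOp q) (weylOp p a) = (1 - planeWave q a) • (waveOp q ∘L weylOp p a) := by
  rw [comm, weylOp_comp_waveOp, sub_smul, one_smul]

theorem waveOp_neg_comp_weylOp (q p a : R3) :
    waveOp (-q) ∘L weylOp p a = planeWave q a • (weylOp p a ∘L waveOp (-q)) := by
  rw [weylOp_comp_waveOp, smul_smul, ← planeWave_neg_right, ← planeWave_add_right, add_neg_cancel,
    planeWave_comm, planeWave_zero, one_smul]

/-- Plane waves commute with Weyl operators up to a phase, so conjugation by them preserves the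
trace norm of the commutator. This is why the exchange term needs no smallness of a. -/
theorem comm_conj_weylOp (q p a : R3) (ω : Op) :
    comm (waveOp q ∘L ω ∘L waveOp (-q)) (weylOp p a) =
      planeWave q a • (waveOp q ∘L comm ω (weylOp p a) ∘L waveOp (-q)) := by
  have h1 := waveOp_neg_comp_weylOp q p a
  have h2 := weylOp_comp_waveOp p a q
  simp only [comm, ← mul_def] at h1 h2 ⊢
  have e1 : waveOp q * (ω * waveOp (-q)) * weylOp p a =
      planeWave q a • (waveOp q * (ω * (weylOp p a * waveOp (-q)))) := by
    rw [mul_assoc, mul_assoc, h1, mul_smul_comm, mul_smul_comm]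
  have e2 : weylOp p a * (waveOp q * (ω * waveOp (-q))) =
      planeWave q a • (waveOp q * (weylOp p a * (ω * waveOp (-q)))) := by
    rw [← mul_assoc, h2, smul_mul_assoc, mul_assoc]
  rw [e1, e2, ← smul_sub, sub_mul, mul_sub, mul_assoc, mul_assoc]

/-- The double commutator of the mean field, a Weyl operator and the density operator. -/
theorem traceNorm_comm_comm_meanField_le (v : R3 → ℂ) (N : ℕ) {ω : Op} (h : traceNorm ω ≠ ∞)
    (ξ p a : R3) :
    traceNorm (comm (comm (meanField v N ω ξ) (weylOp p a)) ω) ≤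
      ‖(N : ℂ)⁻¹‖ₑ * ‖v ξ‖ₑ * (traceNorm ω * (ENNReal.ofReal (‖(2 * Real.pi) • ξ‖ * ‖a‖) *
        (traceNorm (comm ω (weylOp p a)) + traceNorm (comm ω (waveOp ((2 * Real.pi) • ξ))))) +
        2 * ‖ω‖ₑ * traceNorm (comm ω (weylOp p a))) := by
  set q := (2 * Real.pi) • ξ
  rw [meanField, comm_smul_left, comm_smul_left, comm_sub_left, comm_sub_left, comm_smul_left,
    comm_smul_left, traceNorm_smul, enorm_mul]
  gcongr
  refine (traceNorm_sub_le _ _).trans (add_le_add ?_ ?_)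
  · rw [traceNorm_smul, comm_waveOp_weylOp, comm_smul_left, traceNorm_smul, comm_comp_left]
    gcongr
    · exact enorm_opTrace_waveOp_le _ h
    · rw [← ofReal_norm]
      exact ENNReal.ofReal_le_ofReal (norm_one_sub_planeWave_le _ _)
    · refine (traceNorm_add_le _ _).trans (add_le_add ?_ ?_)
      · rw [traceNorm_comm_symm ω]
        exact traceNorm_waveOp_comp_le _ _
      · rw [traceNorm_comm_symm ω]
        exact (traceNorm_comp_le_right _ _).trans (mul_le_of_le_one_left'
          (enorm_le_one_of_norm_le_one (norm_weylOp_le p a)))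
  · rw [comm_conj_weylOp, comm_smul_left, traceNorm_smul]
    have : ‖planeWave q a‖ₑ = 1 := by
      rw [← ofReal_norm, norm_planeWave, ENNReal.ofReal_one]
    rw [this, one_mul]
    refine (traceNorm_comm_le _ _).trans ?_
    gcongr
    exact traceNorm_conj_le (norm_waveOp_le _) (norm_waveOp_le _)

end MeanField

/-! ### Commutators with translations and with the gradient -/

section Gradient

open ContinuousLinearMap Filter LineDeriv
open scoped Topology

theorem transOp_smul_eq (e : R3) (t : ℝ) (ψ : L2) :
    transOp (t • e) ψ =
      fourInvOp (mulOp (phase (fun ξ => 2 * Real.pi * ⟪ξ, e⟫_ℝ) t) (fourOp ψ)) := by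
  have h : waveOp ((2 * Real.pi) • t • e) = mulOp (phase (fun ξ => 2 * Real.pi * ⟪ξ, e⟫_ℝ) t) := by
    rw [waveOp]
    congr 1
    ext ξ
    rw [planeWave, phase, inner_smul_left, inner_smul_left, real_inner_comm]
    congr 3
    simp only [conj_trivial]
    ring
  have h1 := congrArg (fun A : Op => fourInvOp (A ψ)) (fourOp_comp_transOp (t • e))
  simp only [h, ContinuousLinearMap.comp_apply] at h1
  rw [← h1]
  exact (congrArg (fun A : Op => A (transOp (t • e) ψ)) fourInvOp_comp_fourOp).symm

/-- The derivative of translations along a direction. -/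
theorem hasDerivAt_transOp_toL2 (e : R3) (t : ℝ) (φ : 𝓢(R3, ℂ)) :
    HasDerivAt (fun s : ℝ => transOp (s • e) (toL2 φ))
      (transOp (t • e) (toL2 (lineDerivOp e φ))) t := by
  have hθt : (fun ξ : R3 => 2 * Real.pi * ⟪ξ, e⟫_ℝ).HasTemperateGrowth := by fun_prop
  have h := (fourInvOp.restrictScalars ℝ).hasFDerivAt.comp_hasDerivAt t
    (hasDerivAt_mulOp_phase hθt t (𝓕 φ))
  have e1 : SchwartzMap.smulLeftCLM ℂ
      (fun ξ : R3 => Complex.I * ((2 * Real.pi * ⟪ξ, e⟫_ℝ : ℝ) : ℂ)) (𝓕 φ) =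
      𝓕 (lineDerivOp e φ) := by
    rw [SchwartzMap.fourier_lineDerivOp_eq]
    ext ξ
    rw [SchwartzMap.smulLeftCLM_apply_apply (hasTemperateGrowth_I_mul hθt), _root_.smul_apply,
      SchwartzMap.smulLeftCLM_apply_apply (by fun_prop)]
    simp only [smul_eq_mul, Complex.real_smul]
    push_cast
    ring
  rw [e1, ← fourOp_toL2, ← fourOp_toL2] at h
  simp_rw [transOp_smul_eq e]
  exact h

/-- Translations commute with differentiation; this is read off from uniqueness of the derivative of
the commuting group s ↦ T_{se}. -/
theorem exists_toL2_transOp (a e : R3) (φ : 𝓢(R3, ℂ)) :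
    ∃ φ' : 𝓢(R3, ℂ), transOp a (toL2 φ) = toL2 φ' ∧
      transOp a (toL2 (lineDerivOp e φ)) = toL2 (lineDerivOp e φ') := by
  refine ⟨φ.compSubConstCLM ℂ (-a), transOp_toL2 a φ, ?_⟩
  have h1 := ((transOp a).restrictScalars ℝ).hasFDerivAt.comp_hasDerivAt 0
    (hasDerivAt_transOp_toL2 e 0 φ)
  have h2 := hasDerivAt_transOp_toL2 e 0 (φ.compSubConstCLM ℂ (-a))
  have hc : ∀ (b : R3) (ψ : L2), transOp a (transOp b ψ) = transOp b (transOp a ψ) := by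
    intro b ψ
    have := congrArg (fun A : Op => A ψ) ((transOp_comp a b).trans
      ((congrArg transOp (add_comm a b)).trans (transOp_comp b a).symm))
    exact this
  have h3 : HasDerivAt (fun s : ℝ => transOp (s • e) (toL2 (φ.compSubConstCLM ℂ (-a))))
      (transOp a (transOp ((0 : ℝ) • e) (toL2 (lineDerivOp e φ)))) 0 := by
    refine h1.congr_of_eventuallyEq (Eventually.of_forall fun s => ?_)
    simp only [Function.comp_apply, coe_restrictScalars']
    rw [← transOp_toL2, hc]
  have := h2.unique h3
  rw [zero_smul, transOp_zero] at this
  exact this.symm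

/-- Heisenberg evolution under translations: the derivative of T_{-se} ω T_{se} is ħ⁻¹ T_{-se}[ω,
ħ∂ⱼ]T_{se}. Its integral bounds the commutator with a translation. -/
theorem hasDerivAt_inner_conj_transOp {N : ℕ} (hN : hbar N ≠ 0) {j : Fin 3} {ω D : Op}
    (h : IsGradComm N j ω D) (s : ℝ) (φ ψ : 𝓢(R3, ℂ)) :
    HasDerivAt (fun r : ℝ => ⟪toL2 φ, (transOp (-(r • EuclideanSpace.single j (1 : ℝ))) ∘L ω ∘L
        transOp (r • EuclideanSpace.single j (1 : ℝ))) (toL2 ψ)⟫_ℂ)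
      ⟪toL2 φ, (((hbar N : ℂ)⁻¹) • (transOp (-(s • EuclideanSpace.single j (1 : ℝ))) ∘L D ∘L
        transOp (s • EuclideanSpace.single j (1 : ℝ)))) (toL2 ψ)⟫_ℂ s := by
  set e : R3 := EuclideanSpace.single j (1 : ℝ) with he
  have hadj : ∀ (a : R3) (x y : L2), ⟪x, transOp (-a) y⟫_ℂ = ⟪transOp a x, y⟫_ℂ := by
    intro a x y
    rw [← adjoint_transOp, adjoint_inner_right]
  have h1 := hasDerivAt_inner_apply (hasDerivAt_transOp_toL2 e s φ) (hasDerivAt_transOp_toL2 e s ψ)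
    (continuousAt_const (y := ω)) (hasDerivAt_const s ⟪transOp (s • e) (toL2 φ),
      ω (transOp (s • e) (toL2 ψ))⟫_ℂ)
  simp only [_root_.smul_apply, ContinuousLinearMap.comp_apply, hadj, inner_smul_right]
  obtain ⟨φ', hφ1, hφ2⟩ := exists_toL2_transOp (s • e) e φ
  obtain ⟨ψ', hψ1, hψ2⟩ := exists_toL2_transOp (s • e) e ψ
  have h2 := h φ' ψ'
  simp only [hbarDeriv, ← he, inner_smul_left, map_smul, inner_smul_right, Complex.conj_ofReal]
    at h2
  rw [hφ1, hφ2, hψ1, hψ2] at h1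
  rw [hφ1, hψ1, h2]
  have hN' : (hbar N : ℂ) ≠ 0 := by exact_mod_cast hN
  suffices hv : (hbar N : ℂ)⁻¹ * ((hbar N : ℂ) * ⟪toL2 φ', ω (toL2 (lineDerivOp e ψ'))⟫_ℂ +
      (hbar N : ℂ) * ⟪toL2 (lineDerivOp e φ'), ω (toL2 ψ')⟫_ℂ) =
      ⟪toL2 (lineDerivOp e φ'), ω (toL2 ψ')⟫_ℂ + ⟪toL2 φ', ω (toL2 (lineDerivOp e ψ'))⟫_ℂ + 0 by
    rw [hv]
    exact h1
  field_simp
  ring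

theorem comm_transOp_eq (ω : Op) (a : R3) :
    comm ω (transOp a) = transOp a ∘L (transOp (-a) ∘L ω ∘L transOp a - ω) := by
  have : transOp a ∘L transOp (-a) = 1 := by rw [transOp_comp, add_neg_cancel, transOp_zero]
  simp only [comm, ← mul_def] at this ⊢
  rw [mul_sub, ← mul_assoc (transOp a) (transOp (-a)), this, one_mul]

theorem traceNorm_transOp_comp_le (a : R3) (A : Op) : traceNorm (transOp a ∘L A) ≤ traceNorm A :=
  (traceNorm_comp_le_left _ _).trans (mul_le_of_le_one_left' (enorm_transOp_le a))

theorem comm_one (ω : Op) : comm ω 1 = 0 := by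
  simp only [comm, ← mul_def, mul_one, one_mul, sub_self]

theorem IsGradComm.traceNorm_comm_transOp_le {N : ℕ} (hN : 0 < hbar N) {j : Fin 3} {ω D : Op}
    (h : IsGradComm N j ω D) (s : ℝ) :
    traceNorm (comm ω (transOp (s • EuclideanSpace.single j (1 : ℝ)))) ≤
      ENNReal.ofReal (|s| / hbar N) * traceNorm D := by
  set e : R3 := EuclideanSpace.single j (1 : ℝ) with he
  rcases eq_or_ne s 0 with rfl | hs
  · rw [zero_smul, transOp_zero, comm_one, traceNorm_zero]
    exact zero_le
  have hpos : 0 < |s| / hbar N := div_pos (abs_pos.mpr hs) hN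
  rcases eq_or_ne (traceNorm D) ∞ with hD | hD
  · rw [hD, ENNReal.mul_top (ENNReal.ofReal_pos.mpr hpos).ne']
    exact le_top
  have h1 := traceNorm_sub_le_of_weak_deriv denseRange_toL2
    (A := fun r : ℝ => transOp (-(r • e)) ∘L ω ∘L transOp (r • e))
    (D := fun r : ℝ => ((hbar N : ℂ)⁻¹) • (transOp (-(r • e)) ∘L D ∘L transOp (r • e)))
    (a := 0) (b := s) (M := (hbar N)⁻¹ * (traceNorm D).toReal) (by positivity)
    (fun r _ φ ψ => hasDerivAt_inner_conj_transOp hN.ne' h r φ ψ) (fun r _ => by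
      rw [traceNorm_smul, ENNReal.ofReal_mul (by positivity), ENNReal.ofReal_toReal hD]
      refine mul_le_mul' (le_of_eq ?_) (traceNorm_conj_le (norm_transOp_le _) (norm_transOp_le _))
      rw [← ofReal_norm, norm_inv, Complex.norm_real, Real.norm_of_nonneg hN.le])
  simp only [zero_smul, neg_zero, transOp_zero, sub_zero] at h1
  rw [comm_transOp_eq]
  refine (traceNorm_transOp_comp_le _ _).trans ?_
  have e1 : (1 : Op) ∘L ω ∘L 1 = ω := by simp only [← mul_def, mul_one, one_mul]
  rw [e1] at h1
  refine h1.trans (le_of_eq ?_)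
  rw [mul_comm, ← mul_assoc, ENNReal.ofReal_mul (by positivity), ENNReal.ofReal_toReal hD,
    div_eq_mul_inv]

theorem traceNorm_comm_transOp_add_le (ω : Op) (a b : R3) :
    traceNorm (comm ω (transOp (a + b))) ≤
      traceNorm (comm ω (transOp a)) + traceNorm (comm ω (transOp b)) := by
  rw [← transOp_comp, comm_comp_right]
  refine (traceNorm_add_le _ _).trans (add_le_add ?_ (traceNorm_transOp_comp_le _ _))
  exact (traceNorm_comp_le_right _ _).trans (mul_le_of_le_one_left' (enorm_transOp_le b))

theorem traceNorm_comm_transOp_sum_le (ω : Op) {ι : Type*} (s : Finset ι) (f : ι → R3) :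
    traceNorm (comm ω (transOp (∑ i ∈ s, f i))) ≤ ∑ i ∈ s, traceNorm (comm ω (transOp (f i))) := by
  classical
  induction s using Finset.induction_on with
  | empty => rw [Finset.sum_empty, Finset.sum_empty, transOp_zero, comm_one, traceNorm_zero]
  | insert i s hi ih =>
    rw [Finset.sum_insert hi, Finset.sum_insert hi]
    exact (traceNorm_comm_transOp_add_le _ _ _).trans (by gcongr)

/-- The commutator with a translation is controlled by the commutator with the gradient. -/
theorem traceNorm_comm_transOp_le {N : ℕ} (hN : 0 < hbar N) (ω : Op) (a : R3) :
    traceNorm (comm ω (transOp a)) ≤ ENNReal.ofReal (‖a‖ / hbar N) * gradCommNorm N ω := by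
  have ha : a = ∑ j : Fin 3, a j • EuclideanSpace.single j (1 : ℝ) := by
    have := (EuclideanSpace.basisFun (Fin 3) ℝ).sum_repr a
    simpa using this.symm
  conv_lhs => rw [ha]
  refine (traceNorm_comm_transOp_sum_le ω _ _).trans ?_
  rw [gradCommNorm, Finset.mul_sum]
  refine Finset.sum_le_sum fun j _ => ?_
  rcases eq_or_ne (a j) 0 with h0 | h0
  · rw [h0, zero_smul, transOp_zero, comm_one, traceNorm_zero]
    exact zero_le
  have hle : ENNReal.ofReal (|a j| / hbar N) ≤ ENNReal.ofReal (‖a‖ / hbar N) := by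
    refine ENNReal.ofReal_le_ofReal (div_le_div_of_nonneg_right ?_ hN.le)
    simpa using PiLp.norm_apply_le a j
  have hpos : ENNReal.ofReal (|a j| / hbar N) ≠ 0 :=
    (ENNReal.ofReal_pos.mpr (div_pos (abs_pos.mpr h0) hN)).ne'
  refine le_trans ?_ (mul_le_mul_left hle _)
  rw [mul_comm, ← ENNReal.div_le_iff_le_mul (Or.inl hpos) (Or.inl ENNReal.ofReal_ne_top)]
  refine le_iInf₂ fun D hD => ?_
  rw [ENNReal.div_le_iff_le_mul (Or.inl hpos) (Or.inl ENNReal.ofReal_ne_top), mul_comm]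
  exact hD.traceNorm_comm_transOp_le hN _

/-! ### From translations back to the gradient. -/

/-- Weak compactness of bounded families of operators. -/
theorem exists_weak_limit {ι : Type*} (𝒰 : Ultrafilter ι) {D : ι → Op} {M : ℝ}
    (hM : ∀ i, ‖D i‖ ≤ M) :
    ∃ D₀ : Op, ∀ φ ψ, Tendsto (fun i => ⟪φ, D i ψ⟫_ℂ) 𝒰 (𝓝 ⟪φ, D₀ ψ⟫_ℂ) := by
  have hbd : ∀ ψ φ i, ‖⟪D i ψ, φ⟫_ℂ‖ ≤ M * ‖ψ‖ * ‖φ‖ := fun ψ φ i =>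
    (norm_inner_le_norm _ _).trans (by
      gcongr
      exact ((D i).le_opNorm ψ).trans (by gcongr; exact hM i))
  have hlim : ∀ ψ φ, ∃ z : ℂ, ‖z‖ ≤ M * ‖ψ‖ * ‖φ‖ ∧
      Tendsto (fun i => ⟪D i ψ, φ⟫_ℂ) 𝒰 (𝓝 z) := fun ψ φ => by
    -- Each matrix element lies in a compact disc and so converges along the ultrafilter. The limits
    -- form a bounded sesquilinear form, represented by an operator through the Riesz isomorphism.
    obtain ⟨z, hz, hz'⟩ := (isCompact_closedBall (0 : ℂ) (M * ‖ψ‖ * ‖φ‖)).ultrafilter_le_nhds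
      (𝒰.map fun i => ⟪D i ψ, φ⟫_ℂ) (by
        rw [le_principal_iff]
        exact Eventually.of_forall (f := (𝒰 : Filter ι)) fun i =>
          mem_closedBall_zero_iff.mpr (hbd ψ φ i))
    exact ⟨z, mem_closedBall_zero_iff.mp hz, hz'⟩
  choose L hL hLt using hlim
  have huniq : ∀ {f : ι → ℂ} {z w : ℂ}, Tendsto f 𝒰 (𝓝 z) → Tendsto f 𝒰 (𝓝 w) → z = w :=
    fun h h' => tendsto_nhds_unique h h'
  let ℓ : L2 → (L2 →L[ℂ] ℂ) := fun ψ => LinearMap.mkContinuous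
    { toFun := L ψ
      map_add' := fun x y => huniq (hLt ψ (x + y)) (by
        simpa only [inner_add_right] using (hLt ψ x).add (hLt ψ y))
      map_smul' := fun c x => huniq (hLt ψ (c • x)) (by
        simpa only [inner_smul_right, RingHom.id_apply, smul_eq_mul] using
          (hLt ψ x).const_mul c) } (M * ‖ψ‖) (hL ψ)
  let T : L2 → L2 := fun ψ => (InnerProductSpace.toDual ℂ L2).symm (ℓ ψ)
  have hT : ∀ ψ φ, ⟪T ψ, φ⟫_ℂ = L ψ φ := fun ψ φ => InnerProductSpace.toDual_symm_apply
  have hTn : ∀ ψ, ‖T ψ‖ ≤ M * ‖ψ‖ := fun ψ => by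
    rw [LinearIsometryEquiv.norm_map]
    refine LinearMap.mkContinuous_norm_le _ ?_ _
    refine mul_nonneg ?_ (norm_nonneg _)
    obtain ⟨i, _⟩ := 𝒰.nonempty_of_mem univ_mem
    exact (norm_nonneg _).trans (hM i)
  refine ⟨LinearMap.mkContinuous
    { toFun := T
      map_add' := fun x y => ext_inner_right ℂ fun φ => by
        rw [inner_add_left, hT, hT, hT]
        refine huniq (hLt (x + y) φ) ?_
        simpa only [map_add, inner_add_left] using (hLt x φ).add (hLt y φ)
      map_smul' := fun c x => ext_inner_right ℂ fun φ => by
        rw [RingHom.id_apply, inner_smul_left, hT, hT]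
        refine huniq (hLt (c • x) φ) ?_
        simpa only [map_smul, inner_smul_left] using (hLt x φ).const_mul _ } M hTn, fun φ ψ => ?_⟩
  have h1 := (Complex.continuous_conj.tendsto _).comp (hLt ψ φ)
  rw [← hT, inner_conj_symm] at h1
  refine h1.congr fun i => ?_
  exact inner_conj_symm _ _

theorem traceNorm_le_of_weak_limit {ι : Type*} {l : Filter ι} [l.NeBot] {D : ι → Op} {D₀ : Op}
    (h : ∀ φ ψ, Tendsto (fun i => ⟪φ, D i ψ⟫_ℂ) l (𝓝 ⟪φ, D₀ ψ⟫_ℂ)) {M : ℝ≥0∞}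
    (hM : ∀ i, traceNorm (D i) ≤ M) : traceNorm D₀ ≤ M := by
  refine traceNorm_le_of_forall fun S hS s => ?_
  have h1 : Tendsto (fun i => ‖∑ k ∈ s, ⟪S (onb L2 k), D i (onb L2 k)⟫_ℂ‖ₑ) l
      (𝓝 ‖∑ k ∈ s, ⟪S (onb L2 k), D₀ (onb L2 k)⟫_ℂ‖ₑ) :=
    (continuous_enorm.tendsto _).comp (tendsto_finsetSum _ fun k _ => h _ _)
  refine le_of_tendsto h1 (Eventually.of_forall fun i => ?_)
  exact (enorm_sum_inner_le_traceNorm (D i) S 1 hS ContinuousLinearMap.norm_id_le s).trans (hM i)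

/-- Uniform bounds on difference quotients of translations yield the commutator with the
gradient. -/
theorem exists_isGradComm {N : ℕ} (hN : 0 < hbar N) {j : Fin 3} {ω : Op} {M : ℝ≥0∞} (hM : M ≠ ∞)
    {ε₀ : ℝ} (hε₀ : 0 < ε₀)
    (h : ∀ ε, 0 < ε → ε ≤ ε₀ → traceNorm (comm ω (transOp (ε • EuclideanSpace.single j (1 : ℝ)))) ≤
      ENNReal.ofReal (ε / hbar N) * M) :
    ∃ D, IsGradComm N j ω D ∧ traceNorm D ≤ M := by
  set e : R3 := EuclideanSpace.single j (1 : ℝ) with he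
  set ε : ℕ → ℝ := fun n => ε₀ / (n + 1) with hε
  have hεpos : ∀ n, 0 < ε n := fun n => by positivity
  have hεle : ∀ n, ε n ≤ ε₀ := fun n => div_le_self hε₀.le (by
    have : (0 : ℝ) ≤ n := n.cast_nonneg
    linarith)
  have hεlim : Tendsto ε atTop (𝓝[≠] 0) := by
    refine tendsto_nhdsWithin_iff.mpr ⟨?_, Eventually.of_forall fun n => (hεpos n).ne'⟩
    have := tendsto_one_div_add_atTop_nhds_zero_nat (𝕜 := ℝ)
    simpa [hε, div_eq_mul_inv] using this.const_mul ε₀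
  -- Rescaled difference quotients of T_{-εe} ω T_{εe} at ε = 0. The hypothesis bounds them by M in
  -- trace norm, hence also in operator norm.
  set D : ℕ → Op := fun n => ((hbar N / ε n : ℝ) : ℂ) •
    (transOp (-(ε n • e)) ∘L ω ∘L transOp (ε n • e) - ω) with hD
  have hDn : ∀ n, traceNorm (D n) ≤ M := fun n => by
    have e1 : transOp (-(ε n • e)) ∘L ω ∘L transOp (ε n • e) - ω =
        transOp (-(ε n • e)) ∘L comm ω (transOp (ε n • e)) := by
      have h2 : transOp (-(ε n • e)) ∘L transOp (ε n • e) = 1 := by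
        rw [transOp_comp, neg_add_cancel, transOp_zero]
      simp only [comm, ← mul_def] at h2 ⊢
      rw [mul_sub, ← mul_assoc _ _ ω, h2, one_mul]
    simp only [hD]
    rw [e1, traceNorm_smul]
    refine (mul_le_mul_right ((traceNorm_transOp_comp_le _ _).trans (h _ (hεpos n) (hεle n)))
      _).trans (le_of_eq ?_)
    rw [← ofReal_norm, Complex.norm_real, Real.norm_of_nonneg (by have := hεpos n; positivity),
      ← mul_assoc, ← ENNReal.ofReal_mul (by have := hεpos n; positivity)]
    have : hbar N / ε n * (ε n / hbar N) = 1 := by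
      have := (hεpos n).ne'
      field_simp
    rw [this, ENNReal.ofReal_one, one_mul]
  have hDb : ∀ n, ‖D n‖ ≤ M.toReal := fun n => by
    rw [← toReal_enorm]
    exact ENNReal.toReal_mono hM ((enorm_le_traceNorm _).trans (hDn n))
  obtain ⟨D₀, hD₀⟩ := exists_weak_limit (Ultrafilter.of atTop) hDb
  refine ⟨D₀, fun φ ψ => ?_, traceNorm_le_of_weak_limit hD₀ hDn⟩
  refine tendsto_nhds_unique (hD₀ (toL2 φ) (toL2 ψ)) ?_
  -- On Schwartz functions the whole sequence converges to the gradient form, which identifies the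
  -- limit taken along the ultrafilter.
  refine Tendsto.mono_left ?_ (Ultrafilter.of_le atTop)
  have h1 := hasDerivAt_inner_apply (hasDerivAt_transOp_toL2 e 0 φ) (hasDerivAt_transOp_toL2 e 0 ψ)
    (continuousAt_const (y := ω)) (hasDerivAt_const 0 ⟪transOp ((0 : ℝ) • e) (toL2 φ),
      ω (transOp ((0 : ℝ) • e) (toL2 ψ))⟫_ℂ)
  have h2 := (h1.tendsto_slope_zero.comp hεlim).const_mul (hbar N : ℂ)
  have hone : ∀ x : L2, (1 : Op) x = x := fun _ => rfl
  simp only [zero_smul, transOp_zero, zero_add, add_zero, Function.comp_def, hone] at h2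
  have e2 : (hbar N : ℂ) * (⟪toL2 (lineDerivOp e φ), ω (toL2 ψ)⟫_ℂ +
      ⟪toL2 φ, ω (toL2 (lineDerivOp e ψ))⟫_ℂ) =
      ⟪toL2 φ, ω (hbarDeriv N j ψ)⟫_ℂ + ⟪hbarDeriv N j φ, ω (toL2 ψ)⟫_ℂ := by
    simp only [hbarDeriv, ← he, inner_smul_left, map_smul, inner_smul_right, Complex.conj_ofReal]
    ring
  rw [e2] at h2
  refine h2.congr fun n => ?_
  simp only [hD, _root_.smul_apply, _root_.sub_apply, ContinuousLinearMap.comp_apply,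
    inner_smul_right, inner_sub_right]
  rw [← adjoint_transOp, adjoint_inner_right, Complex.real_smul]
  push_cast
  ring

theorem gradCommNorm_le {N : ℕ} (hN : 0 < hbar N) {ω : Op} {M : ℝ≥0∞} {ε₀ : ℝ} (hε₀ : 0 < ε₀)
    (h : ∀ b : R3, 0 < ‖b‖ → ‖b‖ ≤ ε₀ →
      traceNorm (comm ω (transOp b)) ≤ ENNReal.ofReal (‖b‖ / hbar N) * M) :
    gradCommNorm N ω ≤ 3 * M := by
  rcases eq_or_ne M ∞ with rfl | hM
  · rw [ENNReal.mul_top (by norm_num)]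
    exact le_top
  have : ∀ j : Fin 3, ⨅ (D : Op) (_ : IsGradComm N j ω D), traceNorm D ≤ M := fun j => by
    obtain ⟨D, hD, hD'⟩ := exists_isGradComm (j := j) hN hM hε₀ fun ε hε hε' => by
      have hn : ‖ε • (EuclideanSpace.single j (1 : ℝ) : R3)‖ = ε := by
        rw [norm_smul, PiLp.norm_single, norm_one, mul_one, Real.norm_of_nonneg hε.le]
      have := h (ε • EuclideanSpace.single j (1 : ℝ)) (by rwa [hn]) (by rwa [hn])
      rwa [hn] at this
    exact (iInf₂_le D hD).trans hD'
  calc gradCommNorm N ω ≤ ∑ _j : Fin 3, M := Finset.sum_le_sum fun j _ => this j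
    _ = 3 * M := by simp

end Gradient

/-! ### The Hartree-Fock flow in the interaction picture -/

section Flow

open ContinuousLinearMap Filter
open scoped Topology

theorem hbar_pos {N : ℕ} (hN : 1 ≤ N) : 0 < hbar N :=
  Real.rpow_pos_of_pos (by exact_mod_cast hN) _

theorem inv_le_hbar {N : ℕ} (hN : 1 ≤ N) : (N : ℝ)⁻¹ ≤ hbar N := by
  rw [hbar, ← Real.rpow_neg_one]
  exact Real.rpow_le_rpow_of_exponent_le (by exact_mod_cast hN) (by norm_num)

theorem IsWeakIntegral.enorm_sub_le_meanField {v : R3 → ℂ} {N : ℕ} {ω ω' T S : Op}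
    (hT : IsWeakIntegral T (meanField v N ω)) (hS : IsWeakIntegral S (meanField v N ω'))
    (h : traceNorm ω ≠ ∞) (h' : traceNorm ω' ≠ ∞) (hv : Measurable v) :
    ‖T - S‖ₑ ≤ ‖(N : ℂ)⁻¹‖ₑ * (∫⁻ ξ, ‖v ξ‖ₑ) * 2 * traceNorm (ω - ω') := by
  have hfin : traceNorm (ω - ω') ≠ ∞ :=
    ((traceNorm_sub_le _ _).trans_lt (ENNReal.add_lt_top.mpr ⟨h.lt_top, h'.lt_top⟩)).ne
  refine (hT.sub hS).enorm_le.trans ?_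
  simp only [meanField_sub v N h h']
  refine (lintegral_mono fun ξ => enorm_meanField_le v N hfin ξ).trans (le_of_eq ?_)
  rw [lintegral_mul_const _ (by fun_prop), lintegral_const_mul _ (by fun_prop)]
  ring

theorem IsWeakIntegral.enorm_le_meanField {v : R3 → ℂ} {N : ℕ} {ω T : Op}
    (hT : IsWeakIntegral T (meanField v N ω)) (h : traceNorm ω ≠ ∞) (hv : Measurable v) :
    ‖T‖ₑ ≤ ‖(N : ℂ)⁻¹‖ₑ * (∫⁻ ξ, ‖v ξ‖ₑ) * 2 * traceNorm ω := by
  refine hT.enorm_le.trans ?_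
  refine (lintegral_mono fun ξ => enorm_meanField_le v N h ξ).trans (le_of_eq ?_)
  rw [lintegral_mul_const _ (by fun_prop), lintegral_const_mul _ (by fun_prop)]
  ring

/-- A self-adjoint trace class solution `ω` of the Hartree-Fock equation with mean field `W`. -/
structure IsMeanFieldFlow (v : R3 → ℂ) (N : ℕ) (ω W : ℝ → Op) : Prop where
  finite : ∀ t, traceNorm (ω t) ≠ ∞
  adjoint_eq : ∀ t, adjoint (ω t) = ω t
  mean : ∀ t, IsWeakIntegral (W t) (meanField v N (ω t))
  adjoint_mean : ∀ t, adjoint (W t) = W t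
  deriv : ∀ t, HasTraceDerivAt (fun t => interaction N t (ω t))
    (-Complex.I • comm (interaction N t (((hbar N)⁻¹ : ℂ) • W t)) (interaction N t (ω t))) t

/-- The mean field is Lipschitz in ω from trace norm to operator norm, and that of ω* is the adjoint
of that of ω. Hence W - W* is controlled by tr|ω - ω*|, as `adjoint_eq_of_deriv` requires. -/
theorem IsHFSolution.exists_isMeanFieldFlow {V : R3 → ℝ} (hV : Integrable V)
    (hVeven : ∀ᵐ x, V (-x) = V x) (hV' : Integrable (𝓕 fun x => (V x : ℂ)))
    (hvm : Measurable (𝓕 fun x => (V x : ℂ))) {N : ℕ} (hN : 1 ≤ N) {ω : ℝ → Op}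
    (h : IsHFSolution V N ω) (h0 : adjoint (ω 0) = ω 0) :
    ∃ W, IsMeanFieldFlow (𝓕 fun x => (V x : ℂ)) N ω W := by
  set v := 𝓕 (fun x => (V x : ℂ)) with hv
  have hħ := hbar_pos hN
  have hfin : ∀ t, traceNorm (ω t) ≠ ∞ := fun t => (h.traceClass t).ne
  choose ρ X hρ hX heq using h.equation
  set W : ℝ → Op := fun t => directOp V (ρ t) - X t with hW
  have hmean : ∀ t, IsWeakIntegral (W t) (meanField v N (ω t)) := fun t =>
    isWeakIntegral_meanField hV hV' (hρ t) (hX t)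
  have hmean' : ∀ t, IsWeakIntegral (adjoint (W t)) (meanField v N (adjoint (ω t))) := fun t =>
    isWeakIntegral_adjoint_meanField hV hVeven hV' (hfin t) (hρ t) (hX t)
  have hfin' : ∀ t, traceNorm (adjoint (ω t)) ≠ ∞ := fun t => by
    rw [traceNorm_adjoint]; exact hfin t
  set k : ℝ≥0∞ := ‖(N : ℂ)⁻¹‖ₑ * (∫⁻ ξ, ‖v ξ‖ₑ) * 2 with hk
  have hkfin : k ≠ ∞ :=
    ENNReal.mul_ne_top (ENNReal.mul_ne_top enorm_ne_top hV'.2.ne) (by norm_num)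
  have hWc : ∀ t, Tendsto (fun s => ‖W s - W t‖ₑ) (𝓝 t) (𝓝 0) := fun t => by
    have h1 := ENNReal.Tendsto.const_mul (h.continuous t) (Or.inr hkfin)
    rw [mul_zero] at h1
    exact tendsto_of_tendsto_of_tendsto_of_le_of_le tendsto_const_nhds h1
      (fun _ => zero_le) fun s => (hmean s).enorm_sub_le_meanField (hmean t) (hfin s) (hfin t) hvm
  have hderiv := hasTraceDerivAt_interaction hħ.ne' hfin h.continuous hWc heq
  have hB : ∀ t, traceNorm (interaction N t (ω t)) ≠ ∞ := fun t => by
    rw [traceNorm_interaction]; exact hfin t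
  have hcont : Continuous fun t => traceNorm (ω t) := by
    have hle : ∀ A B : Op, traceNorm A ≤ traceNorm B + traceNorm (A - B) := fun A B => by
      have := traceNorm_add_le B (A - B)
      rwa [add_sub_cancel] at this
    refine continuous_of_le_add hfin (g := fun s t => traceNorm (ω s - ω t))
      (fun s t => hle _ _) (fun s t => ?_) h.continuous
    rw [traceNorm_sub_comm]
    exact hle _ _
  have hconjħ : (starRingEnd ℂ) ((hbar N : ℂ)⁻¹) = (hbar N : ℂ)⁻¹ := by
    rw [map_inv₀, Complex.conj_ofReal]
  have hadj := adjoint_eq_of_deriv hB hderiv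
    (by rw [interaction_zero_time, h0]) fun T => by
      obtain ⟨m, hm, hmle⟩ : ∃ m : ℝ≥0∞, m ≠ ∞ ∧ ∀ t, |t| ≤ T → traceNorm (ω t) ≤ m := by
        rcases lt_or_ge T 0 with hT | hT
        · exact ⟨0, by norm_num, fun t ht => absurd ((abs_nonneg t).trans ht) (not_le.mpr hT)⟩
        · obtain ⟨t₀, _, ht₀⟩ := (isCompact_Icc (a := -T) (b := T)).exists_isMaxOn
            ⟨0, by constructor <;> linarith⟩ hcont.continuousOn
          exact ⟨_, hfin t₀, fun t ht => ht₀ (abs_le.mp ht)⟩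
      set κ : ℝ≥0∞ := ‖(hbar N : ℂ)⁻¹‖ₑ with hκ
      have hκfin : κ ≠ ∞ := enorm_ne_top
      have hsum : κ * k + κ * (k * m) + m ≠ ∞ := by finiteness
      -- One constant for three bounds: κk for the Lipschitz estimate, κkm for the size of the
      -- generator and m for the trace norm on [-T, T].
      refine ⟨(κ * k + κ * (k * m) + m).toReal, ENNReal.toReal_nonneg, fun t ht => ?_⟩
      rw [ENNReal.ofReal_toReal hsum, adjoint_interaction, adjoint_interaction,
        ← interaction_sub, ← interaction_sub, enorm_interaction, enorm_interaction,
        traceNorm_interaction, traceNorm_interaction, LinearIsometryEquiv.map_smulₛₗ, hconjħ,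
        ← smul_sub, enorm_smul, enorm_smul, ← hκ]
      refine ⟨?_, ?_, (hmle t ht).trans le_add_self⟩
      · calc κ * ‖W t - adjoint (W t)‖ₑ ≤ κ * (k * traceNorm (ω t - adjoint (ω t))) := by
              gcongr
              exact (hmean t).enorm_sub_le_meanField (hmean' t) (hfin t) (hfin' t) hvm
          _ = κ * k * traceNorm (ω t - adjoint (ω t)) := (mul_assoc _ _ _).symm
          _ ≤ _ := by
              gcongr
              rw [add_assoc]
              exact le_self_add
      · calc κ * ‖W t‖ₑ ≤ κ * (k * m) := by
              gcongr
              refine ((hmean t).enorm_le_meanField (hfin t) hvm).trans ?_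
              gcongr
              exact hmle t ht
          _ ≤ κ * k + κ * (k * m) + m := by
              rw [add_right_comm]
              exact le_add_self
  have hadj' : ∀ t, adjoint (ω t) = ω t := fun t => by
    have := congrArg (interaction N (-t)) (hadj t)
    rwa [adjoint_interaction, interaction_neg_interaction, interaction_neg_interaction] at this
  refine ⟨W, hfin, hadj', hmean, fun t => ?_, hderiv⟩
  have h1 := (hmean' t).enorm_sub_le_meanField (hmean t) (hfin' t) (hfin t) hvm
  rw [hadj' t, sub_self, traceNorm_zero, mul_zero] at h1
  exact sub_eq_zero.mp (enorm_eq_zero.mp (le_antisymm h1 zero_le))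

theorem IsMeanFieldFlow.adjoint_interaction_smul {v : R3 → ℂ} {N : ℕ} {ω W : ℝ → Op}
    (h : IsMeanFieldFlow v N ω W) (t : ℝ) :
    adjoint (interaction N t (((hbar N)⁻¹ : ℂ) • W t)) =
      interaction N t (((hbar N)⁻¹ : ℂ) • W t) := by
  rw [adjoint_interaction, LinearIsometryEquiv.map_smulₛₗ, map_inv₀, Complex.conj_ofReal,
    h.adjoint_mean]

theorem IsMeanFieldFlow.le_initial {v : R3 → ℂ} {N : ℕ} {ω W : ℝ → Op}
    (h : IsMeanFieldFlow v N ω W) (t : ℝ) :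
    traceNorm (ω t) ≤ traceNorm (ω 0) ∧ ‖ω t‖ₑ ≤ ‖ω 0‖ₑ := by
  have hB : ∀ t, traceNorm (interaction N t (ω t)) ≠ ∞ := fun t => by
    rw [traceNorm_interaction]; exact h.finite t
  have hW := h.adjoint_interaction_smul
  have h1 := isIdealNorm_traceNorm.le_initial hB h.deriv hW t
  have h2 := isIdealNorm_enorm.le_initial hB h.deriv hW t
  simp only [traceNorm_interaction, enorm_interaction] at h1 h2
  exact ⟨h1, h2⟩

/-! ### Weyl operators in the interaction picture -/

/-- Conjugation by the free propagator moves phase space points along straight lines with velocity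
2ħp. The scalar phase does not affect trace norms. -/
theorem interaction_weylOp (N : ℕ) (t : ℝ) (p a : R3) :
    ∃ z : ℂ, ‖z‖ = 1 ∧ interaction N t (weylOp p a) = z • weylOp p (a + (2 * hbar N * t) • p) := by
  set κ := hbar N
  have h1 := freeProp_comp_waveOp κ (-t) p
  have h2 := freeProp_comp_transOp κ (-t) a
  have h3 : freeProp κ (-t) ∘L freeProp κ t = 1 := by
    rw [freeProp_comp, neg_add_cancel, freeProp_zero]
  have h4 := transOp_comp_waveOp ((-(2 * κ * -t)) • p) p
  have h5 := transOp_comp ((-(2 * κ * -t)) • p) a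
  have h6 : (-(2 * κ * -t)) • p + a = a + (2 * κ * t) • p := by
    rw [add_comm]
    congr 2
    ring
  rw [h6] at h5
  refine ⟨Complex.exp (Complex.I * ((-t * κ * ‖p‖ ^ 2 : ℝ) : ℂ)) *
    planeWave p ((-(2 * κ * -t)) • p), ?_, ?_⟩
  · rw [norm_mul, norm_planeWave, mul_one, mul_comm, Complex.norm_exp_ofReal_mul_I]
  · rw [interaction, weylOp, weylOp]
    simp only [← mul_def] at h1 h2 h3 h4 h5 ⊢
    rw [← mul_assoc, ← mul_assoc, h1, mul_assoc _ (freeProp κ (-t)), h2, ← mul_assoc, mul_assoc,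
      h3, mul_one, h4, smul_smul, smul_mul_assoc, mul_assoc (waveOp p), h5]

theorem enorm_eq_one_of_norm {z : ℂ} (hz : ‖z‖ = 1) : ‖z‖ₑ = 1 := by
  rw [← ofReal_norm, hz, ENNReal.ofReal_one]

theorem traceNorm_comm_interaction_weylOp (N : ℕ) (t : ℝ) (ω : Op) (p a : R3) :
    traceNorm (comm (interaction N t ω) (weylOp p (a + (2 * hbar N * t) • p))) =
      traceNorm (comm ω (weylOp p a)) := by
  obtain ⟨z, hz, h⟩ := interaction_weylOp N t p a
  rw [← traceNorm_interaction N t (comm ω _), interaction_comm, h, comm_smul_right, traceNorm_smul,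
    enorm_eq_one_of_norm hz, one_mul]

theorem traceNorm_comm_comm_interaction_weylOp (N : ℕ) (t : ℝ) (W ω : Op) (p a : R3) :
    traceNorm (comm (comm (interaction N t W) (weylOp p (a + (2 * hbar N * t) • p)))
      (interaction N t ω)) = traceNorm (comm (comm W (weylOp p a)) ω) := by
  obtain ⟨z, hz, h⟩ := interaction_weylOp N t p a
  rw [← traceNorm_interaction N t (comm (comm W _) ω), interaction_comm, interaction_comm, h,
    comm_smul_right, comm_smul_left, traceNorm_smul, enorm_eq_one_of_norm hz, one_mul]

theorem weylOp_zero_left (a : R3) : weylOp 0 a = transOp a := by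
  rw [weylOp, waveOp_zero, ← mul_def, one_mul]

theorem weylOp_zero_right (p : R3) : weylOp p 0 = waveOp p := by
  rw [weylOp, transOp_zero, ← mul_def, mul_one]

theorem traceNorm_comm_weylOp_le (ω : Op) (p a : R3) :
    traceNorm (comm ω (weylOp p a)) ≤
      traceNorm (comm ω (waveOp p)) + traceNorm (comm ω (transOp a)) := by
  rw [weylOp, comm_comp_right]
  exact (traceNorm_add_le _ _).trans (add_le_add ((traceNorm_comp_le_right _ _).trans
    (mul_le_of_le_one_left' (enorm_transOp_le a))) (traceNorm_waveOp_comp_le _ _))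

theorem traceNorm_comm_waveOp_nsmul_le (ω : Op) (p : R3) (n : ℕ) :
    traceNorm (comm ω (waveOp ((n : ℝ) • p))) ≤ n * traceNorm (comm ω (waveOp p)) := by
  induction n with
  | zero => rw [Nat.cast_zero, zero_smul, waveOp_zero, comm_one, traceNorm_zero]; exact zero_le
  | succ n ih =>
    rw [Nat.cast_succ, add_smul, one_smul, ← waveOp_comp, comm_comp_right, Nat.cast_succ, add_mul,
      one_mul]
    exact (traceNorm_add_le _ _).trans (add_le_add (((traceNorm_comp_le_right _ _).trans
      (mul_le_of_le_one_left' (enorm_waveOp_le p))).trans ih) (traceNorm_waveOp_comp_le _ _))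

/-- With n = ⌊|q|⌋ + 1, e^{iq·x} is the n-th power of a plane wave of frequency at most 1, and n ≤ 1
+ |q|. The weight 1+|p| in the statement thus allows propagation of bounded frequencies alone. -/
theorem traceNorm_comm_waveOp_le_of_ball {ω : Op} {S : ℝ≥0∞}
    (h : ∀ p, ‖p‖ ≤ 1 → traceNorm (comm ω (waveOp p)) ≤ S) (q : R3) :
    traceNorm (comm ω (waveOp q)) ≤ ENNReal.ofReal (1 + ‖q‖) * S := by
  set n := ⌊‖q‖⌋₊ + 1 with hn
  have hn0 : (0 : ℝ) < n := by positivity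
  have hq : q = (n : ℝ) • ((n : ℝ)⁻¹ • q) := by rw [smul_smul, mul_inv_cancel₀ hn0.ne', one_smul]
  have hle : ‖(n : ℝ)⁻¹ • q‖ ≤ 1 := by
    rw [norm_smul, norm_inv, Real.norm_of_nonneg hn0.le, inv_mul_le_one₀ hn0, hn]
    push_cast
    exact (Nat.lt_floor_add_one _).le
  conv_lhs => rw [hq]
  refine (traceNorm_comm_waveOp_nsmul_le ω _ n).trans (mul_le_mul' ?_ (h _ hle))
  rw [← ENNReal.ofReal_natCast]
  refine ENNReal.ofReal_le_ofReal ?_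
  rw [hn]
  push_cast
  linarith [Nat.floor_le (norm_nonneg q)]

end Flow

/-! ### Propagation of the semiclassical commutator bounds -/

section Commutators

open ContinuousLinearMap Filter
open scoped Topology

/-- The weight of the potential which determines the growth rate of the commutators. -/
def growthWeight (v : R3 → ℂ) : ℝ≥0∞ :=
  ∫⁻ ξ, ‖v ξ‖ₑ * ENNReal.ofReal
    (4 * ‖(2 * Real.pi) • ξ‖ * (2 + ‖(2 * Real.pi) • ξ‖) + 2)

/-- With y = 2π and x = |ξ|, the weight 4yx(2 + yx) + 2 is at most 8(1 + y²)(1 + x²), since 2yx ≤ 1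
+ y²x². -/
theorem growthWeight_ne_top {v : R3 → ℂ} (h : Integrable fun ξ => (1 + ‖ξ‖ ^ 2) * ‖v ξ‖) :
    growthWeight v ≠ ∞ := by
  have h1 : ∫⁻ ξ, ‖8 * (1 + (2 * Real.pi) ^ 2) * ((1 + ‖ξ‖ ^ 2) * ‖v ξ‖)‖ₑ < ∞ :=
    (h.const_mul (8 * (1 + (2 * Real.pi) ^ 2))).2
  refine (lt_of_le_of_lt (lintegral_mono fun ξ => ?_) h1).ne
  rw [← ofReal_norm (v ξ), ← ENNReal.ofReal_mul (norm_nonneg (v ξ)),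
    Real.enorm_of_nonneg (by positivity)]
  refine ENNReal.ofReal_le_ofReal ?_
  rw [norm_smul, Real.norm_of_nonneg (by positivity),
    mul_comm ‖v ξ‖, ← mul_assoc (8 * (1 + (2 * Real.pi) ^ 2))]
  refine mul_le_mul_of_nonneg_right ?_ (norm_nonneg (v ξ))
  set x := ‖ξ‖
  set y := 2 * Real.pi
  nlinarith [sq_nonneg (y * x - 1), sq_nonneg y, sq_nonneg x]

/-- The parameter `lam` is 1 for the Weyl operators and ‖b‖/ħ for the translation by b. It measures
both the displacement and the commutator with ω, and comes out linearly, so the rescaled translation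
(ħ/‖b‖)T_b has a bound independent of b. The factor ħ comes from ‖a‖ in the direct term and from N⁻¹
≤ ħ in the exchange term. -/
theorem traceNorm_comm_comm_le {v : R3 → ℂ} (hv : Measurable v) {N : ℕ} (hN : 1 ≤ N)
    {ω W : Op} (hW : IsWeakIntegral W (meanField v N ω)) (hω : traceNorm ω ≤ N) (hω1 : ‖ω‖ₑ ≤ 1)
    {S : ℝ≥0∞} {lam : ℝ} (hl0 : 0 ≤ lam) (hl1 : lam ≤ 1) {p a : R3}
    (ha : ‖a‖ ≤ 4 * lam * hbar N)
    (hS : ∀ q, traceNorm (comm ω (waveOp q)) ≤ ENNReal.ofReal (1 + ‖q‖) * S)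
    (hSA : traceNorm (comm ω (weylOp p a)) ≤ ENNReal.ofReal lam * S) :
    traceNorm (comm (comm W (weylOp p a)) ω) ≤
      ENNReal.ofReal (hbar N * lam) * growthWeight v * S := by
  have hħ := hbar_pos hN
  have hfin : traceNorm ω ≠ ∞ := (hω.trans_lt (ENNReal.natCast_lt_top N)).ne
  refine ((hW.comm_right _).comm_right _).traceNorm_le.trans ?_
  have hpt : ∀ ξ, traceNorm (comm (comm (meanField v N ω ξ) (weylOp p a)) ω) ≤
      ENNReal.ofReal (hbar N * lam) * (‖v ξ‖ₑ * ENNReal.ofReal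
        (4 * ‖(2 * Real.pi) • ξ‖ * (2 + ‖(2 * Real.pi) • ξ‖) + 2)) * S := by
    intro ξ
    refine (traceNorm_comm_comm_meanField_le v N hfin ξ p a).trans ?_
    set x := ‖(2 * Real.pi) • ξ‖ with hx
    have hx0 : 0 ≤ x := norm_nonneg _
    have hNr : ‖(N : ℂ)⁻¹‖ₑ = ENNReal.ofReal (N : ℝ)⁻¹ := by
      rw [← ofReal_norm, norm_inv, Complex.norm_natCast]
    have hN0 : (0 : ℝ) < N := by exact_mod_cast hN
    calc _ ≤ ENNReal.ofReal (N : ℝ)⁻¹ * ‖v ξ‖ₑ * (ENNReal.ofReal N *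
          (ENNReal.ofReal (x * (4 * lam * hbar N)) *
          (ENNReal.ofReal lam * S + ENNReal.ofReal (1 + x) * S)) +
          ENNReal.ofReal 2 * ENNReal.ofReal 1 * (ENNReal.ofReal lam * S)) := by
          rw [hNr, ENNReal.ofReal_natCast, ENNReal.ofReal_one,
            (by simp : ENNReal.ofReal 2 = 2)]
          gcongr
          exact hS _
      _ = ENNReal.ofReal ((N : ℝ)⁻¹ * (N * (x * (4 * lam * hbar N) * (lam + (1 + x))) +
          2 * 1 * lam)) * ‖v ξ‖ₑ * S := by
          have e0 : ∀ i n y u : ℝ, 0 ≤ i → 0 ≤ n → 0 ≤ y → 0 ≤ u →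
              ENNReal.ofReal (i * (n * (y * (lam + u)) + 2 * 1 * lam)) =
              ENNReal.ofReal i * (ENNReal.ofReal n * (ENNReal.ofReal y *
                (ENNReal.ofReal lam + ENNReal.ofReal u)) +
                ENNReal.ofReal 2 * ENNReal.ofReal 1 * ENNReal.ofReal lam) := by
            intro i n y u hi hn hy hu
            rw [ENNReal.ofReal_mul hi, ENNReal.ofReal_add (by positivity) (by positivity),
              ENNReal.ofReal_mul hn, ENNReal.ofReal_mul hy, ENNReal.ofReal_add hl0 hu,
              ENNReal.ofReal_mul (by norm_num : (0 : ℝ) ≤ 2 * 1),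
              ENNReal.ofReal_mul (by norm_num : (0 : ℝ) ≤ 2)]
          rw [e0 _ _ _ _ (by positivity) (by positivity) (by positivity) (by positivity)]
          ring
      _ ≤ ENNReal.ofReal (hbar N * lam * (4 * x * (2 + x) + 2)) * ‖v ξ‖ₑ * S := by
          refine mul_le_mul' (mul_le_mul' (ENNReal.ofReal_le_ofReal ?_) le_rfl) le_rfl
          have e : (N : ℝ)⁻¹ * (N * (x * (4 * lam * hbar N) * (lam + (1 + x))) + 2 * 1 * lam) =
              hbar N * lam * (4 * x * (lam + (1 + x))) + (N : ℝ)⁻¹ * (2 * lam) := by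
            field_simp
          rw [e, mul_add (hbar N * lam)]
          refine add_le_add ?_ ?_
          · exact mul_le_mul_of_nonneg_left (mul_le_mul_of_nonneg_left (by linarith) (by positivity))
              (by positivity)
          · rw [mul_assoc (hbar N), mul_comm lam 2]
            gcongr
            exact inv_le_hbar hN
      _ = _ := by
          rw [ENNReal.ofReal_mul (by positivity)]
          ring
  refine (lintegral_mono hpt).trans (le_of_eq ?_)
  have hm : Measurable fun ξ => ‖v ξ‖ₑ * ENNReal.ofReal
      (4 * ‖(2 * Real.pi) • ξ‖ * (2 + ‖(2 * Real.pi) • ξ‖) + 2) := by fun_prop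
  rw [lintegral_mul_const _ (by fun_prop), lintegral_const_mul _ hm, growthWeight]

/-- The family of observables used to propagate the commutator bounds over a unit of time. -/
def observables (N : ℕ) (b : R3) : Set Op :=
  {A | ∃ p a : R3, ‖p‖ ≤ 1 ∧ ‖a‖ ≤ 2 * hbar N ∧ A = weylOp p a} ∪
    {((hbar N / ‖b‖ : ℝ) : ℂ) • weylOp 0 b}

/-- This bound degenerates as b → 0, but only its finiteness for fixed b is used; the growth rate
does not depend on it. -/
theorem norm_le_of_mem_observables {N : ℕ} {b : R3} (hb : 0 < ‖b‖) (hb' : ‖b‖ ≤ hbar N) {A : Op}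
    (hA : A ∈ observables N b) : ‖A‖ ≤ hbar N / ‖b‖ := by
  rcases hA with ⟨p, a, _, _, rfl⟩ | hA
  · exact (norm_weylOp_le p a).trans ((one_le_div hb).mpr hb')
  · rw [Set.mem_singleton_iff.mp hA, norm_smul, Complex.norm_real,
      Real.norm_of_nonneg (div_nonneg (hb.le.trans hb') hb.le)]
    exact mul_le_of_le_one_right (div_nonneg (hb.le.trans hb') hb.le) (norm_weylOp_le _ _)

/-- The supremum of the commutators with the observables in the interaction picture. -/
def commSup (N : ℕ) (b : R3) (t : ℝ) (ω : Op) : ℝ≥0∞ :=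
  ⨆ A ∈ observables N b, traceNorm (comm (interaction N t ω) A)

/-- In the interaction picture a plane wave with |p| ≤ 1 acquires the displacement 2ħtp, of size at
most 2ħ while |t| ≤ 1. This fixes the radius in `observables` and the length of the time step. -/
theorem traceNorm_comm_waveOp_le_commSup {N : ℕ} (hħ : 0 < hbar N) (b : R3) {t : ℝ} (ht : |t| ≤ 1)
    (ω : Op) (q : R3) :
    traceNorm (comm ω (waveOp q)) ≤ ENNReal.ofReal (1 + ‖q‖) * commSup N b t ω := by
  refine traceNorm_comm_waveOp_le_of_ball (fun p hp => ?_) q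
  rw [← weylOp_zero_right, ← traceNorm_comm_interaction_weylOp N t]
  refine le_iSup₂_of_le (weylOp p (0 + (2 * hbar N * t) • p)) (Or.inl ⟨p, _, hp, ?_, rfl⟩) le_rfl
  rw [zero_add, norm_smul, Real.norm_eq_abs, abs_mul, abs_of_pos (by positivity : 0 < 2 * hbar N)]
  calc 2 * hbar N * |t| * ‖p‖ ≤ 2 * hbar N * 1 * 1 := by gcongr
    _ = 2 * hbar N := by ring

theorem traceNorm_comm_transOp_le_commSup {N : ℕ} (hħ : 0 < hbar N) {b : R3} (hb : 0 < ‖b‖) (t : ℝ)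
    (ω : Op) :
    traceNorm (comm ω (weylOp 0 b)) ≤ ENNReal.ofReal (‖b‖ / hbar N) * commSup N b t ω := by
  have h1 : traceNorm (comm (interaction N t ω) (((hbar N / ‖b‖ : ℝ) : ℂ) • weylOp 0 b)) ≤
      commSup N b t ω := le_iSup₂_of_le _ (Or.inr rfl) le_rfl
  have h2 := traceNorm_comm_interaction_weylOp N t ω 0 b
  rw [smul_zero, add_zero] at h2
  rw [comm_smul_right, traceNorm_smul, h2, ← ofReal_norm, Complex.norm_real,
    Real.norm_of_nonneg (by positivity)] at h1
  calc traceNorm (comm ω (weylOp 0 b)) = ENNReal.ofReal (‖b‖ / hbar N) *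
        (ENNReal.ofReal (hbar N / ‖b‖) * traceNorm (comm ω (weylOp 0 b))) := by
        rw [← mul_assoc, ← ENNReal.ofReal_mul (by positivity)]
        have : ‖b‖ / hbar N * (hbar N / ‖b‖) = 1 := by field_simp
        rw [this, ENNReal.ofReal_one, one_mul]
    _ ≤ _ := by gcongr

theorem IsMeanFieldFlow.traceNorm_comm_comm_observables_le {v : R3 → ℂ} (hv : Measurable v) {N : ℕ}
    (hN : 1 ≤ N) {ω W : ℝ → Op} (h : IsMeanFieldFlow v N ω W) (hω : ∀ t, traceNorm (ω t) ≤ N)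
    (hω1 : ∀ t, ‖ω t‖ₑ ≤ 1) {b : R3} (hb : 0 < ‖b‖) (hb' : ‖b‖ ≤ hbar N) {t : ℝ} (ht : |t| ≤ 1)
    {A : Op} (hA : A ∈ observables N b) :
    traceNorm (comm (comm (interaction N t (((hbar N)⁻¹ : ℂ) • W t)) A)
      (interaction N t (ω t))) ≤ growthWeight v * commSup N b t (ω t) := by
  have hħ := hbar_pos hN
  have hħn : ‖((hbar N)⁻¹ : ℂ)‖ₑ = ENNReal.ofReal (hbar N)⁻¹ := by
    rw [← ofReal_norm, norm_inv, Complex.norm_real, Real.norm_of_nonneg hħ.le]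
  have hwave := traceNorm_comm_waveOp_le_commSup hħ b ht (ω t)
  rw [interaction_smul, comm_smul_left, comm_smul_left, traceNorm_smul, hħn]
  rcases hA with ⟨p, a, hp, ha, rfl⟩ | hA
  · have ha2 : a = (a - (2 * hbar N * t) • p) + (2 * hbar N * t) • p := by abel
    -- Undoing the free flow: the displacement 2ħ allowed in the family plus at most 2ħ|t||p| ≤ 2ħ.
    have hna : ‖a - (2 * hbar N * t) • p‖ ≤ 4 * 1 * hbar N := by
      refine (norm_sub_le _ _).trans ?_
      rw [norm_smul, Real.norm_eq_abs, abs_mul, abs_of_pos (by positivity : 0 < 2 * hbar N)]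
      have : 2 * hbar N * |t| * ‖p‖ ≤ 2 * hbar N * 1 * 1 := by gcongr
      linarith
    have hSA : traceNorm (comm (ω t) (weylOp p (a - (2 * hbar N * t) • p))) ≤
        ENNReal.ofReal 1 * commSup N b t (ω t) := by
      rw [← traceNorm_comm_interaction_weylOp N t, ← ha2, ENNReal.ofReal_one, one_mul]
      exact le_iSup₂_of_le (weylOp p a) (Or.inl ⟨p, a, hp, ha, rfl⟩) le_rfl
    have key := traceNorm_comm_comm_le hv hN (h.mean t) (hω t) (hω1 t) zero_le_one le_rfl hna
      hwave hSA
    rw [← traceNorm_comm_comm_interaction_weylOp N t, ← ha2, mul_one] at key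
    refine (mul_le_mul_right key _).trans (le_of_eq ?_)
    rw [mul_assoc, ← mul_assoc, ← ENNReal.ofReal_mul (by positivity), inv_mul_cancel₀ hħ.ne',
      ENNReal.ofReal_one, one_mul]
  · rw [Set.mem_singleton_iff.mp hA, comm_smul_right, comm_smul_left, traceNorm_smul, ← ofReal_norm,
      Complex.norm_real, Real.norm_of_nonneg (by positivity)]
    have key := traceNorm_comm_comm_le hv hN (h.mean t) (hω t) (hω1 t)
      (lam := ‖b‖ / hbar N) (by positivity) ((div_le_one hħ).mpr hb') (p := 0) (a := b)
      (by rw [mul_assoc, div_mul_cancel₀ _ hħ.ne']; linarith) hwave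
      (traceNorm_comm_transOp_le_commSup hħ hb t (ω t))
    rw [← traceNorm_comm_comm_interaction_weylOp N t, smul_zero, add_zero] at key
    refine (mul_le_mul_right (mul_le_mul_right key _) _).trans (le_of_eq ?_)
    rw [← mul_assoc, mul_assoc (ENNReal.ofReal (hbar N * _)), ← mul_assoc,
      ← ENNReal.ofReal_mul (by positivity), ← ENNReal.ofReal_mul (by positivity)]
    have : (hbar N)⁻¹ * (hbar N / ‖b‖) * (hbar N * (‖b‖ / hbar N)) = 1 := by field_simp
    rw [this, ENNReal.ofReal_one, one_mul]

theorem traceNorm_comm_waveOp_le_waveCommNorm (ω : Op) (p : R3) :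
    traceNorm (comm ω (waveOp p)) ≤ ENNReal.ofReal (1 + ‖p‖) * waveCommNorm ω := by
  have h1 : ENNReal.ofReal (1 / (1 + ‖p‖)) * traceNorm (comm ω (waveOp p)) ≤ waveCommNorm ω :=
    le_iSup (fun p : R3 => ENNReal.ofReal (1 / (1 + ‖p‖)) *
      traceNorm (comm ω (mulOp (planeWave p)))) p
  calc traceNorm (comm ω (waveOp p)) = ENNReal.ofReal (1 + ‖p‖) *
        (ENNReal.ofReal (1 / (1 + ‖p‖)) * traceNorm (comm ω (waveOp p))) := by
        rw [← mul_assoc, ← ENNReal.ofReal_mul (by positivity)]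
        have : (1 + ‖p‖) * (1 / (1 + ‖p‖)) = 1 := by
          have : 0 ≤ ‖p‖ := norm_nonneg _
          field_simp
        rw [this, ENNReal.ofReal_one, one_mul]
    _ ≤ _ := by gcongr

theorem waveCommNorm_le {ω : Op} {M : ℝ≥0∞}
    (h : ∀ q, traceNorm (comm ω (waveOp q)) ≤ ENNReal.ofReal (1 + ‖q‖) * M) :
    waveCommNorm ω ≤ M := by
  refine iSup_le fun p => (mul_le_mul_right (h p) _).trans (le_of_eq ?_)
  rw [← mul_assoc, ← ENNReal.ofReal_mul (by positivity)]
  have : 1 / (1 + ‖p‖) * (1 + ‖p‖) = 1 := by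
    have : 0 ≤ ‖p‖ := norm_nonneg _
    field_simp
  rw [this, ENNReal.ofReal_one, one_mul]

/-- The larger of the two semiclassical commutator norms. -/
def semiclassicalNorm (N : ℕ) (ω : Op) : ℝ≥0∞ := max (waveCommNorm ω) (gradCommNorm N ω)

/-- A Weyl operator in the family costs 1 + |p| ≤ 2 for its plane wave and |a|/ħ ≤ 2 for its
translation; the rescaled translation costs only 1. -/
theorem commSup_zero_le {N : ℕ} (hħ : 0 < hbar N) {b : R3} (hb : 0 < ‖b‖) (ω : Op) :
    commSup N b 0 ω ≤ 4 * semiclassicalNorm N ω := by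
  set x := semiclassicalNorm N ω
  have hw : waveCommNorm ω ≤ x := le_max_left _ _
  have hg : gradCommNorm N ω ≤ x := le_max_right _ _
  refine iSup₂_le fun A hA => ?_
  rw [interaction_zero_time]
  rcases hA with ⟨p, a, hp, ha, rfl⟩ | hA
  · calc _ ≤ _ := traceNorm_comm_weylOp_le ω p a
      _ ≤ ENNReal.ofReal 2 * x + ENNReal.ofReal 2 * x := by
        refine add_le_add ((traceNorm_comm_waveOp_le_waveCommNorm ω p).trans
          (mul_le_mul' (ENNReal.ofReal_le_ofReal (by linarith)) hw))
          ((traceNorm_comm_transOp_le hħ ω a).trans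
          (mul_le_mul' (ENNReal.ofReal_le_ofReal ?_) hg))
        rwa [div_le_iff₀ hħ]
      _ = 4 * x := by
        rw [← add_mul, ← ENNReal.ofReal_add (by norm_num) (by norm_num)]
        norm_num
  · rw [Set.mem_singleton_iff.mp hA, comm_smul_right, traceNorm_smul, ← ofReal_norm,
      Complex.norm_real, Real.norm_of_nonneg (by positivity), weylOp_zero_left]
    calc _ ≤ ENNReal.ofReal (hbar N / ‖b‖) * (ENNReal.ofReal (‖b‖ / hbar N) * x) := by
          gcongr
          exact (traceNorm_comm_transOp_le hħ ω b).trans (by gcongr)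
      _ = 1 * x := by
        rw [← mul_assoc, ← ENNReal.ofReal_mul (by positivity)]
        have : hbar N / ‖b‖ * (‖b‖ / hbar N) = 1 := by field_simp
        rw [this, ENNReal.ofReal_one]
      _ ≤ 4 * x := by gcongr; norm_num

/-- Growth of the commutator norms over a unit of time. -/
theorem IsMeanFieldFlow.semiclassicalNorm_le {v : R3 → ℂ} (hv : Measurable v)
    (hvfin : growthWeight v ≠ ∞) {N : ℕ} (hN : 1 ≤ N) {ω W : ℝ → Op} (h : IsMeanFieldFlow v N ω W)
    (h0 : traceNorm (ω 0) ≤ N) (h1 : ‖ω 0‖ₑ ≤ 1) {t : ℝ} (ht : |t| ≤ 1) :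
    semiclassicalNorm N (ω t) ≤
      ENNReal.ofReal (12 * Real.exp (growthWeight v).toReal) * semiclassicalNorm N (ω 0) := by
  have hħ := hbar_pos hN
  set x := semiclassicalNorm N (ω 0)
  set c := (growthWeight v).toReal with hc
  set M : ℝ≥0∞ := ENNReal.ofReal (Real.exp c) * (4 * x) with hM
  have hc0 : 0 ≤ c := ENNReal.toReal_nonneg
  have hω : ∀ t, traceNorm (ω t) ≤ N := fun t => (h.le_initial t).1.trans h0
  have hω1 : ∀ t, ‖ω t‖ₑ ≤ 1 := fun t => (h.le_initial t).2.trans h1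
  -- The bound M does not involve b, so b may tend to 0 when the gradient is recovered.
  have hS : ∀ b : R3, 0 < ‖b‖ → ‖b‖ ≤ hbar N → commSup N b t (ω t) ≤ M := by
    intro b hb hb'
    have hB : ∀ t, traceNorm (interaction N t (ω t)) ≠ ∞ := fun t => by
      rw [traceNorm_interaction]; exact h.finite t
    have key := iSup_traceNorm_comm_le hB h.deriv h.adjoint_interaction_smul
      (𝒜 := observables N b) (fun A hA => norm_le_of_mem_observables hb hb' hA) (T := 1) hc0
      (fun s hs A hA => by
        rw [ENNReal.ofReal_toReal hvfin]
        exact h.traceNorm_comm_comm_observables_le hv hN hω hω1 hb hb' hs hA) t ht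
    refine key.trans (mul_le_mul' (ENNReal.ofReal_le_ofReal (Real.exp_le_exp.mpr ?_))
      (commSup_zero_le hħ hb (ω 0)))
    exact mul_le_of_le_one_right hc0 ht
  have hM12 : 3 * M = ENNReal.ofReal (12 * Real.exp c) * x := by
    rw [hM, ENNReal.ofReal_mul (by norm_num), (by norm_num : ENNReal.ofReal 12 = 3 * 4)]
    ring
  rw [← hM12]
  refine max_le ?_ ?_
  · have hle : M ≤ 3 * M := le_mul_of_one_le_left' (by norm_num)
    refine (waveCommNorm_le fun q => ?_).trans hle
    -- Any admissible b serves for the plane waves, which belong to every family.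
    set b : R3 := EuclideanSpace.single 0 (hbar N)
    have hb : ‖b‖ = hbar N := by rw [PiLp.norm_single, Real.norm_of_nonneg hħ.le]
    exact (traceNorm_comm_waveOp_le_commSup hħ b ht (ω t) q).trans
      (mul_le_mul_right (hS b (by rwa [hb]) hb.le) _)
  · refine gradCommNorm_le hħ hħ fun b hb hb' => ?_
    rw [← weylOp_zero_left]
    exact (traceNorm_comm_transOp_le_commSup hħ hb t (ω t)).trans
      (mul_le_mul_right (hS b hb hb') _)

/-- The equation is autonomous, so the unit-time estimate can be restarted at any time. -/
theorem IsHFSolution.comp_add {V : R3 → ℝ} {N : ℕ} {ω : ℝ → Op} (h : IsHFSolution V N ω) (τ : ℝ) :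
    IsHFSolution V N fun t => ω (τ + t) where
  traceClass t := h.traceClass (τ + t)
  continuous t := (h.continuous (τ + t)).comp
    ((continuous_const.add continuous_id).tendsto t)
  equation t := by
    obtain ⟨ρ, X, hρ, hX, heq⟩ := h.equation (τ + t)
    exact ⟨ρ, X, hρ, hX, fun φ ψ => (heq φ ψ).comp_const_add τ t⟩

theorem continuous_fourier_ofReal {V : R3 → ℝ} (hV : Integrable V) :
    Continuous (𝓕 fun x => (V x : ℂ)) :=
  VectorFourier.fourierIntegral_continuous Real.continuous_fourierChar
    (innerSL ℝ).continuous₂ hV.ofReal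

theorem integrable_of_integrable_weighted {v : R3 → ℂ} (hv : Continuous v)
    (h : Integrable fun ξ => (1 + ‖ξ‖ ^ 2) * ‖v ξ‖) : Integrable v :=
  h.mono' hv.aestronglyMeasurable (Eventually.of_forall fun ξ =>
    le_mul_of_one_le_left (norm_nonneg _) (by nlinarith [sq_nonneg ‖ξ‖]))

/-- Exponential growth of the commutator norms along a solution of the Hartree-Fock equation. -/
theorem IsHFSolution.semiclassicalNorm_le {V : R3 → ℝ} (hV : Integrable V)
    (hVeven : ∀ᵐ x, V (-x) = V x)
    (hVhat : Integrable fun p => (1 + ‖p‖ ^ 2) * ‖𝓕 (fun x => (V x : ℂ)) p‖)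
    {N : ℕ} (hN : 1 ≤ N) {ω : ℝ → Op} (h : IsHFSolution V N ω) (hadj : adjoint (ω 0) = ω 0)
    (h0 : traceNorm (ω 0) ≤ N) (h1 : ‖ω 0‖ₑ ≤ 1) {K : ℝ}
    (hK : K = 12 * Real.exp (growthWeight (𝓕 fun x => (V x : ℂ))).toReal) (t : ℝ) :
    semiclassicalNorm N (ω t) ≤
      ENNReal.ofReal (K * Real.exp (Real.log K * |t|)) * semiclassicalNorm N (ω 0) := by
  set v := 𝓕 (fun x => (V x : ℂ)) with hv
  have hvc : Continuous v := continuous_fourier_ofReal hV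
  have hvi := integrable_of_integrable_weighted hvc hVhat
  have hK12 : 12 ≤ K := by
    rw [hK]
    have := Real.one_le_exp (x := (growthWeight v).toReal) ENNReal.toReal_nonneg
    linarith
  obtain ⟨W, hW⟩ := h.exists_isMeanFieldFlow hV hVeven hvi hvc.measurable hN hadj
  have hstep : ∀ s τ : ℝ, |τ| ≤ 1 → semiclassicalNorm N (ω (s + τ)) ≤
      ENNReal.ofReal K * semiclassicalNorm N (ω s) := by
    intro s τ hτ
    have hs := h.comp_add s
    obtain ⟨W', hW'⟩ := hs.exists_isMeanFieldFlow hV hVeven hvi hvc.measurable hN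
      (by rw [add_zero]; exact hW.adjoint_eq s)
    have := hW'.semiclassicalNorm_le hvc.measurable (growthWeight_ne_top hVhat) hN
      (by rw [add_zero]; exact (hW.le_initial s).1.trans h0)
      (by rw [add_zero]; exact (hW.le_initial s).2.trans h1) hτ
    rwa [add_zero, ← hK] at this
  set n := ⌊|t|⌋₊ + 1 with hn
  have hn0 : (0 : ℝ) < n := by positivity
  have hiter : ∀ k : ℕ, semiclassicalNorm N (ω (k * (t / n))) ≤
      ENNReal.ofReal K ^ k * semiclassicalNorm N (ω 0) := by
    intro k
    induction k with
    | zero => simp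
    | succ k ih =>
      have e : ((k + 1 : ℕ) : ℝ) * (t / n) = k * (t / n) + t / n := by push_cast; ring
      rw [e, pow_succ', mul_assoc]
      refine (hstep _ _ ?_).trans (mul_le_mul_right ih _)
      rw [abs_div, abs_of_pos hn0, div_le_one hn0, hn]
      push_cast
      exact (Nat.lt_floor_add_one _).le
  have hfinal := hiter n
  rw [mul_div_cancel₀ t hn0.ne', ← ENNReal.ofReal_pow (by linarith)] at hfinal
  refine hfinal.trans (mul_le_mul_left (ENNReal.ofReal_le_ofReal ?_) _)
  -- With ⌊|t|⌋ + 1 steps of length at most 1, K^{⌊|t|⌋+1} = K·K^{⌊|t|⌋} ≤ K e^{|t| log K}, because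
  -- K ≥ 1.
  rw [hn, pow_succ', ← Real.rpow_natCast, Real.rpow_def_of_pos (by linarith)]
  gcongr
  · exact Real.log_nonneg (by linarith)
  · exact Nat.floor_le (abs_nonneg t)

end Commutators

end

end HartreeFock


/-! ### The theorem. -/

theorem proposition3p4
    (V : HartreeFock.R3 → ℝ)
    (hV : MeasureTheory.Integrable V)
    (hVeven : ∀ᵐ x, V (-x) = V x)
    -- finiteness does not depend on the normalization of the Fourier transform
    (hVhat : MeasureTheory.Integrable
      (fun p => (1 + ‖p‖ ^ 2) * ‖FourierTransform.fourier (fun x => (V x : ℂ)) p‖)) :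
    ∃ K c : ℝ, 0 < K ∧ 0 < c ∧
      ∀ (N : ℕ), 1 ≤ N →
      ∀ (ω₀ : HartreeFock.Op), ω₀.IsPositive → ‖ω₀‖ ≤ 1 →
        HartreeFock.IsTraceClass ω₀ → HartreeFock.opTrace ω₀ = (N : ℂ) →
      ∀ (C : ℝ), 0 ≤ C →
        HartreeFock.waveCommNorm ω₀ ≤ ENNReal.ofReal (C * N * HartreeFock.hbar N) →
        HartreeFock.gradCommNorm N ω₀ ≤ ENNReal.ofReal (C * N * HartreeFock.hbar N) →
      ∀ (ω : ℝ → HartreeFock.Op), HartreeFock.IsHFSolution V N ω → ω 0 = ω₀ →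
      ∀ t : ℝ,
        HartreeFock.waveCommNorm (ω t) ≤
            ENNReal.ofReal (K * C * N * HartreeFock.hbar N * Real.exp (c * |t|)) ∧
          HartreeFock.gradCommNorm N (ω t) ≤
            ENNReal.ofReal (K * C * N * HartreeFock.hbar N * Real.exp (c * |t|)) := by
  set K : ℝ := 12 * Real.exp
    (HartreeFock.growthWeight (FourierTransform.fourier fun x => (V x : ℂ))).toReal with hK
  have hK12 : 12 ≤ K := by
    have := Real.one_le_exp
      (x := (HartreeFock.growthWeight (FourierTransform.fourier fun x => (V x : ℂ))).toReal)
      ENNReal.toReal_nonneg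
    linarith
  refine ⟨K, Real.log K, by linarith, Real.log_pos (by linarith), ?_⟩
  intro N hN ω₀ hpos hnorm htc htr C hC hwave hgrad ω hω h0 t
  -- For a positive operator the trace norm is the trace; this is the form in which tr ω_N = N is
  -- used.
  have h1 : HartreeFock.traceNorm ω₀ ≤ N := by
    rw [HartreeFock.traceNorm_eq_opTrace hpos htc.ne, htr, Complex.natCast_re,
      ENNReal.ofReal_natCast]
  have key := hω.semiclassicalNorm_le hV hVeven hVhat hN (by rw [h0]; exact hpos.isSelfAdjoint)
    (by rwa [h0]) (by rw [h0]; exact HartreeFock.enorm_le_one_of_norm_le_one hnorm) hK t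
  have hbound : HartreeFock.semiclassicalNorm N (ω t) ≤
      ENNReal.ofReal (K * C * N * HartreeFock.hbar N * Real.exp (Real.log K * |t|)) := by
    refine key.trans ((mul_le_mul_right (h0 ▸ max_le hwave hgrad) _).trans (le_of_eq ?_))
    rw [← ENNReal.ofReal_mul (by positivity)]
    congr 1
    ring
  exact ⟨(le_max_left _ _).trans hbound, (le_max_right _ _).trans hbound⟩
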